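/- All vector spaces and algebras are over $\mathbb{C}$. Let $n\ge 2$ and let $\mathfrak g=\mathfrak p(n)\subseteq\mathfrak{gl}(n+1|n+1)$ be the periplectic Lie superalgebra of block matrices $\begin{pmatrix}X&Y\\Z&-X^t\end{pmatrix}$ with $\operatorname{tr}X=0$, $Y^t=Y$, $Z^t=-Z$, where $\mathfrak g_{\bar 0}$ and $\mathfrak g_{\bar 1}$ consist of the block diagonal and block antidiagonal matrices and the bracket is the supercommutator. Let $A$ be a finitely generated associative commutative algebra with unit, and let $\Gamma$ be a finite abelian group acting on $\mathfrak g$ and on $A$ by automorphisms (of Lie superalgebras and of $\mathbb C$-algebras, respectively) such that the induced action on $\operatorname{maxspec}(A)$, $\gamma\mathsf m=\{\gamma a: a\in\mathsf m\}$, is free. Let $(\mathfrak g\otimes A)^\Gamma$ be the Lie superalgebra of fixed points of the diagonal action on $\mathfrak g\otimes A$, whose bracket is $[x\otimes a,y\otimes b]=[x,y]\otimes ab$. Modules are $\mathbb Z_2$-graded; irreducible means nonzero without proper nonzero graded submodules; two modules are isomorphic if there is a bijective homogeneous (even or odd) module homomorphism between them. For a Lie superalgebra $\mathfrak a$, let $\operatorname{Irred}(\mathfrak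 a)$ be the set of isomorphism classes of finite-dimensional irreducible $\mathfrak a$-modules. The group $\Gamma$ acts on $\operatorname{Irred}(\mathfrak g)$ by $\gamma[V]=[V^\gamma]$, where $x\in\mathfrak g$ acts on $V^\gamma=V$ as $\gamma^{-1}x$ acts on $V$. For $\mathsf m\in\operatorname{maxspec}(A)$ and a $\mathfrak g$-module $V$, let $\operatorname{ev}^\Gamma_{\mathsf m}(V)$ be the pull-back of $V$ along $(\mathfrak g\otimes A)^\Gamma\hookrightarrow\mathfrak g\otimes A\to\mathfrak g\otimes A/\mathsf m\cong\mathfrak g$. Let $\mathcal P$ be the set of $\Gamma$-equivariant functions $\pi:\operatorname{maxspec}(A)\to\operatorname{Irred}(\mathfrak g)$ such that $\pi(\mathsf m)$ is the class $[\mathbb C]$ of the trivial module for all but finitely many $\mathsf m$. For each $\pi\in\mathcal P$ there is a finite set $\operatorname{Supp}_*(\pi)$ containing exactly one element of each $\Gamma$-orbit in $\operatorname{Supp}(\pi)=\{\mathsf m:\pi(\mathsf m)\ne[\mathbb C]\}$ and contained in $\operatorname{Supp}(\pi)$; fix any such set together with an ordering of it, and put $$\mathcal V(\pi)=\bigotimes_{\mathsf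 m\in\operatorname{Supp}_*(\pi)}\operatorname{ev}^\Gamma_{\mathsf m}\pi(\mathsf m),$$ where $\pi(\mathsf m)$ also denotes a fixed representative of the class, and the empty tensor product is the trivial module $\mathbb C$. Then, whatever the choices of the $\operatorname{Supp}_*(\pi)$ and their orderings, every $\mathcal V(\pi)$ is a finite-dimensional irreducible $(\mathfrak g\otimes A)^\Gamma$-module, and the map $\mathcal P\to\operatorname{Irred}\big((\mathfrak g\otimes A)^\Gamma\big)$, $\pi\mapsto[\mathcal V(\pi)]$, is a bijection. In particular every finite-dimensional irreducible $(\mathfrak g\otimes A)^\Gamma$-module is isomorphic to $\mathcal V(\pi)$ for a unique $\pi\in\mathcal P$. -/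

import Mathlib

open scoped TensorProduct

noncomputable section

namespace EquivMap

/-! ### Super vector spaces and Lie superalgebras over `ℂ` -/

/-- The Koszul sign `(-1)^{ij}` for `i, j ∈ ℤ/2`. -/
def ksign (i j : ZMod 2) : ℂ := (-1) ^ (i.val * j.val)

theorem ksign_zero_left (j : ZMod 2) : ksign 0 j = 1 := by simp [ksign]

theorem ksign_zero_right (i : ZMod 2) : ksign i 0 = 1 := by simp [ksign]

theorem ksign_one_one : ksign 1 1 = -1 := by simp [ksign, ZMod.val_one]

theorem zmod2_cases : ∀ i : ZMod 2, i = 0 ∨ i = 1 := by decide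

theorem zmod2_one_add_one : (1 + 1 : ZMod 2) = 0 := by decide

/-- A `ℤ/2`-grading `V = V₀ ⊕ V₁` of a complex vector space. -/
structure SuperGrading (V : Type*) [AddCommGroup V] [Module ℂ V] where
  gr : ZMod 2 → Submodule ℂ V
  isCompl : IsCompl (gr 0) (gr 1)

section Grading

variable {V W : Type*} [AddCommGroup V] [Module ℂ V] [AddCommGroup W] [Module ℂ W]

/-- Two subspaces that span and are separated by an operator acting as `1` resp. `-1`. -/
theorem isCompl_of_parity (p q : Submodule ℂ V) (s : V →ₗ[ℂ] V)
    (hp : ∀ v ∈ p, s v = v) (hq : ∀ v ∈ q, s v = -v) (h : ⊤ ≤ p ⊔ q) : IsCompl p q := by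
  refine ⟨Submodule.disjoint_def.2 fun v h1 h2 => ?_, codisjoint_iff.2 (top_le_iff.1 h)⟩
  have h3 : v = -v := (hp v h1).symm.trans (hq v h2)
  have h4 : (2 : ℂ) • v = 0 := by rw [two_smul]; nth_rewrite 1 [h3]; exact neg_add_cancel v
  exact (smul_eq_zero.1 h4).resolve_left two_ne_zero

namespace SuperGrading

/-- The projection of `V` onto its homogeneous component of degree `i`. -/
def proj (G : SuperGrading V) (i : ZMod 2) : V →ₗ[ℂ] V :=
  if i = 0 then (G.gr 0).projection (G.gr 1) G.isCompl
  else (G.gr 1).projection (G.gr 0) G.isCompl.symm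

theorem proj_mem (G : SuperGrading V) (i : ZMod 2) (v : V) : G.proj i v ∈ G.gr i := by
  fin_cases i
  · exact Submodule.projection_apply_mem _ _
  · exact Submodule.projection_apply_mem _ _

theorem proj_of_mem (G : SuperGrading V) {i : ZMod 2} (j : ZMod 2) {v : V} (h : v ∈ G.gr i) :
    G.proj j v = if j = i then v else 0 := by
  rcases zmod2_cases i with rfl | rfl <;> rcases zmod2_cases j with rfl | rfl
  · exact Submodule.projection_apply_of_mem_left _ h
  · exact (Submodule.projection_apply_eq_zero_iff _).2 h
  · exact (Submodule.projection_apply_eq_zero_iff _).2 h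
  · exact Submodule.projection_apply_of_mem_left _ h

theorem proj_add (G : SuperGrading V) (v : V) : G.proj 0 v + G.proj 1 v = v :=
  Submodule.projection_add_projection_eq_self G.isCompl v

/-- The parity operator: `v ↦ (-1)^i v` on `V_i`. -/
def parity (G : SuperGrading V) : V →ₗ[ℂ] V := G.proj 0 - G.proj 1

theorem parity_of_mem (G : SuperGrading V) {i : ZMod 2} {v : V} (h : v ∈ G.gr i) :
    G.parity v = ksign 1 i • v := by
  simp only [parity, LinearMap.sub_apply, G.proj_of_mem _ h]
  rcases zmod2_cases i with rfl | rfl <;> simp [ksign_zero_right, ksign_one_one]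

/-- The graded tensor product: `(V ⊗ W)_k` is spanned by `v ⊗ w` with `|v| + |w| = k`. -/
def tensor (G : SuperGrading V) (H : SuperGrading W) : SuperGrading (V ⊗[ℂ] W) where
  gr k := Submodule.span ℂ
    {t | ∃ i j : ZMod 2, i + j = k ∧ ∃ v ∈ G.gr i, ∃ w ∈ H.gr j, t = v ⊗ₜ[ℂ] w}
  isCompl := by
    refine isCompl_of_parity _ _ (TensorProduct.map G.parity H.parity) ?_ ?_ ?_
    · intro t ht
      induction ht using Submodule.span_induction with
      | mem t h =>
        obtain ⟨i, j, hij, v, hv, w, hw, rfl⟩ := h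
        rw [TensorProduct.map_tmul, G.parity_of_mem hv, H.parity_of_mem hw]
        rcases zmod2_cases i with rfl | rfl <;> rcases zmod2_cases j with rfl | rfl <;>
          first
          | (exfalso; revert hij; decide)
          | simp [ksign_zero_right, ksign_one_one, TensorProduct.neg_tmul,
              TensorProduct.tmul_neg]
      | zero => simp
      | add x y _ _ hx hy => rw [map_add, hx, hy]
      | smul c x _ hx => rw [map_smul, hx]
    · intro t ht
      induction ht using Submodule.span_induction with
      | mem t h =>
        obtain ⟨i, j, hij, v, hv, w, hw, rfl⟩ := h
        rw [TensorProduct.map_tmul, G.parity_of_mem hv, H.parity_of_mem hw]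
        rcases zmod2_cases i with rfl | rfl <;> rcases zmod2_cases j with rfl | rfl <;>
          first
          | (exfalso; revert hij; decide)
          | simp [ksign_zero_right, ksign_one_one, TensorProduct.neg_tmul,
              TensorProduct.tmul_neg]
      | zero => simp
      | add x y _ _ hx hy => rw [map_add, hx, hy, neg_add]
      | smul c x _ hx => rw [map_smul, hx, smul_neg]
    · rintro t -
      induction t with
      | zero => exact zero_mem _
      | add x y hx hy => exact add_mem hx hy
      | tmul v w =>
        rw [← G.proj_add v, ← H.proj_add w, TensorProduct.add_tmul, TensorProduct.tmul_add,
          TensorProduct.tmul_add]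
        refine add_mem (add_mem ?_ ?_) (add_mem ?_ ?_)
        · exact Submodule.mem_sup_left (Submodule.subset_span
            ⟨0, 0, by decide, _, G.proj_mem 0 v, _, H.proj_mem 0 w, rfl⟩)
        · exact Submodule.mem_sup_right (Submodule.subset_span
            ⟨0, 1, by decide, _, G.proj_mem 0 v, _, H.proj_mem 1 w, rfl⟩)
        · exact Submodule.mem_sup_right (Submodule.subset_span
            ⟨1, 0, by decide, _, G.proj_mem 1 v, _, H.proj_mem 0 w, rfl⟩)
        · exact Submodule.mem_sup_left (Submodule.subset_span
            ⟨1, 1, by decide, _, G.proj_mem 1 v, _, H.proj_mem 1 w, rfl⟩)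

/-- The grading `(V ⊗ W)_k = V_k ⊗ W`, with `W` purely even. -/
def extend (G : SuperGrading V) (W : Type*) [AddCommGroup W] [Module ℂ W] :
    SuperGrading (V ⊗[ℂ] W) where
  gr k := Submodule.span ℂ {t | ∃ v ∈ G.gr k, ∃ w : W, t = v ⊗ₜ[ℂ] w}
  isCompl := by
    refine isCompl_of_parity _ _ (G.parity.rTensor W) ?_ ?_ ?_
    · intro t ht
      induction ht using Submodule.span_induction with
      | mem t h =>
        obtain ⟨v, hv, w, rfl⟩ := h
        rw [LinearMap.rTensor_tmul, G.parity_of_mem hv]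
        simp [ksign]
      | zero => simp
      | add x y _ _ hx hy => rw [map_add, hx, hy]
      | smul c x _ hx => rw [map_smul, hx]
    · intro t ht
      induction ht using Submodule.span_induction with
      | mem t h =>
        obtain ⟨v, hv, w, rfl⟩ := h
        rw [LinearMap.rTensor_tmul, G.parity_of_mem hv]
        simp [ksign, ZMod.val_one, TensorProduct.neg_tmul]
      | zero => simp
      | add x y _ _ hx hy => rw [map_add, hx, hy, neg_add]
      | smul c x _ hx => rw [map_smul, hx, smul_neg]
    · rintro t -
      induction t with
      | zero => exact zero_mem _
      | add x y hx hy => exact add_mem hx hy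
      | tmul v w =>
        rw [← G.proj_add v, TensorProduct.add_tmul]
        exact add_mem
          (Submodule.mem_sup_left (Submodule.subset_span ⟨_, G.proj_mem 0 v, w, rfl⟩))
          (Submodule.mem_sup_right (Submodule.subset_span ⟨_, G.proj_mem 1 v, w, rfl⟩))

end SuperGrading

end Grading

/-- A complex Lie superalgebra. -/
class LieSuperalgebra (L : Type*) [AddCommGroup L] [Module ℂ L] where
  grading : SuperGrading L
  br : L →ₗ[ℂ] L →ₗ[ℂ] L
  br_mem : ∀ {i j : ZMod 2} {x y : L}, x ∈ grading.gr i → y ∈ grading.gr j →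
    br x y ∈ grading.gr (i + j)
  br_skew : ∀ {i j : ZMod 2} {x y : L}, x ∈ grading.gr i → y ∈ grading.gr j →
    br x y = -(ksign i j • br y x)
  br_jacobi : ∀ {i j : ZMod 2} {x y : L}, x ∈ grading.gr i → y ∈ grading.gr j → ∀ z : L,
    br x (br y z) = br (br x y) z + ksign i j • br y (br x z)

open LieSuperalgebra

/-- The homogeneous component of degree `i` of a Lie superalgebra. -/
abbrev homog (L : Type*) [AddCommGroup L] [Module ℂ L] [LieSuperalgebra L] (i : ZMod 2) :
    Submodule ℂ L := (grading (L := L)).gr i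

section Algebras

variable {L L' : Type*} [AddCommGroup L] [Module ℂ L] [LieSuperalgebra L]
  [AddCommGroup L'] [Module ℂ L'] [LieSuperalgebra L']

variable (L L') in
/-- Homomorphisms of Lie superalgebras: even linear maps that preserve the bracket. -/
structure SuperHom where
  toFun : L →ₗ[ℂ] L'
  map_mem : ∀ {i : ZMod 2} {x : L}, x ∈ homog L i → toFun x ∈ homog L' i
  map_br : ∀ x y : L, toFun (br x y) = br (toFun x) (toFun y)

variable (L) in
/-- The group of automorphisms of a Lie superalgebra. -/
def superAut : Subgroup (L ≃ₗ[ℂ] L) where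
  carrier := {f | (∀ (i : ZMod 2) (x : L), f x ∈ homog L i ↔ x ∈ homog L i) ∧
    ∀ x y : L, f (br x y) = br (f x) (f y)}
  one_mem' := ⟨fun _ _ => Iff.rfl, fun _ _ => rfl⟩
  mul_mem' := by
    rintro f g ⟨hf, hf'⟩ ⟨hg, hg'⟩
    exact ⟨fun i x => (hf i (g x)).trans (hg i x), fun x y => by
      simp only [LinearEquiv.mul_apply, hg', hf']⟩
  inv_mem' := by
    rintro f ⟨hf, hf'⟩
    refine ⟨fun i x => ?_, fun x y => ?_⟩
    · have h := hf i (f.symm x)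
      rw [LinearEquiv.apply_symm_apply] at h
      exact h.symm
    · apply f.injective
      have h : ∀ z, f (f⁻¹ z) = z := fun z => f.apply_symm_apply z
      rw [hf', h, h, h]

/-- An automorphism as a homomorphism. -/
def autHom (f : superAut L) : SuperHom L L where
  toFun := (f : L ≃ₗ[ℂ] L)
  map_mem := fun {i} {x} hx => (f.2.1 i x).2 hx
  map_br := f.2.2

variable (L) in
/-- A sub-superalgebra: a graded subspace closed under the bracket. -/
structure LieSubsuperalgebra where
  carrier : Submodule ℂ L
  proj_mem : ∀ (i : ZMod 2) {x : L}, x ∈ carrier → (grading (L := L)).proj i x ∈ carrier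
  br_mem : ∀ {x y : L}, x ∈ carrier → y ∈ carrier → br x y ∈ carrier

/-- The underlying vector space of a sub-superalgebra. -/
def LieSubsuperalgebra.Elt (S : LieSubsuperalgebra L) := S.carrier

instance (S : LieSubsuperalgebra L) : AddCommGroup S.Elt :=
  inferInstanceAs (AddCommGroup S.carrier)

instance (S : LieSubsuperalgebra L) : Module ℂ S.Elt :=
  inferInstanceAs (Module ℂ S.carrier)

/-- The inclusion of a sub-superalgebra, as a linear map. -/
def LieSubsuperalgebra.val (S : LieSubsuperalgebra L) : S.Elt →ₗ[ℂ] L := S.carrier.subtype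

theorem LieSubsuperalgebra.val_injective (S : LieSubsuperalgebra L) :
    Function.Injective S.val := Subtype.val_injective

/-- A sub-superalgebra with the induced structure of Lie superalgebra. -/
instance (S : LieSubsuperalgebra L) : LieSuperalgebra S.Elt where
  grading :=
    { gr := fun i => (homog L i).comap S.val
      isCompl := by
        constructor
        · rw [Submodule.disjoint_def]
          intro x h0 h1
          refine S.val_injective ?_
          rw [map_zero]
          exact Submodule.disjoint_def.1 (grading (L := L)).isCompl.1 _ h0 h1
        · rw [codisjoint_iff, eq_top_iff]
          rintro x -
          refine Submodule.mem_sup.2 ⟨⟨_, S.proj_mem 0 x.2⟩, ?_, ⟨_, S.proj_mem 1 x.2⟩, ?_, ?_⟩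
          · exact SuperGrading.proj_mem _ 0 _
          · exact SuperGrading.proj_mem _ 1 _
          · exact S.val_injective (SuperGrading.proj_add _ _) }
  br := LinearMap.mk₂ ℂ (fun x y => (⟨br (S.val x) (S.val y), S.br_mem x.2 y.2⟩ : S.carrier))
    (fun _ _ _ => Subtype.ext (by simp; rfl)) (fun _ _ _ => Subtype.ext (by simp; rfl))
    (fun _ _ _ => Subtype.ext (by simp; rfl)) (fun _ _ _ => Subtype.ext (by simp; rfl))
  br_mem := fun hx hy => LieSuperalgebra.br_mem (L := L) hx hy
  br_skew := fun hx hy => S.val_injective (LieSuperalgebra.br_skew (L := L) hx hy)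
  br_jacobi := fun hx hy z => S.val_injective (LieSuperalgebra.br_jacobi (L := L) hx hy (S.val z))

/-- The inclusion of a sub-superalgebra. -/
def LieSubsuperalgebra.incl (S : LieSubsuperalgebra L) : SuperHom S.Elt L where
  toFun := S.val
  map_mem := fun hx => hx
  map_br := fun _ _ => rfl

/-- Composition of homomorphisms of Lie superalgebras. -/
def SuperHom.comp {L'' : Type*} [AddCommGroup L''] [Module ℂ L''] [LieSuperalgebra L'']
    (g : SuperHom L' L'') (f : SuperHom L L') : SuperHom L L'' where
  toFun := g.toFun ∘ₗ f.toFun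
  map_mem := fun hx => g.map_mem (f.map_mem hx)
  map_br := fun x y => by simp [f.map_br, g.map_br]

end Algebras

/-! ### The periplectic Lie superalgebra -/

section Periplectic

/-- The grading of square block matrices: block diagonal matrices are even, block antidiagonal
matrices are odd. -/
def glGrading (ι : Type) : SuperGrading (Matrix (ι ⊕ ι) (ι ⊕ ι) ℂ) where
  gr i := if i = 0 then
      { carrier := {M | M.toBlocks₁₂ = 0 ∧ M.toBlocks₂₁ = 0}
        zero_mem' := ⟨rfl, rfl⟩
        add_mem' := fun {M N} hM hN =>
          ⟨(congrArg₂ (· + ·) hM.1 hN.1).trans (add_zero _),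
            (congrArg₂ (· + ·) hM.2 hN.2).trans (add_zero _)⟩
        smul_mem' := fun c M hM =>
          ⟨(congrArg (c • ·) hM.1).trans (smul_zero c),
            (congrArg (c • ·) hM.2).trans (smul_zero c)⟩ }
    else
      { carrier := {M | M.toBlocks₁₁ = 0 ∧ M.toBlocks₂₂ = 0}
        zero_mem' := ⟨rfl, rfl⟩
        add_mem' := fun {M N} hM hN =>
          ⟨(congrArg₂ (· + ·) hM.1 hN.1).trans (add_zero _),
            (congrArg₂ (· + ·) hM.2 hN.2).trans (add_zero _)⟩
        smul_mem' := fun c M hM =>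
          ⟨(congrArg (c • ·) hM.1).trans (smul_zero c),
            (congrArg (c • ·) hM.2).trans (smul_zero c)⟩ }
  isCompl := by
    constructor
    · rw [Submodule.disjoint_def]
      rintro M ⟨h1, h2⟩ ⟨h3, h4⟩
      rw [← Matrix.fromBlocks_toBlocks M, h1, h2, h3, h4, Matrix.fromBlocks_zero]
    · rw [codisjoint_iff, eq_top_iff]
      rintro M -
      refine Submodule.mem_sup.2 ⟨Matrix.fromBlocks M.toBlocks₁₁ 0 0 M.toBlocks₂₂, ⟨rfl, rfl⟩,
        Matrix.fromBlocks 0 M.toBlocks₁₂ M.toBlocks₂₁ 0, ⟨rfl, rfl⟩, ?_⟩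
      rw [Matrix.fromBlocks_add]
      simp [Matrix.fromBlocks_toBlocks]

theorem glGrading_proj_zero {ι : Type} (a b c d : Matrix ι ι ℂ) :
    (glGrading ι).proj 0 (Matrix.fromBlocks a b c d) = Matrix.fromBlocks a 0 0 d := by
  have h : Matrix.fromBlocks a b c d = Matrix.fromBlocks a 0 0 d + Matrix.fromBlocks 0 b c 0 := by
    simp [Matrix.fromBlocks_add]
  have h0 : Matrix.fromBlocks a 0 0 d ∈ (glGrading ι).gr 0 := ⟨rfl, rfl⟩
  have h1 : Matrix.fromBlocks 0 b c 0 ∈ (glGrading ι).gr 1 := ⟨rfl, rfl⟩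
  rw [h, map_add, SuperGrading.proj_of_mem _ 0 h0, SuperGrading.proj_of_mem _ 0 h1]
  simp

theorem glGrading_proj_one {ι : Type} (a b c d : Matrix ι ι ℂ) :
    (glGrading ι).proj 1 (Matrix.fromBlocks a b c d) = Matrix.fromBlocks 0 b c 0 := by
  have h : Matrix.fromBlocks a b c d = Matrix.fromBlocks a 0 0 d + Matrix.fromBlocks 0 b c 0 := by
    simp [Matrix.fromBlocks_add]
  have h0 : Matrix.fromBlocks a 0 0 d ∈ (glGrading ι).gr 0 := ⟨rfl, rfl⟩
  have h1 : Matrix.fromBlocks 0 b c 0 ∈ (glGrading ι).gr 1 := ⟨rfl, rfl⟩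
  rw [h, map_add, SuperGrading.proj_of_mem _ 1 h0, SuperGrading.proj_of_mem _ 1 h1]
  simp

variable {ι : Type} [Fintype ι] [DecidableEq ι]

theorem gl_mul_mem {i j : ZMod 2} {x y : Matrix (ι ⊕ ι) (ι ⊕ ι) ℂ}
    (hx : x ∈ (glGrading ι).gr i) (hy : y ∈ (glGrading ι).gr j) :
    x * y ∈ (glGrading ι).gr (i + j) := by
  rw [← Matrix.fromBlocks_toBlocks x, ← Matrix.fromBlocks_toBlocks y, Matrix.fromBlocks_multiply]
  rcases zmod2_cases i with rfl | rfl <;> rcases zmod2_cases j with rfl | rfl <;> obtain ⟨h1, h2⟩ := hx <;> obtain ⟨h3, h4⟩ := hy <;>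
    rw [h1, h2, h3, h4] <;> refine ⟨?_, ?_⟩ <;> simp

/-- The supercommutator of block matrices: on homogeneous elements it is
`[x, y] = x y - (-1)^{|x||y|} y x`, extended bilinearly. -/
def glBracket (ι : Type) [Fintype ι] [DecidableEq ι] : Matrix (ι ⊕ ι) (ι ⊕ ι) ℂ →ₗ[ℂ]
    Matrix (ι ⊕ ι) (ι ⊕ ι) ℂ →ₗ[ℂ] Matrix (ι ⊕ ι) (ι ⊕ ι) ℂ :=
  LinearMap.mk₂ ℂ
    (fun x y => x * y -
      ∑ i, ∑ j, ksign i j • ((glGrading ι).proj j y * (glGrading ι).proj i x))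
    (fun x x' y => by
      simp only [map_add, add_mul, mul_add, smul_add, Finset.sum_add_distrib]; abel)
    (fun c x y => by
      simp only [map_smul, smul_mul_assoc, mul_smul_comm, smul_sub, Finset.smul_sum,
        smul_comm c])
    (fun x y y' => by
      simp only [map_add, add_mul, mul_add, smul_add, Finset.sum_add_distrib]; abel)
    (fun c x y => by
      simp only [map_smul, smul_mul_assoc, mul_smul_comm, smul_sub, Finset.smul_sum,
        smul_comm c])

theorem glBracket_of_mem {i j : ZMod 2} {x y : Matrix (ι ⊕ ι) (ι ⊕ ι) ℂ}
    (hx : x ∈ (glGrading ι).gr i) (hy : y ∈ (glGrading ι).gr j) :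
    glBracket ι x y = x * y - ksign i j • (y * x) := by
  simp only [glBracket, LinearMap.mk₂_apply, SuperGrading.proj_of_mem _ _ hx,
    SuperGrading.proj_of_mem _ _ hy]
  congr 1
  rw [Finset.sum_eq_single i, Finset.sum_eq_single j]
  · simp
  · intro b _ hb; simp [hb]
  · simp
  · intro b _ hb; simp [hb]
  · simp

/-- The general linear Lie superalgebra `gl(ι | ι)`. -/
instance glSuper : LieSuperalgebra (Matrix (ι ⊕ ι) (ι ⊕ ι) ℂ) where
  grading := glGrading ι
  br := glBracket ι
  br_mem := by
    intro i j x y hx hy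
    rw [glBracket_of_mem hx hy]
    refine sub_mem (gl_mul_mem hx hy) (Submodule.smul_mem _ _ ?_)
    rw [add_comm]
    exact gl_mul_mem hy hx
  br_skew := by
    intro i j x y hx hy
    rw [glBracket_of_mem hx hy, glBracket_of_mem hy hx]
    rcases zmod2_cases i with rfl | rfl <;> rcases zmod2_cases j with rfl | rfl <;>
      simp [ksign_zero_left, ksign_zero_right, ksign_one_one, add_comm]
  br_jacobi := by
    intro i j x y hx hy z
    have key : ∀ k : ZMod 2, ∀ z ∈ (glGrading ι).gr k,
        glBracket ι x (glBracket ι y z) =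
          glBracket ι (glBracket ι x y) z + ksign i j • glBracket ι y (glBracket ι x z) := by
      intro k z hz
      have m : ∀ {i j : ZMod 2} {x y : Matrix (ι ⊕ ι) (ι ⊕ ι) ℂ},
          x ∈ (glGrading ι).gr i → y ∈ (glGrading ι).gr j →
          x * y - ksign i j • (y * x) ∈ (glGrading ι).gr (i + j) := by
        intro i j x y hx hy
        refine sub_mem (gl_mul_mem hx hy) (Submodule.smul_mem _ _ ?_)
        rw [add_comm]
        exact gl_mul_mem hy hx
      rw [glBracket_of_mem hy hz, glBracket_of_mem hx hy, glBracket_of_mem hx hz,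
        glBracket_of_mem hx (m hy hz), glBracket_of_mem (m hx hy) hz,
        glBracket_of_mem hy (m hx hz)]
      rcases zmod2_cases i with rfl | rfl <;> rcases zmod2_cases j with rfl | rfl <;>
        rcases zmod2_cases k with rfl | rfl <;>
        simp only [zmod2_one_add_one, add_zero, zero_add, ksign_zero_left, ksign_zero_right,
          ksign_one_one, one_smul, neg_smul] <;> noncomm_ring
    rw [← (glGrading ι).proj_add z]
    simp only [map_add, smul_add]
    rw [key 0 _ ((glGrading ι).proj_mem 0 z), key 1 _ ((glGrading ι).proj_mem 1 z)]
    abel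

theorem glBracket_fromBlocks (a b c d a' b' c' d' : Matrix ι ι ℂ) :
    glBracket ι (Matrix.fromBlocks a b c d) (Matrix.fromBlocks a' b' c' d') =
      Matrix.fromBlocks (a * a' - a' * a + (b * c' + b' * c)) (a * b' + b * d' - a' * b - b' * d)
        (c * a' + d * c' - c' * a - d' * c) (d * d' - d' * d + (c * b' + c' * b)) := by
  have hu : (Finset.univ : Finset (ZMod 2)) = {0, 1} := rfl
  simp only [glBracket, LinearMap.mk₂_apply, hu]
  rw [Finset.sum_pair (by decide), Finset.sum_pair (by decide), Finset.sum_pair (by decide)]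
  simp only [glGrading_proj_zero, glGrading_proj_one, Matrix.fromBlocks_multiply, ksign,
    ZMod.val_zero, ZMod.val_one, mul_zero, zero_mul, pow_zero, one_smul, mul_one, pow_one,
    neg_smul, Matrix.fromBlocks_neg, Matrix.fromBlocks_add, sub_eq_add_neg]
  congr 1 <;> simp <;> abel

/-- The periplectic Lie superalgebra `p(n) ⊆ gl(n+1 | n+1)`: block matrices
`(A, B; C, -Aᵗ)` with `tr A = 0`, `B` symmetric and `C` skew-symmetric. -/
def periplectic (n : ℕ) : LieSubsuperalgebra
    (Matrix (Fin (n + 1) ⊕ Fin (n + 1)) (Fin (n + 1) ⊕ Fin (n + 1)) ℂ) where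
  carrier :=
    { carrier := {M | ∃ A B C : Matrix (Fin (n + 1)) (Fin (n + 1)) ℂ,
        A.trace = 0 ∧ B.transpose = B ∧ C.transpose = -C ∧
        M = Matrix.fromBlocks A B C (-A.transpose)}
      zero_mem' := ⟨0, 0, 0, by simp, by simp, by simp, by simp⟩
      add_mem' := by
        rintro _ _ ⟨A, B, C, hA, hB, hC, rfl⟩ ⟨A', B', C', hA', hB', hC', rfl⟩
        refine ⟨A + A', B + B', C + C', by simp [hA, hA'], by simp [hB, hB'],
          by simp [hC, hC', add_comm], ?_⟩
        simp [Matrix.fromBlocks_add, add_comm]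
      smul_mem' := by
        rintro c _ ⟨A, B, C, hA, hB, hC, rfl⟩
        refine ⟨c • A, c • B, c • C, by simp [hA], by simp [hB], by simp [hC], ?_⟩
        simp [Matrix.fromBlocks_smul] }
  proj_mem := by
    rintro i _ ⟨A, B, C, hA, hB, hC, rfl⟩
    fin_cases i
    · exact ⟨A, 0, 0, hA, by simp, by simp, glGrading_proj_zero _ _ _ _⟩
    · exact ⟨0, B, C, by simp, hB, hC, (glGrading_proj_one _ _ _ _).trans (by simp)⟩
  br_mem := by
    rintro _ _ ⟨A, B, C, hA, hB, hC, rfl⟩ ⟨A', B', C', hA', hB', hC', rfl⟩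
    refine ⟨A * A' - A' * A + (B * C' + B' * C),
      A * B' + B * (-A'.transpose) - A' * B - B' * (-A.transpose),
      C * A' + (-A.transpose) * C' - C' * A - (-A'.transpose) * C, ?_, ?_, ?_,
      (glBracket_fromBlocks _ _ _ _ _ _ _ _).trans ?_⟩
    · have h : ∀ S K : Matrix (Fin (n + 1)) (Fin (n + 1)) ℂ, S.transpose = S →
          K.transpose = -K → (S * K).trace = 0 := by
        intro S K hS hK
        have h1 : (S * K).trace = -(S * K).trace := by
          conv_lhs => rw [← Matrix.trace_transpose, Matrix.transpose_mul, hS, hK, neg_mul,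
            Matrix.trace_neg, Matrix.trace_mul_comm]
        exact self_eq_neg.1 h1
      simp only [Matrix.trace_add, Matrix.trace_sub, h B C' hB hC', h B' C hB' hC,
        Matrix.trace_mul_comm A' A]
      simp
    · simp only [Matrix.transpose_sub, Matrix.transpose_add, Matrix.transpose_mul,
        Matrix.transpose_neg, Matrix.transpose_transpose, hB, hB']
      noncomm_ring
    · simp only [Matrix.transpose_sub, Matrix.transpose_add, Matrix.transpose_mul,
        Matrix.transpose_neg, Matrix.transpose_transpose, hC, hC']
      noncomm_ring
    · congr 1
      simp only [Matrix.transpose_sub, Matrix.transpose_add, Matrix.transpose_mul,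
        hB, hB', hC, hC']
      noncomm_ring

/-- The underlying vector space of `p(n)`, a Lie superalgebra. -/
abbrev Peri (n : ℕ) : Type := (periplectic n).Elt

end Periplectic

/-! ### Modules over Lie superalgebras -/

/-- A module over a Lie superalgebra: a super vector space with an even linear map
`L → End V` that turns the superbracket into the supercommutator. Carriers live in `Type`; this
loses nothing for finite-dimensional modules. -/
structure SuperModule (L : Type*) [AddCommGroup L] [Module ℂ L] [LieSuperalgebra L] where
  carrier : Type
  [addCommGroup : AddCommGroup carrier]
  [module : Module ℂ carrier]
  grading : SuperGrading carrier
  act : L →ₗ[ℂ] Module.End ℂ carrier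
  act_mem : ∀ {i j : ZMod 2} {x : L} {v : carrier}, x ∈ homog L i → v ∈ grading.gr j →
    act x v ∈ grading.gr (i + j)
  act_br : ∀ {i j : ZMod 2} {x y : L}, x ∈ homog L i → y ∈ homog L j → ∀ v : carrier,
    act (br x y) v = act x (act y v) - ksign i j • act y (act x v)

attribute [instance] SuperModule.addCommGroup SuperModule.module

namespace SuperModule

section

variable {L L' : Type*} [AddCommGroup L] [Module ℂ L] [LieSuperalgebra L]
  [AddCommGroup L'] [Module ℂ L'] [LieSuperalgebra L']

/-- Irreducible modules: nonzero, with no graded submodules other than `0` and `V`. -/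
def IsIrreducible (V : SuperModule L) : Prop :=
  Nontrivial V.carrier ∧ ∀ N : Submodule ℂ V.carrier,
    (∀ (i : ZMod 2), ∀ v ∈ N, V.grading.proj i v ∈ N) → (∀ (x : L), ∀ v ∈ N, V.act x v ∈ N) →
    N = ⊥ ∨ N = ⊤

/-- Isomorphic modules: there is a bijective homogeneous homomorphism, of some degree
`d ∈ ℤ/2`, that is, a linear bijection `f` with `f(V_i) = W_{i+d}` and
`f(x v) = (-1)^{d|x|} x f(v)`. -/
def Iso (V W : SuperModule L) : Prop :=
  ∃ (d : ZMod 2) (f : V.carrier ≃ₗ[ℂ] W.carrier),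
    (∀ (i : ZMod 2) (v : V.carrier), f v ∈ W.grading.gr (i + d) ↔ v ∈ V.grading.gr i) ∧
    ∀ (i : ZMod 2), ∀ x ∈ homog L i, ∀ v : V.carrier,
      f (V.act x v) = ksign d i • W.act x (f v)

theorem Iso.refl (V : SuperModule L) : Iso V V :=
  ⟨0, LinearEquiv.refl ℂ _, fun i v => by simp, fun i x _ v => by simp [ksign_zero_left]⟩

theorem ksign_mul_self (d i : ZMod 2) : ksign d i * ksign d i = 1 := by
  rw [ksign, ← mul_pow]; simp

theorem ksign_add (d e i : ZMod 2) : ksign (d + e) i = ksign d i * ksign e i := by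
  rcases zmod2_cases d with rfl | rfl <;> rcases zmod2_cases e with rfl | rfl <;>
    rcases zmod2_cases i with rfl | rfl <;>
    simp [zmod2_one_add_one, ksign_zero_left, ksign_zero_right, ksign_one_one]

theorem Iso.symm {V W : SuperModule L} (h : Iso V W) : Iso W V := by
  obtain ⟨d, f, h1, h2⟩ := h
  refine ⟨d, f.symm, fun i w => ?_, fun i x hx w => ?_⟩
  · rw [← h1 (i + d) (f.symm w), f.apply_symm_apply, add_assoc]
    have : d + d = 0 := CharTwo.add_self_eq_zero d
    rw [this, add_zero]
  · apply f.injective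
    rw [map_smul, h2 i x hx, f.apply_symm_apply, f.apply_symm_apply, smul_smul, ksign_mul_self,
      one_smul]

theorem Iso.trans {V W U : SuperModule L} (h : Iso V W) (h' : Iso W U) : Iso V U := by
  obtain ⟨d, f, h1, h2⟩ := h
  obtain ⟨e, g, h3, h4⟩ := h'
  refine ⟨d + e, f.trans g, fun i v => ?_, fun i x hx v => ?_⟩
  · rw [← add_assoc, LinearEquiv.trans_apply, h3, h1]
  · rw [LinearEquiv.trans_apply, LinearEquiv.trans_apply, h2 i x hx, map_smul, h4 i x hx,
      smul_smul, ksign_add]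

/-- The pull-back of a module along a homomorphism of Lie superalgebras. -/
def pullback (f : SuperHom L L') (V : SuperModule L') : SuperModule L where
  carrier := V.carrier
  grading := V.grading
  act := V.act ∘ₗ f.toFun
  act_mem := fun hx hv => V.act_mem (f.map_mem hx) hv
  act_br := fun {i j x y} hx hy v => by
    simp only [LinearMap.comp_apply, f.map_br]
    exact V.act_br (f.map_mem hx) (f.map_mem hy) v

variable (L) in
/-- The trivial module `ℂ`, purely even, with zero action. -/
def trivial : SuperModule L where
  carrier := ℂ
  grading :=
    { gr := fun i => if i = 0 then ⊤ else ⊥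
      isCompl := by simpa using isCompl_top_bot }
  act := 0
  act_mem := fun _ _ => by simp
  act_br := fun _ _ _ => by simp

/-- The action on `V ⊗ W`, `x (v ⊗ w) = x v ⊗ w + (-1)^{|x||v|} v ⊗ x w` for homogeneous
`x` and `v`: the second summand is `v ⊗ x₀ w + (-1)^{|v|} v ⊗ x₁ w`. -/
def tensorAct (V W : SuperModule L) : L →ₗ[ℂ] Module.End ℂ (V.carrier ⊗[ℂ] W.carrier) where
  toFun x := TensorProduct.map (V.act x) LinearMap.id +
    (TensorProduct.map LinearMap.id (W.act ((LieSuperalgebra.grading (L := L)).proj 0 x)) +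
      TensorProduct.map V.grading.parity (W.act ((LieSuperalgebra.grading (L := L)).proj 1 x)))
  map_add' x y := by
    simp only [map_add, TensorProduct.map_add_left, TensorProduct.map_add_right]
    abel
  map_smul' c x := by
    simp only [map_smul, TensorProduct.map_smul_left, TensorProduct.map_smul_right,
      RingHom.id_apply, smul_add]

theorem tensorAct_tmul (V W : SuperModule L) {i j : ZMod 2} {x : L} (hx : x ∈ homog L i)
    {v : V.carrier} (hv : v ∈ V.grading.gr j) (w : W.carrier) :
    tensorAct V W x (v ⊗ₜ w) = V.act x v ⊗ₜ w + ksign i j • (v ⊗ₜ W.act x w) := by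
  simp only [tensorAct, LinearMap.coe_mk, AddHom.coe_mk, LinearMap.add_apply,
    TensorProduct.map_tmul, LinearMap.id_apply, SuperGrading.proj_of_mem _ _ hx,
    V.grading.parity_of_mem hv]
  rcases zmod2_cases i with rfl | rfl
  · simp [ksign_zero_left]
  · simp [TensorProduct.smul_tmul']

theorem tensor_hom_ext (V W : SuperModule L) {M : Type*} [AddCommGroup M] [Module ℂ M]
    {f g : V.carrier ⊗[ℂ] W.carrier →ₗ[ℂ] M}
    (h : ∀ (j : ZMod 2), ∀ v ∈ V.grading.gr j, ∀ w, f (v ⊗ₜ w) = g (v ⊗ₜ w)) : f = g := by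
  refine TensorProduct.ext' fun v w => ?_
  rw [← V.grading.proj_add v, TensorProduct.add_tmul, map_add, map_add,
    h 0 _ (V.grading.proj_mem 0 v), h 1 _ (V.grading.proj_mem 1 v)]

/-- The tensor product of two modules. -/
def tensor (V W : SuperModule L) : SuperModule L where
  carrier := V.carrier ⊗[ℂ] W.carrier
  grading := V.grading.tensor W.grading
  act := tensorAct V W
  act_mem := by
    intro i j x t hx ht
    induction ht using Submodule.span_induction with
    | mem t h =>
      obtain ⟨k, l, hkl, v, hv, w, hw, rfl⟩ := h
      rw [tensorAct_tmul V W hx hv]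
      refine add_mem (Submodule.subset_span ?_) (Submodule.smul_mem _ _ (Submodule.subset_span ?_))
      · exact ⟨i + k, l, by rw [← hkl, add_assoc], _, V.act_mem hx hv, _, hw, rfl⟩
      · exact ⟨k, i + l, by rw [← hkl, add_left_comm], _, hv, _, W.act_mem hx hw, rfl⟩
    | zero => simp
    | add x y _ _ hx hy => rw [map_add]; exact add_mem hx hy
    | smul c x _ hx => rw [map_smul]; exact Submodule.smul_mem _ _ hx
  act_br := by
    intro i j x y hx hy t
    have key : tensorAct V W (br x y) =
        tensorAct V W x ∘ₗ tensorAct V W y - ksign i j • (tensorAct V W y ∘ₗ tensorAct V W x) := by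
      refine tensor_hom_ext V W fun k v hv w => ?_
      simp only [LinearMap.sub_apply, LinearMap.smul_apply, LinearMap.comp_apply]
      rw [tensorAct_tmul V W (br_mem hx hy) hv, tensorAct_tmul V W hx hv,
        tensorAct_tmul V W hy hv]
      simp only [map_add, map_smul]
      rw [tensorAct_tmul V W hx hv, tensorAct_tmul V W hy hv,
        tensorAct_tmul V W hx (V.act_mem hy hv), tensorAct_tmul V W hy (V.act_mem hx hv),
        V.act_br hx hy, W.act_br hx hy]
      rcases zmod2_cases i with rfl | rfl <;> rcases zmod2_cases j with rfl | rfl <;>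
        rcases zmod2_cases k with rfl | rfl <;>
        simp only [zmod2_one_add_one, add_zero, zero_add, ksign_zero_left, ksign_zero_right,
          ksign_one_one, one_smul, neg_smul, TensorProduct.sub_tmul, TensorProduct.tmul_sub,
          TensorProduct.neg_tmul, TensorProduct.tmul_neg] <;> abel
    exact LinearMap.congr_fun key t

/-- The tensor product `V₁ ⊗ (V₂ ⊗ ⋯ ⊗ (V_k ⊗ ℂ))` of a finite family of modules. -/
def tensorList : List (SuperModule L) → SuperModule L
  | [] => trivial L
  | V :: Vs => tensor V (tensorList Vs)

variable (L) in
/-- Finite-dimensional irreducible modules. -/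
abbrev FinIrr := {V : SuperModule L // FiniteDimensional ℂ V.carrier ∧ V.IsIrreducible}

variable (L) in
/-- The isomorphism relation on finite-dimensional irreducible modules. -/
def isoSetoid : Setoid (FinIrr L) where
  r V W := Iso V.1 W.1
  iseqv := ⟨fun V => Iso.refl V.1, fun h => h.symm, fun h h' => h.trans h'⟩

variable (L) in
/-- The set of isomorphism classes of finite-dimensional irreducible modules. -/
def Irred := Quotient (isoSetoid L)

/-- The isomorphism class of a finite-dimensional irreducible module. -/
def isoClass (V : SuperModule L) (h : FiniteDimensional ℂ V.carrier ∧ V.IsIrreducible) :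
    Irred L := Quotient.mk (isoSetoid L) ⟨V, h⟩

/-- An arbitrary but fixed representative of an isomorphism class. -/
def Irred.rep (c : Irred L) : SuperModule L := (Quotient.out c).1

theorem trivial_irreducible : (trivial L).IsIrreducible := by
  refine ⟨inferInstanceAs (Nontrivial ℂ), fun N _ _ => ?_⟩
  exact eq_bot_or_eq_top (α := Submodule ℂ ℂ) N

variable (L) in
/-- The class of the trivial module. -/
def trivialClass : Irred L :=
  isoClass (trivial L) ⟨inferInstanceAs (FiniteDimensional ℂ ℂ), trivial_irreducible⟩

/-- The twist `V^f` of a module by an automorphism `f`: the element `x` acts on `V^f` as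
`f⁻¹ x` acts on `V`. -/
def twist (f : superAut L) (V : SuperModule L) : SuperModule L := pullback (autHom f⁻¹) V

theorem twist_irreducible (f : superAut L) {V : SuperModule L} (h : V.IsIrreducible) :
    (twist f V).IsIrreducible := by
  refine ⟨h.1, fun N h1 h2 => h.2 N h1 fun x v hv => ?_⟩
  have h3 := h2 ((f : L ≃ₗ[ℂ] L) x) v hv
  have h4 : ((f⁻¹ : superAut L) : L ≃ₗ[ℂ] L) ((f : L ≃ₗ[ℂ] L) x) = x :=
    (f : L ≃ₗ[ℂ] L).symm_apply_apply x
  change V.act (((f⁻¹ : superAut L) : L ≃ₗ[ℂ] L) ((f : L ≃ₗ[ℂ] L) x)) v ∈ N at h3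
  rwa [h4] at h3

theorem Iso.twist (f : superAut L) {V W : SuperModule L} (h : Iso V W) :
    Iso (V.twist f) (W.twist f) := by
  obtain ⟨d, g, h1, h2⟩ := h
  exact ⟨d, g, h1, fun i x hx v => h2 i _ ((autHom f⁻¹).map_mem hx) v⟩

/-- The action of automorphisms on isomorphism classes, `f [V] = [V^f]`. -/
def Irred.twist (f : superAut L) : Irred L → Irred L :=
  Quotient.map' (s₁ := isoSetoid L) (s₂ := isoSetoid L)
    (fun V => ⟨V.1.twist f, V.2.1, twist_irreducible f V.2.2⟩) fun _ _ h => h.twist f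

end

end SuperModule

/-! ### Equivariant map superalgebras -/

section MapSuper

variable {L : Type*} [AddCommGroup L] [Module ℂ L] [LieSuperalgebra L]
  {A : Type*} [CommRing A] [Algebra ℂ A]

/-- The map superalgebra `L ⊗ A`, with `[x ⊗ a, y ⊗ b] = [x, y] ⊗ a b`. -/
instance mapSuper : LieSuperalgebra (L ⊗[ℂ] A) where
  grading := (grading (L := L)).extend A
  br := TensorProduct.map₂ br (LinearMap.mul ℂ A)
  br_mem := by
    intro i j s t hs ht
    induction hs using Submodule.span_induction with
    | mem s h =>
      obtain ⟨x, hx, a, rfl⟩ := h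
      induction ht using Submodule.span_induction with
      | mem t h =>
        obtain ⟨y, hy, b, rfl⟩ := h
        exact Submodule.subset_span ⟨br x y, br_mem hx hy, a * b, by simp⟩
      | zero => simp
      | add t t' _ _ h h' => rw [map_add]; exact add_mem h h'
      | smul c t _ h => rw [map_smul]; exact Submodule.smul_mem _ _ h
    | zero => simp
    | add t t' _ _ h h' => rw [map_add, LinearMap.add_apply]; exact add_mem h h'
    | smul c t _ h => rw [map_smul, LinearMap.smul_apply]; exact Submodule.smul_mem _ _ h
  br_skew := by
    intro i j s t hs ht
    induction hs using Submodule.span_induction with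
    | mem s h =>
      obtain ⟨x, hx, a, rfl⟩ := h
      induction ht using Submodule.span_induction with
      | mem t h =>
        obtain ⟨y, hy, b, rfl⟩ := h
        simp only [TensorProduct.map₂_apply_tmul, TensorProduct.map_tmul, LinearMap.mul_apply']
        rw [br_skew hx hy, TensorProduct.neg_tmul, TensorProduct.smul_tmul', mul_comm b a]
      | zero => simp
      | add t t' _ _ h h' =>
        rw [map_add, h, h', map_add, LinearMap.add_apply, smul_add, neg_add]
      | smul c t _ h =>
        rw [map_smul, h, map_smul, LinearMap.smul_apply, smul_neg, smul_comm]
    | zero => simp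
    | add t t' _ _ h h' =>
      rw [map_add, LinearMap.add_apply, h, h', map_add, smul_add, neg_add]
    | smul c t _ h =>
      rw [map_smul, LinearMap.smul_apply, h, map_smul, smul_neg, smul_comm]
  br_jacobi := by
    intro i j s t hs ht u
    induction hs using Submodule.span_induction with
    | mem s h =>
      obtain ⟨x, hx, a, rfl⟩ := h
      induction ht using Submodule.span_induction with
      | mem t h =>
        obtain ⟨y, hy, b, rfl⟩ := h
        induction u with
        | zero => simp
        | add u u' h h' => simp only [map_add, h, h', smul_add]; abel
        | tmul z c =>
          simp only [TensorProduct.map₂_apply_tmul, TensorProduct.map_tmul, LinearMap.mul_apply']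
          rw [br_jacobi hx hy, TensorProduct.add_tmul, TensorProduct.smul_tmul', mul_assoc,
            mul_left_comm b a c]
      | zero => simp
      | add t t' _ _ h h' => simp only [map_add, LinearMap.add_apply, h, h', smul_add]; abel
      | smul c t _ h => simp only [map_smul, LinearMap.smul_apply, h, smul_add, smul_comm c]
    | zero => simp
    | add t t' _ _ h h' => simp only [map_add, LinearMap.add_apply, h, h', smul_add]; abel
    | smul c t _ h => simp only [map_smul, LinearMap.smul_apply, h, smul_add, smul_comm c]

theorem mapSuper_br_tmul (x y : L) (a b : A) :
    br (x ⊗ₜ[ℂ] a) (y ⊗ₜ[ℂ] b) = (br x y) ⊗ₜ[ℂ] (a * b) := rfl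

theorem mapSuper_proj_tmul (i : ZMod 2) (x : L) (a : A) :
    (grading (L := L ⊗[ℂ] A)).proj i (x ⊗ₜ[ℂ] a) =
      ((LieSuperalgebra.grading (L := L)).proj i x) ⊗ₜ[ℂ] a := by
  have h : ∀ j, ((LieSuperalgebra.grading (L := L)).proj j x) ⊗ₜ[ℂ] a ∈ homog (L ⊗[ℂ] A) j := fun j =>
    Submodule.subset_span ⟨_, SuperGrading.proj_mem _ j x, a, rfl⟩
  conv_lhs => rw [← (LieSuperalgebra.grading (L := L)).proj_add x, TensorProduct.add_tmul, map_add,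
    SuperGrading.proj_of_mem _ i (h 0), SuperGrading.proj_of_mem _ i (h 1)]
  rcases zmod2_cases i with rfl | rfl <;> simp

/-- An automorphism of a Lie superalgebra commutes with the projections on the homogeneous
components. -/
theorem superAut_proj (f : superAut L) (i : ZMod 2) (x : L) :
    (f : L ≃ₗ[ℂ] L) ((LieSuperalgebra.grading (L := L)).proj i x) =
      (LieSuperalgebra.grading (L := L)).proj i ((f : L ≃ₗ[ℂ] L) x) := by
  have h : ∀ j, (f : L ≃ₗ[ℂ] L) ((LieSuperalgebra.grading (L := L)).proj j x) ∈ homog L j := fun j =>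
    (f.2.1 j _).2 (SuperGrading.proj_mem _ j x)
  conv_rhs => rw [← (LieSuperalgebra.grading (L := L)).proj_add x, map_add, map_add,
    SuperGrading.proj_of_mem _ i (h 0), SuperGrading.proj_of_mem _ i (h 1)]
  rcases zmod2_cases i with rfl | rfl <;> simp

variable {Γ : Type*} [Group Γ]

/-- The diagonal action on `L ⊗ A`, `γ (x ⊗ a) = γ x ⊗ γ a`. -/
def diagAct (σ : Γ →* superAut L) (τ : Γ →* (A ≃ₐ[ℂ] A)) (γ : Γ) :
    L ⊗[ℂ] A →ₗ[ℂ] L ⊗[ℂ] A :=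
  TensorProduct.map ((σ γ : L ≃ₗ[ℂ] L) : L →ₗ[ℂ] L) (τ γ).toLinearMap

/-- The equivariant map superalgebra `(L ⊗ A)^Γ` of `Γ`-fixed points. -/
def equivMap (σ : Γ →* superAut L) (τ : Γ →* (A ≃ₐ[ℂ] A)) :
    LieSubsuperalgebra (L ⊗[ℂ] A) where
  carrier :=
    { carrier := {t | ∀ γ, diagAct σ τ γ t = t}
      zero_mem' := fun _ => map_zero _
      add_mem' := fun hs ht γ => by rw [map_add, hs γ, ht γ]
      smul_mem' := fun c t ht γ => by rw [map_smul, ht γ] }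
  proj_mem := by
    intro i t ht γ
    have key : diagAct σ τ γ ∘ₗ (grading (L := L ⊗[ℂ] A)).proj i =
        (grading (L := L ⊗[ℂ] A)).proj i ∘ₗ diagAct σ τ γ := by
      refine TensorProduct.ext' fun x a => ?_
      simp only [LinearMap.comp_apply, diagAct, mapSuper_proj_tmul, TensorProduct.map_tmul]
      exact congrArg (· ⊗ₜ[ℂ] _) (superAut_proj (σ γ) i x)
    have h := LinearMap.congr_fun key t
    simp only [LinearMap.comp_apply, ht γ] at h
    exact h
  br_mem := by
    intro s t hs ht γ
    have key : ∀ s t : L ⊗[ℂ] A,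
        diagAct σ τ γ (br s t) = br (diagAct σ τ γ s) (diagAct σ τ γ t) := by
      intro s t
      induction s with
      | zero => simp
      | add s s' h h' => simp only [map_add, LinearMap.add_apply, h, h']
      | tmul x a =>
        induction t with
        | zero => simp
        | add t t' h h' => simp only [map_add, h, h']
        | tmul y b =>
          simp only [mapSuper_br_tmul, diagAct, TensorProduct.map_tmul]
          refine congrArg₂ (· ⊗ₜ[ℂ] ·) ((σ γ).2.2 x y) (map_mul (τ γ) a b)
    rw [key, hs γ, ht γ]

/-- The action of `Γ` on the maximal spectrum, `γ m = {γ a | a ∈ m}`. -/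
def maxAct (τ : Γ →* (A ≃ₐ[ℂ] A)) (γ : Γ) (m : MaximalSpectrum A) : MaximalSpectrum A :=
  have := m.isMaximal
  ⟨m.asIdeal.map (τ γ), Ideal.map_isMaximal_of_equiv (τ γ)⟩

theorem residue_bijective [Algebra.FiniteType ℂ A] (m : MaximalSpectrum A) :
    Function.Bijective (algebraMap ℂ (A ⧸ m.asIdeal)) := by
  have := m.isMaximal
  let _ := Ideal.Quotient.field m.asIdeal
  have : Module.Finite ℂ (A ⧸ m.asIdeal) := finite_of_finite_type_of_isJacobsonRing _ _
  exact IsAlgClosed.algebraMap_bijective_of_isIntegral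

/-- The character `A → A/m ≅ ℂ`. -/
def residue [Algebra.FiniteType ℂ A] (m : MaximalSpectrum A) : A →ₐ[ℂ] ℂ :=
  ((AlgEquiv.ofBijective (Algebra.ofId ℂ (A ⧸ m.asIdeal))
    (residue_bijective m)).symm : (A ⧸ m.asIdeal) →ₐ[ℂ] ℂ).comp (Ideal.Quotient.mkₐ ℂ m.asIdeal)

variable (L) in
/-- The evaluation `L ⊗ A → L ⊗ A/m ≅ L`. -/
def evalHom [Algebra.FiniteType ℂ A] (m : MaximalSpectrum A) : SuperHom (L ⊗[ℂ] A) L where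
  toFun := (TensorProduct.rid ℂ L).toLinearMap ∘ₗ (residue m).toLinearMap.lTensor L
  map_mem := by
    intro i t ht
    induction ht using Submodule.span_induction with
    | mem t h =>
      obtain ⟨x, hx, a, rfl⟩ := h
      simpa using Submodule.smul_mem _ _ hx
    | zero => simp
    | add t t' _ _ h h' => rw [map_add]; exact add_mem h h'
    | smul c t _ h => rw [map_smul]; exact Submodule.smul_mem _ _ h
  map_br := by
    intro s t
    induction s with
    | zero => simp
    | add s s' h h' => simp only [map_add, LinearMap.add_apply, h, h']
    | tmul x a =>
      induction t with
      | zero => simp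
      | add t t' h h' => simp only [map_add, h, h']
      | tmul y b => simp [mapSuper_br_tmul, smul_smul, mul_comm]

open SuperModule

/-- The evaluation module of an `L`-module at `m`, restricted to `(L ⊗ A)^Γ`. -/
def evalModule [Algebra.FiniteType ℂ A] (σ : Γ →* superAut L) (τ : Γ →* (A ≃ₐ[ℂ] A))
    (m : MaximalSpectrum A) (V : SuperModule L) : SuperModule (equivMap σ τ).Elt :=
  V.pullback ((evalHom L m).comp (equivMap σ τ).incl)

/-- The set `𝒫` of `Γ`-equivariant functions from the maximal spectrum to isomorphism classes of
finite-dimensional irreducible `L`-modules whose value is the trivial class at all but finitely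
many points. -/
def FinSuppMaps (σ : Γ →* superAut L) (τ : Γ →* (A ≃ₐ[ℂ] A)) :
    Set (MaximalSpectrum A → Irred L) :=
  {π | (∀ γ m, π (maxAct τ γ m) = (π m).twist (σ γ)) ∧ {m | π m ≠ trivialClass L}.Finite}

/-- `l` enumerates, without repetition, a set of representatives of the `Γ`-orbits in the
support of `π`. -/
def IsSuppStar (τ : Γ →* (A ≃ₐ[ℂ] A)) (π : MaximalSpectrum A → Irred L)
    (l : List (MaximalSpectrum A)) : Prop :=
  (∀ m ∈ l, π m ≠ trivialClass L) ∧
  (∀ m, π m ≠ trivialClass L → ∃ γ, maxAct τ γ m ∈ l) ∧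
  l.Pairwise (fun m m' => ∀ γ, maxAct τ γ m ≠ m')

/-- The module `𝒱(π)`: the tensor product of the evaluation modules of `π(m)` at `m`, over the
points `m` of the list `l`. -/
def evalProduct [Algebra.FiniteType ℂ A] (σ : Γ →* superAut L) (τ : Γ →* (A ≃ₐ[ℂ] A))
    (π : MaximalSpectrum A → Irred L) (l : List (MaximalSpectrum A)) :
    SuperModule (equivMap σ τ).Elt :=
  tensorList (l.map fun m => evalModule σ τ m (π m).rep)

end MapSuper

end EquivMap

end

open scoped TensorProduct

noncomputable section

namespace EquivMap

open LieSuperalgebra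

/-! ### Density for operators on finite-dimensional spaces -/

section Density

variable {V : Type*} [AddCommGroup V] [Module ℂ V]

/-! The argument works for any Lie superalgebra `L` that an even element `H` grades by integers so
that the zero weight space is even, commutative (`Triangular`) and spanned by brackets of even root
vectors of opposite weights (`Triangular.HasCoroots`). For `p(n)` with `n ≥ 2` one takes for `H` a
traceless integral diagonal matrix with distinct entries such that no sum of two entries,
repetitions included, is zero.

Since the zero weight space is even and commutative, the top weight space of a finite-dimensional
irreducible module is a line. It follows that such a module has no proper nonzero submodules even
among ungraded subspaces (`Triangular.eq_bot_or_top`), so by Burnside its operators generate the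
full endomorphism algebra (`Triangular.fullOn_univ`). This excludes irreducible modules with odd
endomorphisms, the usual obstacle in the super setting: tensor products of irreducibles over
independent actions stay irreducible (`FullOn.tensor`), and every ungraded isomorphism can be made
homogeneous (`PlainIso.iso`).

Irreducibility and injectivity. As the action on points is free, sums over `Γ` of elements `x ⊗ a`
interpolate: they take a prescribed value at `m` and vanish at finitely many points of other orbits
(`exists_evalAt_eq`). Hence the factors of `𝒱(π)` are acted on independently. Under the elements
that vanish at the other points, `𝒱(π)` is a multiple of the evaluation of `π(m)` at `m`; this type
is an invariant of the module (`IsIsotypic.iso`), so `π` can be recovered.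

Surjectivity. Let `V` be finite-dimensional irreducible over the fixed points. Freeness makes `A`
Galois over its invariants (`exists_isGaloisSystem`); therefore the fixed points are perfect, and
the ideal `fixedAnn V` of `A` has finite codimension and lies in finitely many maximal ideals. With
one point chosen in each of their orbits there is an idempotent `e` modulo this ideal, supported at
the chosen points, whose conjugates are orthogonal with sum `1` (`exists_idempotent`). Letting `t`
act as the sum over `Γ` of the conjugates of `e t` extends `V` to an irreducible `L ⊗ A`-module. A
highest weight computation shows that the annihilator in `A` of the extension is radical
(`annIdeal_isRadical`), so functions vanishing at the chosen points act by zero. The points are then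
split off one at a time: the part of the action at `m` supercommutes with the rest, and the module
is the tensor product of an irreducible `L`-module and a space of intertwiners
(`tensor_decomposition`). Thus `V` is a tensor product of evaluation modules, and its types form the
required `π`. -/

/-- A subspace stable under a set of operators is stable under the algebra they generate. -/
theorem adjoin_stable {S : Set (Module.End ℂ V)} {N : Submodule ℂ V}
    (hN : ∀ x ∈ S, ∀ v ∈ N, x v ∈ N) {f : Module.End ℂ V} (hf : f ∈ Algebra.adjoin ℂ S) :
    ∀ v ∈ N, f v ∈ N := by
  induction hf using Algebra.adjoin_induction with
  | mem x hx => exact hN x hx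
  | algebraMap r => intro v hv; exact N.smul_mem r hv
  | add f g _ _ hf hg => intro v hv; exact add_mem (hf v hv) (hg v hv)
  | mul f g _ _ hf hg => intro v hv; exact hf _ (hg v hv)

/-- A linear functional that takes the value `1` at a given nonzero vector. -/
theorem exists_dual_eq_one {v : V} (hv : v ≠ 0) : ∃ φ : V →ₗ[ℂ] ℂ, φ v = 1 := by
  obtain ⟨φ, hφ⟩ : ∃ φ : V →ₗ[ℂ] ℂ, φ v ≠ 0 := by
    by_contra! h
    exact hv ((Module.forall_dual_apply_eq_zero_iff ℂ v).1 h)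
  exact ⟨(φ v)⁻¹ • φ, by simp [hφ]⟩

/-- A subspace stable under all operators is trivial. -/
theorem eq_bot_or_top_of_forall_stable {N : Submodule ℂ V}
    (hN : ∀ f : Module.End ℂ V, ∀ v ∈ N, f v ∈ N) : N = ⊥ ∨ N = ⊤ := by
  by_cases h : N = ⊥
  · exact Or.inl h
  · obtain ⟨v, hv, hv0⟩ := N.ne_bot_iff.1 h
    obtain ⟨φ, hφ⟩ := exists_dual_eq_one hv0
    refine Or.inr (eq_top_iff.2 fun w _ => ?_)
    have := hN (φ.smulRight w) v hv
    simpa [hφ] using this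

/-- An operator that commutes with a generating set of the algebra of all operators is a scalar. -/
theorem exists_eq_smul_of_commute {S : Set (Module.End ℂ V)} (hS : Algebra.adjoin ℂ S = ⊤)
    {T : Module.End ℂ V} (hT : ∀ x ∈ S, ∀ v, T (x v) = x (T v)) : ∃ c : ℂ, ∀ v, T v = c • v := by
  have key : ∀ f : Module.End ℂ V, ∀ v, T (f v) = f (T v) := by
    intro f
    have hf : f ∈ Algebra.adjoin ℂ S := hS ▸ Algebra.mem_top
    induction hf using Algebra.adjoin_induction with
    | mem x hx => exact hT x hx
    | algebraMap r => intro v; exact map_smul T r v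
    | add f g _ _ hf hg => intro v; simp [hf, hg]
    | mul f g _ _ hf hg => intro v; simp [hf, hg]
  by_cases h : ∃ v : V, v ≠ 0
  · obtain ⟨v, hv⟩ := h
    obtain ⟨φ, hφ⟩ := exists_dual_eq_one hv
    refine ⟨φ (T v), fun w => ?_⟩
    have := key (φ.smulRight w) v
    simpa [hφ] using this
  · push Not at h
    exact ⟨0, fun v => by rw [h v]; simp⟩

/-- **Burnside's theorem**: operators on a finite-dimensional complex space without common
invariant subspaces generate the algebra of all operators. -/
theorem adjoin_eq_top_of_simple [FiniteDimensional ℂ V] [Nontrivial V] {S : Set (Module.End ℂ V)}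
    (hS : ∀ N : Submodule ℂ V, (∀ x ∈ S, ∀ v ∈ N, x v ∈ N) → N = ⊥ ∨ N = ⊤) :
    Algebra.adjoin ℂ S = ⊤ := by
  let R := Algebra.adjoin ℂ S
  have hsm : ∀ (r : R) (v : V), r • v = r.1 v := fun _ _ => rfl
  have hsimple : IsSimpleModule R V := by
    refine { toIsSimpleOrder := { exists_pair_ne := exists_pair_ne _, eq_bot_or_eq_top := ?_ } }
    intro N
    have h1 := hS (N.restrictScalars ℂ) fun x hx v hv =>
      N.smul_mem (⟨x, Algebra.subset_adjoin hx⟩ : R) hv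
    rcases h1 with h | h
    · exact Or.inl ((Submodule.restrictScalars_eq_bot_iff _ _ _).1 h)
    · exact Or.inr ((Submodule.restrictScalars_eq_top_iff _ _ _).1 h)
  -- Schur's lemma, by way of an eigenspace. As all `R`-endomorphisms are scalars, every complex
  -- linear `f` commutes with them, which is the hypothesis of the density theorem.
  have hschur : ∀ T : Module.End R V, ∃ c : ℂ, ∀ v, T v = c • v := by
    intro T
    let T' : Module.End ℂ V := T.restrictScalars ℂ
    obtain ⟨c, hc⟩ := Module.End.exists_eigenvalue T'
    have h := hS (Module.End.eigenspace T' c) fun x hx v hv => by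
      rw [Module.End.mem_eigenspace_iff] at hv ⊢
      have h1 : T' (x v) = x (T' v) := T.map_smul (⟨x, Algebra.subset_adjoin hx⟩ : R) v
      rw [h1, hv, map_smul]
    rcases h with h | h
    · exact absurd h hc
    · exact ⟨c, fun v => Module.End.mem_eigenspace_iff.1 (h ▸ Submodule.mem_top)⟩
  rw [eq_top_iff]
  intro f _
  let f' : Module.End (Module.End R V) V :=
    { toFun := f
      map_add' := map_add f
      map_smul' := fun T v => by
        obtain ⟨c, hc⟩ := hschur T
        change f (T v) = T (f v)
        rw [hc, hc, map_smul] }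
  obtain ⟨s, hs⟩ := Module.Finite.fg_top (R := ℂ) (M := V)
  obtain ⟨r, hr⟩ := jacobson_density (R := R) f' s
  have : f = r.1 := by
    refine LinearMap.ext_on (s := (s : Set V)) hs fun v hv => hr v hv
  exact this ▸ r.2

/-- A nonzero subspace with a given property contains a minimal such subspace. -/
theorem exists_minimal_submodule [FiniteDimensional ℂ V] (p : Submodule ℂ V → Prop)
    {N : Submodule ℂ V} (hN : p N) (h0 : N ≠ ⊥) :
    ∃ M : Submodule ℂ V, p M ∧ M ≠ ⊥ ∧ ∀ M' ≤ M, p M' → M' = ⊥ ∨ M' = M := by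
  obtain ⟨M, ⟨h1, h2⟩, h3⟩ := WellFounded.has_min (wellFounded_lt (α := Submodule ℂ V))
    {M | p M ∧ M ≠ ⊥} ⟨N, hN, h0⟩
  refine ⟨M, h1, h2, fun M' hle hM' => ?_⟩
  by_cases h : M' = ⊥
  · exact Or.inl h
  · right
    by_contra hne
    exact h3 M' ⟨hM', h⟩ (lt_of_le_of_ne hle hne)

end Density

/-! ### Parity operators -/

namespace SuperGrading

variable {V : Type*} [AddCommGroup V] [Module ℂ V] (G : SuperGrading V)

theorem parity_parity (v : V) : G.parity (G.parity v) = v := by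
  have h : ∀ i, G.parity (G.parity (G.proj i v)) = G.proj i v := fun i => by
    rw [G.parity_of_mem (G.proj_mem i v), map_smul, G.parity_of_mem (G.proj_mem i v), smul_smul,
      SuperModule.ksign_mul_self, one_smul]
  conv_lhs => rw [← G.proj_add v, map_add, map_add, h, h, G.proj_add]

theorem proj_eq (i : ZMod 2) (v : V) :
    G.proj i v = (2⁻¹ : ℂ) • (v + ksign 1 i • G.parity v) := by
  have h : v + ksign 1 i • G.parity v = (2 : ℂ) • G.proj i v := by
    conv_lhs => rw [parity, LinearMap.sub_apply]
    nth_rewrite 1 [← G.proj_add v]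
    rcases zmod2_cases i with rfl | rfl
    · rw [ksign_zero_right, two_smul]; simp
    · rw [ksign_one_one, two_smul]; simp only [neg_smul, one_smul, neg_sub]; abel
  rw [h, smul_smul]; simp

theorem mem_gr_iff (i : ZMod 2) (v : V) : v ∈ G.gr i ↔ G.parity v = ksign 1 i • v := by
  refine ⟨G.parity_of_mem, fun h => ?_⟩
  have h1 := G.proj_eq i v
  rw [h, smul_smul, SuperModule.ksign_mul_self, one_smul, ← two_smul ℂ v, smul_smul] at h1
  have h2 : v = G.proj i v := by rw [h1]; simp
  rw [h2]
  exact G.proj_mem i v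

/-- The parity operator as a linear equivalence. -/
def parityEquiv : V ≃ₗ[ℂ] V :=
  LinearEquiv.ofLinearMap G.parity G.parity (LinearMap.ext G.parity_parity)
    (LinearMap.ext G.parity_parity)

@[simp] theorem parityEquiv_apply (v : V) : G.parityEquiv v = G.parity v := rfl

theorem proj_mem_of_parity_mem {N : Submodule ℂ V} (h : ∀ v ∈ N, G.parity v ∈ N) (i : ZMod 2) :
    ∀ v ∈ N, G.proj i v ∈ N := fun v hv => by
  rw [proj_eq]
  exact N.smul_mem _ (add_mem hv (N.smul_mem _ (h v hv)))

theorem parity_mem {N : Submodule ℂ V} (h : ∀ (i : ZMod 2), ∀ v ∈ N, G.proj i v ∈ N) :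
    ∀ v ∈ N, G.parity v ∈ N := fun v hv => sub_mem (h 0 v hv) (h 1 v hv)

end SuperGrading

/-- Linear maps out of a Lie superalgebra that agree on homogeneous elements are equal. -/
theorem homog_induction {L : Type*} [AddCommGroup L] [Module ℂ L] [LieSuperalgebra L]
    {p : L → Prop} (hadd : ∀ x y, p x → p y → p (x + y))
    (h : ∀ i, ∀ x ∈ homog L i, p x) (x : L) : p x := by
  rw [← (grading (L := L)).proj_add x]
  exact hadd _ _ (h 0 _ (SuperGrading.proj_mem _ 0 x)) (h 1 _ (SuperGrading.proj_mem _ 1 x))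

/-! ### Modules with all operators; graded and ungraded isomorphisms -/

namespace SuperModule

variable {L : Type*} [AddCommGroup L] [Module ℂ L] [LieSuperalgebra L]

theorem parity_act (V : SuperModule L) {i : ZMod 2} {x : L} (hx : x ∈ homog L i)
    (v : V.carrier) : V.grading.parity (V.act x v) = ksign 1 i • V.act x (V.grading.parity v) := by
  have h : ∀ j, V.grading.parity (V.act x (V.grading.proj j v)) =
      ksign 1 i • V.act x (V.grading.parity (V.grading.proj j v)) := fun j => by
    rw [V.grading.parity_of_mem (V.act_mem hx (V.grading.proj_mem j v)),
      V.grading.parity_of_mem (V.grading.proj_mem j v), map_smul, smul_smul]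
    congr 1
    rcases zmod2_cases i with rfl | rfl <;> rcases zmod2_cases j with rfl | rfl <;>
      simp [zmod2_one_add_one, ksign_zero_right, ksign_one_one]
  conv_lhs => rw [← V.grading.proj_add v, map_add, map_add, h, h, ← smul_add, ← map_add,
    ← map_add, V.grading.proj_add]

/-- The operators of the elements of `S` generate the algebra of all operators on `V`. -/
def FullOn (V : SuperModule L) (S : Set L) : Prop := Algebra.adjoin ℂ (V.act '' S) = ⊤

theorem FullOn.mono {V : SuperModule L} {S T : Set L} (h : V.FullOn S) (hST : S ⊆ T) :
    V.FullOn T := top_le_iff.1 (h.ge.trans (Algebra.adjoin_mono (Set.image_mono hST)))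

theorem FullOn.eq_bot_or_top {V : SuperModule L} {S : Set L} (h : V.FullOn S)
    (N : Submodule ℂ V.carrier) (hN : ∀ x ∈ S, ∀ v ∈ N, V.act x v ∈ N) : N = ⊥ ∨ N = ⊤ := by
  refine eq_bot_or_top_of_forall_stable fun f v hv => ?_
  refine adjoin_stable (S := V.act '' S) ?_ (h.ge Algebra.mem_top) v hv
  rintro _ ⟨x, hx, rfl⟩
  exact hN x hx

/-- Fullness is stronger than irreducibility: it rules out ungraded submodules as well. -/
theorem FullOn.isIrreducible {V : SuperModule L} {S : Set L} (h : V.FullOn S)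
    (hV : Nontrivial V.carrier) : V.IsIrreducible :=
  ⟨hV, fun N _ hN => h.eq_bot_or_top N fun x _ => hN x⟩

/-- An isomorphism of the underlying ungraded modules. -/
def PlainIso (V W : SuperModule L) : Prop :=
  ∃ f : V.carrier ≃ₗ[ℂ] W.carrier, ∀ x v, f (V.act x v) = W.act x (f v)

theorem PlainIso.refl (V : SuperModule L) : PlainIso V V := ⟨LinearEquiv.refl _ _, fun _ _ => rfl⟩

theorem PlainIso.symm {V W : SuperModule L} : PlainIso V W → PlainIso W V := by
  rintro ⟨f, hf⟩
  exact ⟨f.symm, fun x w => f.injective (by simp [hf])⟩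

theorem PlainIso.trans {V W U : SuperModule L} : PlainIso V W → PlainIso W U → PlainIso V U := by
  rintro ⟨f, hf⟩ ⟨g, hg⟩
  exact ⟨f.trans g, fun x w => by simp [hf, hg]⟩

/-- Isomorphic modules are related by an intertwiner that commutes with parity up to a sign. -/
theorem Iso.exists_plain {V W : SuperModule L} (h : Iso V W) :
    ∃ (d : ZMod 2) (f : V.carrier ≃ₗ[ℂ] W.carrier), (∀ x v, f (V.act x v) = W.act x (f v)) ∧
      ∀ v, W.grading.parity (f v) = ksign 1 d • f (V.grading.parity v) := by
  obtain ⟨d, f, h1, h2⟩ := h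
  have hpar : ∀ v, W.grading.parity (f v) = ksign 1 d • f (V.grading.parity v) := by
    intro v
    have h3 : ∀ i, W.grading.parity (f (V.grading.proj i v)) =
        ksign 1 d • f (V.grading.parity (V.grading.proj i v)) := fun i => by
      rw [W.grading.parity_of_mem ((h1 i _).2 (V.grading.proj_mem i v)),
        V.grading.parity_of_mem (V.grading.proj_mem i v), map_smul, smul_smul]
      congr 1
      rcases zmod2_cases i with rfl | rfl <;> rcases zmod2_cases d with rfl | rfl <;>
        simp [zmod2_one_add_one, ksign_zero_right, ksign_one_one]
    conv_lhs => rw [← V.grading.proj_add v, map_add, map_add, h3, h3, ← smul_add, ← map_add,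
      ← map_add, V.grading.proj_add]
  rcases zmod2_cases d with rfl | rfl
  · refine ⟨0, f, fun x => ?_, hpar⟩
    induction x using homog_induction with
    | hadd x y hx hy => intro v; simp [hx, hy]
    | h i x hx => intro v; rw [h2 i x hx, ksign_zero_left, one_smul]
  -- Composing an odd map with parity absorbs the sign `(-1)^|x|`, so the composite intertwines
  -- without signs.
  · refine ⟨1, V.grading.parityEquiv.trans f, fun x => ?_, fun v => by simp [hpar]⟩
    induction x using homog_induction with
    | hadd x y hx hy => intro v; simp only [map_add, LinearMap.add_apply, hx, hy]
    | h i x hx =>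
      intro v
      simp only [LinearEquiv.trans_apply, SuperGrading.parityEquiv_apply]
      rw [parity_act V hx, map_smul, h2 i x hx, smul_smul, ksign_mul_self, one_smul]

theorem Iso.plainIso {V W : SuperModule L} (h : Iso V W) : PlainIso V W := by
  obtain ⟨_, f, hf, _⟩ := h.exists_plain
  exact ⟨f, hf⟩

theorem parity_act_parity (V : SuperModule L) {i : ZMod 2} {x : L} (hx : x ∈ homog L i)
    (v : V.carrier) : V.act x (V.grading.parity v) = ksign 1 i • V.grading.parity (V.act x v) := by
  rw [parity_act V hx, smul_smul, ksign_mul_self, one_smul]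

theorem FullOn.commute_smul {V : SuperModule L} {S : Set L} (h : V.FullOn S)
    {T : Module.End ℂ V.carrier} (hT : ∀ x ∈ S, ∀ v, T (V.act x v) = V.act x (T v)) :
    ∃ c : ℂ, ∀ v, T v = c • v := by
  refine exists_eq_smul_of_commute (S := V.act '' S) h ?_
  rintro _ ⟨x, hx, rfl⟩
  exact hT x hx

/-- For modules without ungraded submodules, ungraded isomorphisms are homogeneous. -/
theorem PlainIso.iso {V W : SuperModule L} {S : Set L} (hV : V.FullOn S) (h : PlainIso V W) :
    Iso V W := by
  obtain ⟨f, hf⟩ := h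
  by_cases hnt : Nontrivial V.carrier
  swap
  · have hs : Subsingleton V.carrier := not_nontrivial_iff_subsingleton.1 hnt
    have hs' : Subsingleton W.carrier := f.symm.injective.subsingleton
    refine ⟨0, f, fun i v => ?_, fun i x hx v => Subsingleton.elim _ _⟩
    rw [Subsingleton.elim (f v) 0, Subsingleton.elim v 0]
    simp
  -- `T` measures the failure of `f` to commute with parity. It commutes with the action, hence is a
  -- scalar `c`, and `c * c = 1`. For `c = 1` the map `f` is even. For `c = -1` it shifts degrees,
  -- and composing with parity supplies the sign demanded of an odd homomorphism.
  let T : Module.End ℂ V.carrier :=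
    f.symm.toLinearMap ∘ₗ W.grading.parity ∘ₗ f.toLinearMap ∘ₗ V.grading.parity
  have hT : ∀ x v, T (V.act x v) = V.act x (T v) := by
    intro x
    induction x using homog_induction with
    | hadd x y hx hy => intro v; simp only [map_add, LinearMap.add_apply, hx, hy]
    | h i x hx =>
      intro v
      apply f.injective
      simp only [T, LinearMap.comp_apply, LinearEquiv.coe_coe, f.apply_symm_apply, hf]
      rw [parity_act V hx, map_smul, hf, map_smul, parity_act W hx, smul_smul, ksign_mul_self,
        one_smul]
  obtain ⟨c, hc⟩ := hV.commute_smul fun x _ => hT x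
  have hpf : ∀ v, W.grading.parity (f v) = c • f (V.grading.parity v) := by
    intro v
    have h1 := congrArg f (hc (V.grading.parity v))
    simp only [T, LinearMap.comp_apply, LinearEquiv.coe_coe, f.apply_symm_apply,
      SuperGrading.parity_parity, map_smul] at h1
    exact h1
  have hc2 : c * c = 1 := by
    obtain ⟨v, hv⟩ := exists_ne (0 : V.carrier)
    have h1 := W.grading.parity_parity (f v)
    rw [hpf, map_smul, hpf, SuperGrading.parity_parity, smul_smul] at h1
    by_contra hne
    have h2 : (c * c - 1) • f v = 0 := by rw [sub_smul, h1, one_smul, sub_self]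
    rcases smul_eq_zero.1 h2 with h3 | h3
    · exact hne (sub_eq_zero.1 h3)
    · exact hv (f.injective (by rw [h3, map_zero]))
  rcases mul_self_eq_one_iff.1 hc2 with rfl | rfl
  · refine ⟨0, f, fun i v => ?_, fun i x _ v => by rw [hf, ksign_zero_left, one_smul]⟩
    rw [add_zero, SuperGrading.mem_gr_iff, SuperGrading.mem_gr_iff, hpf, one_smul, ← map_smul,
      f.injective.eq_iff]
  · refine ⟨1, V.grading.parityEquiv.trans f, fun i v => ?_, fun i x hx v => ?_⟩
    · rw [SuperGrading.mem_gr_iff, SuperGrading.mem_gr_iff, LinearEquiv.trans_apply,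
        SuperGrading.parityEquiv_apply, hpf, SuperGrading.parity_parity, ← map_smul, ← map_smul,
        f.injective.eq_iff, ← V.grading.parityEquiv.injective.eq_iff (b := ksign 1 i • v),
        SuperGrading.parityEquiv_apply, SuperGrading.parityEquiv_apply, SuperGrading.parity_parity,
        map_smul]
      have h1 : ksign 1 (i + 1) = -ksign 1 i := by
        rcases zmod2_cases i with rfl | rfl <;>
          simp [zmod2_one_add_one, ksign_zero_right, ksign_one_one]
      rw [h1, neg_smul, neg_smul, one_smul, neg_inj]
    · simp only [LinearEquiv.trans_apply, SuperGrading.parityEquiv_apply]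
      rw [parity_act V hx, map_smul, hf]

end SuperModule

end EquivMap
end

noncomputable section

namespace EquivMap

open LieSuperalgebra

/-! ### Tensor products of modules -/

namespace SuperModule

variable {L L' : Type*} [AddCommGroup L] [Module ℂ L] [LieSuperalgebra L]
  [AddCommGroup L'] [Module ℂ L'] [LieSuperalgebra L']

theorem tensorAct_apply_tmul (V W : SuperModule L) (x : L) (v : V.carrier) (w : W.carrier) :
    tensorAct V W x (v ⊗ₜ[ℂ] w) = V.act x v ⊗ₜ[ℂ] w +
      (v ⊗ₜ[ℂ] W.act ((LieSuperalgebra.grading (L := L)).proj 0 x) w +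
        V.grading.parity v ⊗ₜ[ℂ] W.act ((LieSuperalgebra.grading (L := L)).proj 1 x) w) := rfl

/-- The tensor action involves the parity of the first factor but not that of the second, so only
`V` needs a homogeneous isomorphism. If that isomorphism anticommutes with parity, inserting the
parity of `W` on the second factor restores the signs of the odd elements. -/
theorem plainIso_tensor {V V' W W' : SuperModule L} (h : Iso V V') (h' : PlainIso W W') :
    PlainIso (tensor V W) (tensor V' W') := by
  obtain ⟨d, f, hf, hp⟩ := h.exists_plain
  obtain ⟨g, hg⟩ := h'
  rcases zmod2_cases d with rfl | rfl
  · refine ⟨TensorProduct.congr f g, fun x => LinearMap.congr_fun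
      (f := (TensorProduct.congr f g).toLinearMap ∘ₗ tensorAct V W x)
      (g := tensorAct V' W' x ∘ₗ (TensorProduct.congr f g).toLinearMap)
      (TensorProduct.ext' fun v w => ?_)⟩
    simp only [LinearMap.comp_apply, LinearEquiv.coe_coe, tensorAct_apply_tmul, map_add,
      TensorProduct.congr_tmul, hf, hg, hp, ksign_zero_right, one_smul]
  · let g' := W.grading.parityEquiv.trans g
    refine ⟨TensorProduct.congr f g', fun x => LinearMap.congr_fun
      (f := (TensorProduct.congr f g').toLinearMap ∘ₗ tensorAct V W x)
      (g := tensorAct V' W' x ∘ₗ (TensorProduct.congr f g').toLinearMap)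
      (TensorProduct.ext' fun v w => ?_)⟩
    simp only [LinearMap.comp_apply, LinearEquiv.coe_coe, tensorAct_apply_tmul, map_add,
      TensorProduct.congr_tmul, g', LinearEquiv.trans_apply, SuperGrading.parityEquiv_apply]
    rw [parity_act W (SuperGrading.proj_mem _ 0 x),
      parity_act W (SuperGrading.proj_mem _ 1 x), hp, ksign_zero_right, ksign_one_one,
      one_smul, hf, hg, neg_smul, neg_smul, one_smul, one_smul, map_neg, hg,
      TensorProduct.neg_tmul, TensorProduct.tmul_neg]

theorem map_proj_superHom (φ : SuperHom L L') (i : ZMod 2) (x : L) :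
    (LieSuperalgebra.grading (L := L')).proj i (φ.toFun x) =
      φ.toFun ((LieSuperalgebra.grading (L := L)).proj i x) := by
  have h : ∀ j, φ.toFun ((LieSuperalgebra.grading (L := L)).proj j x) ∈ homog L' j := fun j =>
    φ.map_mem (SuperGrading.proj_mem _ j x)
  conv_lhs => rw [← (LieSuperalgebra.grading (L := L)).proj_add x, map_add, map_add,
    SuperGrading.proj_of_mem _ i (h 0), SuperGrading.proj_of_mem _ i (h 1)]
  rcases zmod2_cases i with rfl | rfl <;> simp

theorem plainIso_pullback_tensor (φ : SuperHom L L') (V W : SuperModule L') :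
    PlainIso ((tensor V W).pullback φ) (tensor (V.pullback φ) (W.pullback φ)) := by
  refine ⟨LinearEquiv.refl _ _, fun x t => ?_⟩
  change tensorAct V W (φ.toFun x) t = tensorAct (V.pullback φ) (W.pullback φ) x t
  simp only [tensorAct, LinearMap.coe_mk, AddHom.coe_mk, map_proj_superHom]
  rfl

theorem PlainIso.pullback (φ : SuperHom L L') {V W : SuperModule L'} (h : PlainIso V W) :
    PlainIso (V.pullback φ) (W.pullback φ) := by
  obtain ⟨f, hf⟩ := h
  exact ⟨f, fun x v => hf _ v⟩

theorem plainIso_tensorList {l l' : List (SuperModule L)} (h : List.Forall₂ Iso l l') :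
    PlainIso (tensorList l) (tensorList l') := by
  induction h with
  | nil => exact PlainIso.refl _
  | cons h _ ih => exact plainIso_tensor h ih

theorem plainIso_pullback_tensorList (φ : SuperHom L L') (l : List (SuperModule L')) :
    PlainIso ((tensorList l).pullback φ) (tensorList (l.map (pullback φ))) := by
  induction l with
  | nil => exact ⟨LinearEquiv.refl _ _, fun x v => rfl⟩
  | cons V l ih => exact (plainIso_pullback_tensor φ V _).trans (plainIso_tensor (Iso.refl _) ih)

@[simp] theorem trivial_act : (trivial L).act = 0 := rfl

theorem plainIso_tensor_trivial {V W : SuperModule L} (hV : Iso V (trivial L))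
    (hW : PlainIso W (trivial L)) : PlainIso (tensor V W) (trivial L) := by
  refine (plainIso_tensor hV hW).trans ⟨TensorProduct.lid ℂ ℂ, fun x t => ?_⟩
  have h0 : (tensor (trivial L) (trivial L)).act x = 0 := by
    change tensorAct _ _ x = 0
    simp [tensorAct]
  rw [h0, trivial_act]
  exact map_zero _

/-- This allows the list of evaluation points to be enlarged by points where the type is trivial. -/
theorem plainIso_tensorList_append {l l' : List (SuperModule L)}
    (h : ∀ V ∈ l', Iso V (trivial L)) : PlainIso (tensorList (l ++ l')) (tensorList l) := by
  induction l with
  | nil =>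
    induction l' with
    | nil => exact PlainIso.refl _
    | cons V l' ih =>
      exact plainIso_tensor_trivial (h V (by simp)) (ih fun W hW => h W (by simp [hW]))
  | cons V l ih => exact plainIso_tensor (Iso.refl V) ih

/-- Endomorphisms of a line are scalars, so no generators are needed. -/
theorem fullOn_trivial (S : Set L) : (trivial L).FullOn S := by
  refine eq_top_iff.2 fun f _ => ?_
  have hf : f = algebraMap ℂ _ (f (1 : ℂ)) := by
    refine LinearMap.ext_ring (R := ℂ) ?_
    exact (mul_one (M := ℂ) (f (1 : ℂ))).symm
  rw [hf]
  exact Subalgebra.algebraMap_mem _ _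

/-- An irreducible module with zero action is trivial. -/
theorem IsIrreducible.iso_trivial {V : SuperModule L} (hV : V.IsIrreducible)
    (h0 : ∀ x v, V.act x v = 0) : Iso V (trivial L) := by
  obtain ⟨hnt, hs⟩ := hV
  obtain ⟨v, hv⟩ := exists_ne (0 : V.carrier)
  obtain ⟨i, hi⟩ : ∃ i, V.grading.proj i v ≠ 0 := by
    by_contra! h
    exact hv (by rw [← V.grading.proj_add v, h, h, add_zero])
  set w := V.grading.proj i v
  have hw : w ∈ V.grading.gr i := V.grading.proj_mem i v
  have htop : Submodule.span ℂ {w} = ⊤ := by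
    refine (hs (Submodule.span ℂ {w}) (fun j u hu => ?_) (fun x u _ => ?_)).resolve_left ?_
    · obtain ⟨c, rfl⟩ := Submodule.mem_span_singleton.1 hu
      rw [map_smul, V.grading.proj_of_mem j hw]
      split_ifs
      · exact hu
      · simp
    · rw [h0]; exact zero_mem _
    · simpa using hi
  let f : ℂ ≃ₗ[ℂ] V.carrier :=
    (LinearEquiv.toSpanNonzeroSingleton ℂ V.carrier w hi).trans (LinearEquiv.ofTop _ htop)
  have : PlainIso (trivial L) V := ⟨f, fun x v => by
    rw [h0]
    change f 0 = 0
    exact map_zero f⟩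
  exact (this.iso (fullOn_trivial ∅)).symm

/-- The operators on a tensor product are generated by those on the two factors. -/
theorem FullOn.tensor {V W : SuperModule L} [FiniteDimensional ℂ V.carrier]
    [FiniteDimensional ℂ W.carrier] {S T : Set L}
    (hS : ∀ x ∈ S, ∃ i, x ∈ homog L i) (hT : ∀ x ∈ T, ∃ i, x ∈ homog L i)
    (hSW : ∀ x ∈ S, W.act x = 0) (hTV : ∀ x ∈ T, V.act x = 0)
    (hV : V.FullOn S) (hW : W.FullOn T) : (tensor V W).FullOn (S ∪ T) := by
  have hactS : ∀ x ∈ S, (SuperModule.tensor V W).act x = TensorProduct.map (V.act x) LinearMap.id := by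
    intro x hx
    obtain ⟨i, hi⟩ := hS x hx
    have h0 : ∀ j, W.act ((LieSuperalgebra.grading (L := L)).proj j x) = 0 := fun j => by
      rw [SuperGrading.proj_of_mem _ j hi]
      split_ifs
      · exact hSW x hx
      · exact map_zero _
    change tensorAct V W x = _
    simp [tensorAct, h0]
  have hactT : ∀ x ∈ T, ∃ i : ZMod 2, (SuperModule.tensor V W).act x =
      TensorProduct.map (if i = 0 then LinearMap.id else V.grading.parity) (W.act x) := by
    intro x hx
    obtain ⟨i, hi⟩ := hT x hx
    refine ⟨i, ?_⟩
    change tensorAct V W x = _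
    simp only [tensorAct, LinearMap.coe_mk, AddHom.coe_mk, hTV x hx, SuperGrading.proj_of_mem _ _ hi]
    rcases zmod2_cases i with rfl | rfl <;> simp
  set R := Algebra.adjoin ℂ ((SuperModule.tensor V W).act '' (S ∪ T)) with hR
  have h1 : ∀ a : Module.End ℂ V.carrier, TensorProduct.map a LinearMap.id ∈ R := by
    intro a
    have ha : a ∈ Algebra.adjoin ℂ (V.act '' S) := hV.ge Algebra.mem_top
    induction ha using Algebra.adjoin_induction with
    | mem a ha =>
      obtain ⟨x, hx, rfl⟩ := ha
      rw [← hactS x hx]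
      exact Algebra.subset_adjoin ⟨x, Or.inl hx, rfl⟩
    | algebraMap r =>
      have : TensorProduct.map (algebraMap ℂ (Module.End ℂ V.carrier) r)
          (LinearMap.id : W.carrier →ₗ[ℂ] W.carrier) = algebraMap ℂ (Module.End ℂ _) r := by
        refine TensorProduct.ext' fun v w => ?_
        simp [Module.algebraMap_end_apply, TensorProduct.smul_tmul']
      rw [this]
      exact R.algebraMap_mem r
    | add a b _ _ ha hb => rw [TensorProduct.map_add_left]; exact R.add_mem ha hb
    | mul a b _ _ ha hb =>
      have : TensorProduct.map (a * b) (LinearMap.id : W.carrier →ₗ[ℂ] W.carrier) =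
          (TensorProduct.map a LinearMap.id : Module.End ℂ _) *
            (TensorProduct.map b LinearMap.id : Module.End ℂ _) :=
        TensorProduct.ext' fun v w => rfl
      rw [this]
      exact R.mul_mem ha hb
  have h2 : ∀ b : Module.End ℂ W.carrier, TensorProduct.map LinearMap.id b ∈ R := by
    intro b
    have hb : b ∈ Algebra.adjoin ℂ (W.act '' T) := hW.ge Algebra.mem_top
    induction hb using Algebra.adjoin_induction with
    | mem b hb =>
      obtain ⟨x, hx, rfl⟩ := hb
      obtain ⟨i, hi⟩ := hactT x hx
      have hm : TensorProduct.map (if i = 0 then LinearMap.id else V.grading.parity) (W.act x) ∈ R :=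
        hi ▸ Algebra.subset_adjoin ⟨x, Or.inr hx, rfl⟩
      -- An odd `x` in `T` acts as parity tensor `x`. Parity of `V` on the first factor already
      -- belongs to `R`, and multiplying by it removes the sign.
      have h3 := R.mul_mem (h1 (if i = 0 then LinearMap.id else V.grading.parity)) hm
      have h4 : (TensorProduct.map LinearMap.id (W.act x) : Module.End ℂ (V.carrier ⊗[ℂ] W.carrier)) =
          (TensorProduct.map (if i = 0 then LinearMap.id else V.grading.parity) LinearMap.id :
            Module.End ℂ _) * (TensorProduct.map
              (if i = 0 then LinearMap.id else V.grading.parity) (W.act x) : Module.End ℂ _) := by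
        refine TensorProduct.ext' fun v w => ?_
        simp only [Module.End.mul_apply, TensorProduct.map_tmul]
        split_ifs <;> simp [SuperGrading.parity_parity]
      rw [h4]
      exact h3
    | algebraMap r =>
      have : TensorProduct.map (LinearMap.id : V.carrier →ₗ[ℂ] V.carrier)
          (algebraMap ℂ (Module.End ℂ W.carrier) r) = algebraMap ℂ (Module.End ℂ _) r := by
        refine TensorProduct.ext' fun v w => ?_
        simp [Module.algebraMap_end_apply]
      rw [this]
      exact R.algebraMap_mem r
    | add a b _ _ ha hb => rw [TensorProduct.map_add_right]; exact R.add_mem ha hb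
    | mul a b _ _ ha hb =>
      have : TensorProduct.map (LinearMap.id : V.carrier →ₗ[ℂ] V.carrier) (a * b) =
          (TensorProduct.map LinearMap.id a : Module.End ℂ _) *
            (TensorProduct.map LinearMap.id b : Module.End ℂ _) :=
        TensorProduct.ext' fun v w => rfl
      rw [this]
      exact R.mul_mem ha hb
  refine eq_top_iff.2 fun f hf => ?_
  clear hf
  -- By finite dimensionality every operator on the tensor product is a sum of operators `a ⊗ b`.
  obtain ⟨z, rfl⟩ : ∃ z, TensorProduct.homTensorHomMap (.id ℂ) V.carrier W.carrier V.carrier W.carrier z = f := by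
    obtain ⟨z, hz⟩ := (homTensorHomEquiv ℂ V.carrier W.carrier V.carrier W.carrier).surjective f
    exact ⟨z, by rw [← hz, homTensorHomEquiv_apply]⟩
  induction z with
  | zero => rw [map_zero]; exact R.zero_mem
  | add y z hy hz => rw [map_add]; exact R.add_mem hy hz
  | tmul a b =>
    rw [TensorProduct.homTensorHomMap_apply]
    have : (TensorProduct.map a b : Module.End ℂ (V.carrier ⊗[ℂ] W.carrier)) =
        (TensorProduct.map a LinearMap.id : Module.End ℂ _) *
          (TensorProduct.map LinearMap.id b : Module.End ℂ _) :=
      TensorProduct.ext' fun v w => rfl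
    rw [this]
    exact R.mul_mem (h1 a) (h2 b)

end SuperModule

end EquivMap
end

noncomputable section

namespace EquivMap

open LieSuperalgebra

/-! ### Highest weight theory -/

/-- A weight decomposition of a Lie superalgebra with respect to an even element `H` with integral
eigenvalues, whose zero weight space is even and commutative. -/
structure Triangular (L : Type*) [AddCommGroup L] [Module ℂ L] [LieSuperalgebra L] where
  H : L
  R : ℤ → ZMod 2 → Submodule ℂ L
  H_even : H ∈ homog L 0
  le_homog : ∀ k i, R k i ≤ homog L i
  br_H : ∀ {k i x}, x ∈ R k i → br H x = (k : ℂ) • x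
  br_mem : ∀ {k l i j x y}, x ∈ R k i → y ∈ R l j → br x y ∈ R (k + l) (i + j)
  iSup_eq_top : ⨆ k, ⨆ i, R k i = ⊤
  zero_one : R 0 1 = ⊥
  zero_comm : ∀ {x y}, x ∈ R 0 0 → y ∈ R 0 0 → br x y = 0

namespace Triangular

variable {L : Type*} [AddCommGroup L] [Module ℂ L] [LieSuperalgebra L] (T : Triangular L)

theorem induction {p : L → Prop} (h0 : p 0) (hadd : ∀ x y, p x → p y → p (x + y))
    (h : ∀ k i, ∀ x ∈ T.R k i, p x) (x : L) : p x := by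
  have hx : x ∈ ⨆ k, ⨆ i, T.R k i := T.iSup_eq_top ▸ Submodule.mem_top
  induction hx using Submodule.iSup_induction' with
  | mem k x hx =>
    induction hx using Submodule.iSup_induction' with
    | mem i x hx => exact h k i x hx
    | zero => exact h0
    | add x y _ _ hx hy => exact hadd x y hx hy
  | zero => exact h0
  | add x y _ _ hx hy => exact hadd x y hx hy

variable (V : SuperModule L)

/-- Stability under the nonnegative weight spaces. -/
def BorelStable (W : Submodule ℂ V.carrier) : Prop :=
  ∀ k i, 0 ≤ k → ∀ x ∈ T.R k i, ∀ w ∈ W, V.act x w ∈ W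

/-- Stability under the negative weight spaces. -/
def NegStable (W : Submodule ℂ V.carrier) : Prop :=
  ∀ k i, k < 0 → ∀ x ∈ T.R k i, ∀ w ∈ W, V.act x w ∈ W

variable {V} in
/-- A graded subspace stable under the nonnegative weight spaces generates an irreducible module
under the negative ones. -/
theorem eq_top_of_negStable (hV : V.IsIrreducible) {W Z : Submodule ℂ V.carrier} (hW0 : W ≠ ⊥)
    (hWgr : ∀ i, ∀ w ∈ W, V.grading.proj i w ∈ W) (hW : T.BorelStable V W)
    (hZ : T.NegStable V Z) (hWZ : W ≤ Z) : Z = ⊤ := by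
  -- The smallest candidate for `Z`. It turns out to be a graded submodule, which takes the place of
  -- a PBW argument.
  let U : Submodule ℂ V.carrier := sInf {Z | T.NegStable V Z ∧ W ≤ Z}
  have hUmin : ∀ Z, T.NegStable V Z → W ≤ Z → U ≤ Z := fun Z h1 h2 => sInf_le ⟨h1, h2⟩
  have hWU : W ≤ U := le_sInf fun Z hZ => hZ.2
  have hUneg : T.NegStable V U := by
    intro k i hk x hx w hw
    refine Submodule.mem_sInf.2 fun Z hZ => ?_
    exact hZ.1 k i hk x hx w (Submodule.mem_sInf.1 hw Z hZ)
  -- `U₁` is stable under a negative `y` because `x y u = [x, y] u ± y x u`, where both terms lie in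
  -- `U`. It contains `W` by Borel stability, so minimality gives `U ≤ U₁`, that is, `U` is a
  -- submodule.
  let U₁ : Submodule ℂ V.carrier :=
    { carrier := {u | u ∈ U ∧ ∀ x, V.act x u ∈ U}
      zero_mem' := ⟨zero_mem _, fun x => by rw [map_zero]; exact zero_mem _⟩
      add_mem' := fun ha hb => ⟨add_mem ha.1 hb.1, fun x => by
        rw [map_add]; exact add_mem (ha.2 x) (hb.2 x)⟩
      smul_mem' := fun c a ha => ⟨U.smul_mem c ha.1, fun x => by
        rw [map_smul]; exact U.smul_mem c (ha.2 x)⟩ }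
  have hU₁ : U ≤ U₁ := by
    refine hUmin U₁ ?_ ?_
    · rintro k i hk y hy u ⟨hu, hu'⟩
      refine ⟨hUneg k i hk y hy u hu, fun x => ?_⟩
      induction x using T.induction with
      | h0 => simp
      | hadd x x' h h' => rw [map_add, LinearMap.add_apply]; exact add_mem h h'
      | h l j x hx =>
        have h1 := V.act_br (T.le_homog _ _ hx) (T.le_homog _ _ hy) u
        rw [eq_sub_iff_add_eq] at h1
        rw [← h1]
        exact add_mem (hu' _) (U.smul_mem _ (hUneg k i hk y hy _ (hu' x)))
    · intro w hw
      refine ⟨hWU hw, fun x => ?_⟩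
      induction x using T.induction with
      | h0 => simp
      | hadd x x' h h' => rw [map_add, LinearMap.add_apply]; exact add_mem h h'
      | h l j x hx =>
        rcases lt_or_ge l 0 with hl | hl
        · exact hUneg l j hl x hx w (hWU hw)
        · exact hWU (hW l j hl x hx w hw)
  let U₂ : Submodule ℂ V.carrier := U.comap V.grading.parity
  have hU₂ : U ≤ U₂ := by
    refine hUmin U₂ ?_ fun w hw => hWU (V.grading.parity_mem hWgr w hw)
    intro k i hk y hy u hu
    change V.grading.parity _ ∈ U
    rw [V.parity_act (T.le_homog _ _ hy)]
    exact U.smul_mem _ (hUneg k i hk y hy _ hu)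
  have hU : U = ⊤ := by
    refine (hV.2 U (V.grading.proj_mem_of_parity_mem hU₂) fun x v hv => (hU₁ hv).2 x).resolve_left ?_
    intro h
    exact hW0 (le_bot_iff.1 (h ▸ hWU))
  exact top_le_iff.1 (hU ▸ hUmin Z hZ hWZ)

/-- The eigenspace of `H` with eigenvalue `c`. -/
def eig (c : ℂ) : Submodule ℂ V.carrier := Module.End.eigenspace (V.act T.H) c

/-- The sum of the eigenspaces of `H` with eigenvalues `c - 1, c - 2, …`. -/
def low (c : ℂ) : Submodule ℂ V.carrier := ⨆ k : ℕ, T.eig V (c - (k + 1))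

variable {V}

theorem mem_eig {c : ℂ} {v : V.carrier} : v ∈ T.eig V c ↔ V.act T.H v = c • v :=
  Module.End.mem_eigenspace_iff

theorem act_mem_eig {k : ℤ} {i : ZMod 2} {x : L} (hx : x ∈ T.R k i) {c : ℂ} {v : V.carrier}
    (hv : v ∈ T.eig V c) : V.act x v ∈ T.eig V (c + k) := by
  rw [mem_eig] at hv ⊢
  have h := V.act_br T.H_even (T.le_homog _ _ hx) v
  rw [T.br_H hx, ksign_zero_left, one_smul, eq_sub_iff_add_eq] at h
  rw [← h, hv, map_smul, map_smul, LinearMap.smul_apply, add_smul, add_comm]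

theorem eig_parity {c : ℂ} {v : V.carrier} (hv : v ∈ T.eig V c) :
    V.grading.parity v ∈ T.eig V c := by
  rw [mem_eig] at hv ⊢
  rw [V.parity_act_parity T.H_even, hv, ksign_zero_right, one_smul, map_smul]

theorem eig_le_low (c : ℂ) {k : ℤ} (hk : k < 0) : T.eig V (c + k) ≤ T.low V c := by
  obtain ⟨m, rfl⟩ : ∃ m : ℕ, k = -(m + 1 : ℤ) := ⟨(-k - 1).toNat, by omega⟩
  refine le_trans (le_of_eq ?_) (le_iSup (fun k : ℕ => T.eig V (c - (k + 1))) m)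
  congr 1
  push_cast
  ring

theorem low_negStable (c : ℂ) : T.NegStable V (T.low V c) := by
  intro k i hk x hx w hw
  induction hw using Submodule.iSup_induction' with
  | mem m w hw =>
    have h := T.act_mem_eig hx hw
    refine T.eig_le_low c (k := -(m + 1 : ℤ) + k) (by omega) ?_
    convert h using 2
    push_cast
    ring
  | zero => simp
  | add u w _ _ hu hw => rw [map_add]; exact add_mem hu hw

theorem eig_disjoint_low (c : ℂ) : Disjoint (T.eig V c) (T.low V c) := by
  have h := (Module.End.eigenspaces_iSupIndep (V.act T.H)) c
  refine h.mono_right (iSup_le fun k => ?_)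
  refine le_iSup₂_of_le (f := fun j (_ : j ≠ c) => Module.End.eigenspace (V.act T.H) j)
    (c - (k + 1)) ?_ le_rfl
  intro he
  have : ((k : ℂ) + 1) = 0 := by linear_combination -he
  exact Nat.cast_add_one_ne_zero k this

theorem finite_eig [FiniteDimensional ℂ V.carrier] : {c : ℂ | T.eig V c ≠ ⊥}.Finite :=
  Module.End.finite_hasEigenvalue (V.act T.H)

/-- A nonzero subspace stable under `H` contains an eigenvector of `H` whose eigenvalue has maximal
real part. -/
theorem exists_max_eig [FiniteDimensional ℂ V.carrier] {N : Submodule ℂ V.carrier} (hN0 : N ≠ ⊥)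
    (hN : ∀ v ∈ N, V.act T.H v ∈ N) : ∃ c : ℂ, T.eig V c ⊓ N ≠ ⊥ ∧
      ∀ c' : ℂ, T.eig V c' ⊓ N ≠ ⊥ → c'.re ≤ c.re := by
  have hne : {c : ℂ | T.eig V c ⊓ N ≠ ⊥}.Nonempty := by
    have : Nontrivial N := (Submodule.nontrivial_iff_ne_bot).2 hN0
    obtain ⟨c, hc⟩ := Module.End.exists_eigenvalue ((V.act T.H).restrict hN)
    obtain ⟨v, hv⟩ := hc.exists_hasEigenvector
    refine ⟨c, (Submodule.ne_bot_iff _).2 ⟨v.1, ⟨?_, v.2⟩, fun h => hv.2 (Subtype.ext h)⟩⟩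
    exact T.mem_eig.2 (congrArg Subtype.val hv.apply_eq_smul)
  have hfin : {c : ℂ | T.eig V c ⊓ N ≠ ⊥}.Finite := T.finite_eig.subset fun c hc h => hc (by
    rw [h, bot_inf_eq])
  -- Real parts are compared because `H` is only known to have integral eigenvalues on `L`; on a
  -- module they are complex numbers, which root vectors shift by integers.
  obtain ⟨c, hc, hmax⟩ := hfin.exists_maximalFor Complex.re _ hne
  exact ⟨c, hc, fun c' hc' => (le_total c'.re c.re).elim id fun h => hmax hc' h⟩

variable (V) in
/-- The vectors of weight `c` killed by the positive weight spaces. -/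
def singular (c : ℂ) : Submodule ℂ V.carrier where
  carrier := {v | v ∈ T.eig V c ∧ ∀ k i, 0 < k → ∀ x ∈ T.R k i, V.act x v = 0}
  zero_mem' := ⟨zero_mem _, fun _ _ _ _ _ => map_zero _⟩
  add_mem' := fun ha hb => ⟨add_mem ha.1 hb.1, fun k i hk x hx => by
    rw [map_add, ha.2 k i hk x hx, hb.2 k i hk x hx, add_zero]⟩
  smul_mem' := fun c a ha => ⟨Submodule.smul_mem _ c ha.1, fun k i hk x hx => by
    rw [map_smul, ha.2 k i hk x hx, smul_zero]⟩

theorem singular_parity {c : ℂ} {v : V.carrier} (hv : v ∈ T.singular V c) :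
    V.grading.parity v ∈ T.singular V c := by
  refine ⟨T.eig_parity hv.1, fun k i hk x hx => ?_⟩
  rw [V.parity_act_parity (T.le_homog _ _ hx), hv.2 k i hk x hx, map_zero, smul_zero]

/-- For `x` of weight zero and `y` of positive weight, `[y, x]` has positive weight, and `y x v =
[y, x] v ± x y v = 0`. -/
theorem singular_borelStable (c : ℂ) : T.BorelStable V (T.singular V c) := by
  intro k i hk x hx v hv
  rcases hk.lt_or_eq with hk | rfl
  · rw [hv.2 k i hk x hx]
    exact zero_mem _
  · refine ⟨by simpa using T.act_mem_eig hx hv.1, fun l j hl y hy => ?_⟩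
    have h := V.act_br (T.le_homog _ _ hy) (T.le_homog _ _ hx) v
    rw [hv.2 _ _ (by omega) _ (T.br_mem hy hx), hv.2 l j hl y hy, map_zero, smul_zero,
      sub_zero] at h
    exact h.symm

/-- A positive root vector that did not kill `v` would produce in `N` an eigenvalue of larger real
part. -/
theorem mem_singular_of_max {c : ℂ} {N : Submodule ℂ V.carrier}
    (hN : ∀ x, ∀ v ∈ N, V.act x v ∈ N)
    (hmax : ∀ c' : ℂ, T.eig V c' ⊓ N ≠ ⊥ → c'.re ≤ c.re) {v : V.carrier} (hv : v ∈ T.eig V c)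
    (hvN : v ∈ N) : v ∈ T.singular V c := by
  refine ⟨hv, fun k i hk x hx => ?_⟩
  by_contra h
  have h1 := hmax (c + k) ((Submodule.ne_bot_iff _).2 ⟨_, ⟨T.act_mem_eig hx hv, hN x v hvN⟩, h⟩)
  have h2 : (0 : ℝ) < k := by exact_mod_cast hk
  simp at h1
  linarith

/-- A highest weight vector of an irreducible module: it is homogeneous, killed by positive weight
spaces and an eigenvector of the zero weight space, with eigenvalue `c` of maximal real part. -/
structure IsHighest (V : SuperModule L) (c : ℂ) (v : V.carrier) : Prop where
  ne_zero : v ≠ 0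
  homog : ∃ i, v ∈ V.grading.gr i
  mem : v ∈ T.singular V c
  cartan : ∀ x ∈ T.R 0 0, ∃ a : ℂ, V.act x v = a • v
  max : ∀ c' : ℂ, T.eig V c' ≠ ⊥ → c'.re ≤ c.re

theorem exists_isHighest [FiniteDimensional ℂ V.carrier] (hV : Nontrivial V.carrier) :
    ∃ c v, T.IsHighest V c v := by
  obtain ⟨c, hc, hmax⟩ := T.exists_max_eig (V := V) (N := ⊤) top_ne_bot fun _ _ => Submodule.mem_top
  have hmax' : ∀ c' : ℂ, T.eig V c' ≠ ⊥ → c'.re ≤ c.re := fun c' h => hmax c' (by simpa using h)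
  have hsing : T.singular V c ≠ ⊥ := by
    obtain ⟨v, ⟨hv, _⟩, hv0⟩ := (Submodule.ne_bot_iff _).1 hc
    exact (Submodule.ne_bot_iff _).2 ⟨v, T.mem_singular_of_max (fun _ _ _ => Submodule.mem_top) hmax
      hv Submodule.mem_top, hv0⟩
  -- On a minimal such `W` the zero weight space acts by scalars: an eigenspace in `W` of one of its
  -- elements is stable under the others, which commute with it, and under parity, since the element
  -- is even. Any homogeneous component of a vector of `W` is then a simultaneous eigenvector.
  obtain ⟨W, ⟨hWs, hWp, hWx⟩, hW0, hWmin⟩ := exists_minimal_submodule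
    (fun W => W ≤ T.singular V c ∧ (∀ v ∈ W, V.grading.parity v ∈ W) ∧
      ∀ x ∈ T.R 0 0, ∀ v ∈ W, V.act x v ∈ W)
    (N := T.singular V c) ⟨le_rfl, fun v hv => T.singular_parity hv,
      fun x hx v hv => T.singular_borelStable c 0 0 le_rfl x hx v hv⟩ hsing
  obtain ⟨w, hw, hw0⟩ := (Submodule.ne_bot_iff _).1 hW0
  obtain ⟨i, hi⟩ : ∃ i, V.grading.proj i w ≠ 0 := by
    by_contra! h
    exact hw0 (by rw [← V.grading.proj_add w, h, h, add_zero])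
  have hwi : V.grading.proj i w ∈ W := V.grading.proj_mem_of_parity_mem hWp i w hw
  refine ⟨c, V.grading.proj i w, hi, ⟨i, V.grading.proj_mem i w⟩, hWs hwi, fun x hx => ?_, hmax'⟩
  have : Nontrivial W := (Submodule.nontrivial_iff_ne_bot).2 hW0
  obtain ⟨a, ha⟩ := Module.End.exists_eigenvalue ((V.act x).restrict (hWx x hx))
  obtain ⟨u, hu⟩ := ha.exists_hasEigenvector
  have hux : V.act x u.1 = a • u.1 := congrArg Subtype.val hu.apply_eq_smul
  have hE : Module.End.eigenspace (V.act x) a ⊓ W = W := by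
    refine (hWmin _ inf_le_right ⟨inf_le_right.trans hWs, ?_, ?_⟩).resolve_left ?_
    · rintro v ⟨hv, hvW⟩
      refine ⟨?_, hWp v hvW⟩
      rw [SetLike.mem_coe, Module.End.mem_eigenspace_iff] at hv ⊢
      rw [V.parity_act_parity (T.le_homog _ _ hx), hv, ksign_zero_right, one_smul, map_smul]
    · rintro y hy v ⟨hv, hvW⟩
      refine ⟨?_, hWx y hy v hvW⟩
      rw [SetLike.mem_coe, Module.End.mem_eigenspace_iff] at hv ⊢
      have h := V.act_br (T.le_homog _ _ hx) (T.le_homog _ _ hy) v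
      rw [T.zero_comm hx hy, map_zero, LinearMap.zero_apply, ksign_zero_left, one_smul] at h
      rw [sub_eq_zero.1 h.symm, hv, map_smul]
    · intro h
      have h1 : u.1 ∈ Module.End.eigenspace (V.act x) a ⊓ W :=
        ⟨Module.End.mem_eigenspace_iff.2 hux, u.2⟩
      rw [h] at h1
      exact hu.2 (Subtype.ext h1)
  have h2 : V.grading.proj i w ∈ Module.End.eigenspace (V.act x) a ⊓ W := hE.symm ▸ hwi
  exact ⟨a, Module.End.mem_eigenspace_iff.1 h2.1⟩

/-! ### Consequences of a highest weight vector in an irreducible module -/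

namespace IsHighest

variable {T} {c : ℂ} {v : V.carrier}

theorem borel (h : T.IsHighest V c v) {k : ℤ} {i : ZMod 2} (hk : 0 ≤ k) {x : L} (hx : x ∈ T.R k i) :
    ∃ a : ℂ, V.act x v = a • v := by
  rcases hk.lt_or_eq with hk | rfl
  · exact ⟨0, by rw [h.mem.2 k i hk x hx, zero_smul]⟩
  · rcases zmod2_cases i with rfl | rfl
    · exact h.cartan x hx
    · rw [T.zero_one, Submodule.mem_bot] at hx
      exact ⟨0, by simp [hx]⟩

theorem span_proj (h : T.IsHighest V c v) : ∀ i, ∀ w ∈ Submodule.span ℂ {v}, V.grading.proj i w ∈ Submodule.span ℂ {v} := by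
  obtain ⟨j, hj⟩ := h.homog
  intro i w hw
  obtain ⟨a, rfl⟩ := Submodule.mem_span_singleton.1 hw
  rw [map_smul, V.grading.proj_of_mem i hj]
  split_ifs
  · exact hw
  · simp

theorem span_borelStable (h : T.IsHighest V c v) : T.BorelStable V (Submodule.span ℂ {v}) := by
  intro k i hk x hx w hw
  obtain ⟨a, rfl⟩ := Submodule.mem_span_singleton.1 hw
  obtain ⟨b, hb⟩ := h.borel hk hx
  rw [map_smul, hb, smul_smul]
  exact Submodule.mem_span_singleton.2 ⟨_, rfl⟩

theorem span_ne_bot (h : T.IsHighest V c v) : Submodule.span ℂ {v} ≠ ⊥ := by simpa using h.ne_zero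

/-- A subspace stable under the negative weight spaces that contains a highest weight vector. -/
theorem eq_top (h : T.IsHighest V c v) (hV : V.IsIrreducible) {Z : Submodule ℂ V.carrier} (hZ : T.NegStable V Z)
    (hv : v ∈ Z) : Z = ⊤ :=
  T.eq_top_of_negStable hV h.span_ne_bot h.span_proj h.span_borelStable hZ
    ((Submodule.span_singleton_le_iff_mem _ _).2 hv)

theorem low_ne_top (h : T.IsHighest V c v) : T.low V c ≠ ⊤ := fun ht =>
  h.ne_zero (Submodule.disjoint_def.1 (T.eig_disjoint_low c) v h.mem.1 (ht ▸ Submodule.mem_top))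

/-- If nonzero, `W` would generate the module under the negative root vectors; these preserve the
sum of the lower weight spaces, which does not contain `v`. -/
theorem eq_bot_of_le_low (h : T.IsHighest V c v) (hV : V.IsIrreducible) {W : Submodule ℂ V.carrier}
    (hWgr : ∀ i, ∀ w ∈ W, V.grading.proj i w ∈ W) (hW : T.BorelStable V W)
    (hle : W ≤ T.low V c) : W = ⊥ := by
  by_contra h0
  exact h.low_ne_top (T.eq_top_of_negStable hV h0 hWgr hW (T.low_negStable c) hle)

/-- Because elements of nonnegative weight act on `v` by scalars, negative root vectors generate
everything from the line through `v`, and what they produce has lower weight. Only the line is left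
in weight `c`. -/
theorem eig_le_span (h : T.IsHighest V c v) (hV : V.IsIrreducible) : T.eig V c ≤ Submodule.span ℂ {v} := by
  have htop : Submodule.span ℂ {v} ⊔ T.low V c = ⊤ := by
    refine h.eq_top hV ?_ (Submodule.mem_sup_left (Submodule.mem_span_singleton_self v))
    intro k i hk x hx w hw
    obtain ⟨y, hy, z, hz, rfl⟩ := Submodule.mem_sup.1 hw
    obtain ⟨a, rfl⟩ := Submodule.mem_span_singleton.1 hy
    rw [map_add]
    refine Submodule.mem_sup_right (add_mem (T.eig_le_low c hk ?_) (T.low_negStable c k i hk x hx z hz))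
    exact T.act_mem_eig hx (Submodule.smul_mem _ _ h.mem.1)
  intro w hw
  have hw' : w ∈ Submodule.span ℂ {v} ⊔ T.low V c := htop ▸ Submodule.mem_top
  obtain ⟨y, hy, z, hz, rfl⟩ := Submodule.mem_sup.1 hw'
  have hye : y ∈ T.eig V c := (Submodule.span_singleton_le_iff_mem _ _).2 h.mem.1 hy
  have hze : z ∈ T.eig V c := by simpa using sub_mem hw hye
  rw [Submodule.disjoint_def.1 (T.eig_disjoint_low c) z hze hz, add_zero]
  exact hy

end IsHighest

/-- Finite-dimensional irreducible modules have no ungraded submodules. -/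
theorem eq_bot_or_top (T : Triangular L) [FiniteDimensional ℂ V.carrier] (hV : V.IsIrreducible)
    (N : Submodule ℂ V.carrier) (hN : ∀ x, ∀ v ∈ N, V.act x v ∈ N) : N = ⊥ ∨ N = ⊤ := by
  by_cases hN0 : N = ⊥
  · exact Or.inl hN0
  right
  obtain ⟨c, v, hv⟩ := T.exists_isHighest hV.1
  obtain ⟨c', hc', hmax⟩ := T.exists_max_eig hN0 (hN T.H)
  obtain ⟨w, ⟨hw, hwN⟩, hw0⟩ := (Submodule.ne_bot_iff _).1 hc'
  have hws := T.mem_singular_of_max hN hmax hw hwN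
  -- Unlike `N`, the space of singular vectors of weight `c'` is graded, so it generates `V`
  -- downwards. The eigenvalues of `H` on `V` are therefore among `c'`, `c' - 1`, `c' - 2`, …, and
  -- maximality of the real part of `c` forces `c = c'`.
  have htop : T.eig V c' ⊔ T.low V c' = ⊤ := by
    refine T.eq_top_of_negStable hV (W := T.singular V c')
      ((Submodule.ne_bot_iff _).2 ⟨w, hws, hw0⟩)
      (fun i => V.grading.proj_mem_of_parity_mem (fun v hv => T.singular_parity hv) i)
      (T.singular_borelStable c') ?_ (le_trans (fun _ h => h.1) le_sup_left)
    intro k i hk x hx u hu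
    obtain ⟨y, hy, z, hz, rfl⟩ := Submodule.mem_sup.1 hu
    rw [map_add]
    exact Submodule.mem_sup_right (add_mem (T.eig_le_low c' hk (T.act_mem_eig hx hy))
      (T.low_negStable c' k i hk x hx z hz))
  have hcc : c = c' := by
    by_contra hne
    have hd : Disjoint (T.eig V c) (T.eig V c' ⊔ T.low V c') := by
      refine ((Module.End.eigenspaces_iSupIndep (V.act T.H)) c).mono_right ?_
      have hle : ∀ j, j ≠ c → T.eig V j ≤ ⨆ j, ⨆ (_ : j ≠ c), Module.End.eigenspace (V.act T.H) j :=
        fun j hj => le_iSup₂_of_le (f := fun j (_ : j ≠ c) => Module.End.eigenspace (V.act T.H) j)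
          j hj le_rfl
      refine sup_le (hle c' (Ne.symm hne)) (iSup_le fun k => hle _ fun he => ?_)
      have h1 := hv.max c' ((Submodule.ne_bot_iff _).2 ⟨w, hw, hw0⟩)
      have h2 := congrArg Complex.re he
      simp at h2
      have : (0 : ℝ) ≤ k := Nat.cast_nonneg k
      linarith
    rw [htop] at hd
    exact hv.ne_zero (Submodule.disjoint_def.1 hd v hv.mem.1 Submodule.mem_top)
  subst hcc
  -- The top weight space is a line, so a nonzero vector of `N` of that weight is a multiple of `v`,
  -- and `N` contains the generator `v`.
  obtain ⟨a, rfl⟩ := Submodule.mem_span_singleton.1 (hv.eig_le_span hV hw)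
  have ha : a ≠ 0 := fun h => hw0 (by rw [h, zero_smul])
  exact hv.eq_top hV (fun k i _ x _ u hu => hN x u hu) ((N.smul_mem_iff ha).1 hwN)

/-- Burnside's theorem applies because irreducibility excludes ungraded submodules too. In
particular Schur's lemma holds without an odd exception. -/
theorem fullOn_univ (T : Triangular L) [FiniteDimensional ℂ V.carrier] (hV : V.IsIrreducible) :
    V.FullOn Set.univ := by
  have := hV.1
  refine adjoin_eq_top_of_simple fun N hN => T.eq_bot_or_top hV N fun x v hv => ?_
  exact hN _ ⟨x, Set.mem_univ x, rfl⟩ v hv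

end Triangular

end EquivMap
end

noncomputable section

namespace EquivMap

open LieSuperalgebra

/-! ### Modules over map superalgebras -/

section MapModules

variable {L : Type*} [AddCommGroup L] [Module ℂ L] {A : Type*} [CommRing A] [Algebra ℂ A]

variable (L) in
/-- Multiplication by an element of `A` on `L ⊗ A`. -/
def mulA (a : A) : L ⊗[ℂ] A →ₗ[ℂ] L ⊗[ℂ] A := (LinearMap.mulLeft ℂ a).lTensor L

@[simp] theorem mulA_tmul (a : A) (x : L) (b : A) : mulA L a (x ⊗ₜ[ℂ] b) = x ⊗ₜ[ℂ] (a * b) := rfl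

theorem mulA_add (a b : A) (t : L ⊗[ℂ] A) : mulA L (a + b) t = mulA L a t + mulA L b t := by
  induction t with
  | zero => simp
  | add t t' h h' => simp only [map_add, h, h']; abel
  | tmul x c => simp only [mulA_tmul, add_mul, TensorProduct.tmul_add]

theorem mulA_smul (z : ℂ) (a : A) (t : L ⊗[ℂ] A) : mulA L (z • a) t = z • mulA L a t := by
  induction t with
  | zero => simp
  | add t t' h h' => simp only [map_add, h, h', smul_add]
  | tmul x c => simp only [mulA_tmul, smul_mul_assoc, TensorProduct.tmul_smul]

theorem mulA_sum {ι : Type*} (s : Finset ι) (f : ι → A) (t : L ⊗[ℂ] A) :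
    mulA L (∑ i ∈ s, f i) t = ∑ i ∈ s, mulA L (f i) t := by
  classical
  induction s using Finset.induction_on with
  | empty =>
    have := mulA_smul (L := L) 0 (0 : A) t
    simpa using this
  | insert i s hi ih => rw [Finset.sum_insert hi, Finset.sum_insert hi, mulA_add, ih]

theorem mulA_mul (a b : A) (t : L ⊗[ℂ] A) : mulA L (a * b) t = mulA L a (mulA L b t) := by
  induction t with
  | zero => simp
  | add t t' h h' => simp only [map_add, h, h']
  | tmul x c => simp only [mulA_tmul, mul_assoc]

@[simp] theorem mulA_one (t : L ⊗[ℂ] A) : mulA L 1 t = t := by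
  induction t with
  | zero => simp
  | add t t' h h' => simp only [map_add, h, h']
  | tmul x c => simp

variable [LieSuperalgebra L]

theorem mulA_br (a b : A) (s t : L ⊗[ℂ] A) :
    br (mulA L a s) (mulA L b t) = mulA L (a * b) (br s t) := by
  induction s with
  | zero => simp
  | add s s' h h' => simp only [map_add, LinearMap.add_apply, h, h']
  | tmul x c =>
    induction t with
    | zero => simp
    | add t t' h h' => simp only [map_add, h, h']
    | tmul y d => simp only [mulA_tmul, mapSuper_br_tmul]; congr 1; ring

theorem mulA_mem_homog (a : A) {i : ZMod 2} {t : L ⊗[ℂ] A} (ht : t ∈ homog (L ⊗[ℂ] A) i) :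
    mulA L a t ∈ homog (L ⊗[ℂ] A) i := by
  induction ht using Submodule.span_induction with
  | mem t h =>
    obtain ⟨x, hx, b, rfl⟩ := h
    exact Submodule.subset_span ⟨x, hx, a * b, rfl⟩
  | zero => simp
  | add t t' _ _ h h' => rw [map_add]; exact add_mem h h'
  | smul c t _ h => rw [map_smul]; exact Submodule.smul_mem _ _ h

theorem tmul_mem_homog {i : ZMod 2} {x : L} (hx : x ∈ homog L i) (a : A) :
    x ⊗ₜ[ℂ] a ∈ homog (L ⊗[ℂ] A) i := Submodule.subset_span ⟨x, hx, a, rfl⟩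

variable (A) in
/-- The weight decomposition of `L ⊗ A` induced by that of `L`. -/
def Triangular.tensor (T : Triangular L) : Triangular (L ⊗[ℂ] A) where
  H := T.H ⊗ₜ 1
  R k i := Submodule.span ℂ {t | ∃ x ∈ T.R k i, ∃ a : A, t = x ⊗ₜ[ℂ] a}
  H_even := tmul_mem_homog T.H_even 1
  le_homog k i := Submodule.span_mono fun t ⟨x, hx, a, h⟩ => ⟨x, T.le_homog k i hx, a, h⟩
  br_H := by
    intro k i t ht
    induction ht using Submodule.span_induction with
    | mem t h =>
      obtain ⟨x, hx, a, rfl⟩ := h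
      rw [mapSuper_br_tmul, T.br_H hx, one_mul, TensorProduct.smul_tmul']
    | zero => simp
    | add t t' _ _ h h' => rw [map_add, h, h', smul_add]
    | smul c t _ h => rw [map_smul, h, smul_comm]
  br_mem := by
    intro k l i j s t hs ht
    induction hs using Submodule.span_induction with
    | mem s h =>
      obtain ⟨x, hx, a, rfl⟩ := h
      induction ht using Submodule.span_induction with
      | mem t h =>
        obtain ⟨y, hy, b, rfl⟩ := h
        exact Submodule.subset_span ⟨br x y, T.br_mem hx hy, a * b, rfl⟩
      | zero => simp
      | add t t' _ _ h h' => rw [map_add]; exact add_mem h h'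
      | smul c t _ h => rw [map_smul]; exact Submodule.smul_mem _ _ h
    | zero => simp
    | add t t' _ _ h h' => rw [map_add, LinearMap.add_apply]; exact add_mem h h'
    | smul c t _ h => rw [map_smul, LinearMap.smul_apply]; exact Submodule.smul_mem _ _ h
  iSup_eq_top := by
    rw [eq_top_iff]
    rintro t -
    induction t with
    | zero => exact zero_mem _
    | add t t' h h' => exact add_mem h h'
    | tmul x a =>
      induction x using T.induction with
      | h0 => simp
      | hadd x y hx hy => rw [TensorProduct.add_tmul]; exact add_mem hx hy
      | h k i x hx =>
        exact Submodule.mem_iSup_of_mem k (Submodule.mem_iSup_of_mem i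
          (Submodule.subset_span ⟨x, hx, a, rfl⟩))
  zero_one := by
    rw [Submodule.span_eq_bot]
    rintro t ⟨x, hx, a, rfl⟩
    rw [T.zero_one, Submodule.mem_bot] at hx
    rw [hx, TensorProduct.zero_tmul]
  zero_comm := by
    intro s t hs ht
    induction hs using Submodule.span_induction with
    | mem s h =>
      obtain ⟨x, hx, a, rfl⟩ := h
      induction ht using Submodule.span_induction with
      | mem t h =>
        obtain ⟨y, hy, b, rfl⟩ := h
        rw [mapSuper_br_tmul, T.zero_comm hx hy, TensorProduct.zero_tmul]
      | zero => simp
      | add t t' _ _ h h' => rw [map_add, h, h', add_zero]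
      | smul c t _ h => rw [map_smul, h, smul_zero]
    | zero => simp
    | add t t' _ _ h h' => rw [map_add, LinearMap.add_apply, h, h', add_zero]
    | smul c t _ h => rw [map_smul, LinearMap.smul_apply, h, smul_zero]

theorem Triangular.tmul_mem_tensor (T : Triangular L) {k : ℤ} {i : ZMod 2} {x : L}
    (hx : x ∈ T.R k i) (a : A) : x ⊗ₜ[ℂ] a ∈ (T.tensor A).R k i :=
  Submodule.subset_span ⟨x, hx, a, rfl⟩

/-- The zero weight space is spanned by brackets of even root vectors of opposite weights. -/
def Triangular.HasCoroots (T : Triangular L) : Prop :=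
  T.R 0 0 ≤ Submodule.span ℂ {z | ∃ k : ℤ, 0 < k ∧ ∃ e ∈ T.R k 0, ∃ f ∈ T.R (-k) 0, z = br e f}

/-- The largest ideal `J` of `A` such that `L ⊗ J` acts by zero. -/
def annIdeal (V : SuperModule (L ⊗[ℂ] A)) : Ideal A where
  carrier := {a | ∀ (x : L) (b : A), V.act (x ⊗ₜ[ℂ] (a * b)) = 0}
  zero_mem' := fun x b => by simp
  add_mem' := fun {a a'} ha ha' x b => by
    rw [add_mul, TensorProduct.tmul_add, map_add, ha, ha', add_zero]
  smul_mem' := fun c a ha x b => by rw [smul_eq_mul, mul_comm c, mul_assoc]; exact ha x _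

theorem act_tmul_of_mem_annIdeal {V : SuperModule (L ⊗[ℂ] A)} {a : A} (h : a ∈ annIdeal V) (x : L) :
    V.act (x ⊗ₜ[ℂ] a) = 0 := by simpa using h x 1

/-! ### The annihilator of a finite-dimensional irreducible module is radical -/

section Radical

variable {T : Triangular L} {V : SuperModule (L ⊗[ℂ] A)}
  [FiniteDimensional ℂ V.carrier] {c : ℂ} {v : V.carrier}

/-- On a highest weight vector, `[e, f] ⊗ b` acts by zero if `b ^ 2` annihilates the module. -/
theorem coroot_act_eq_zero (hv : (T.tensor A).IsHighest V c v) {b : A}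
    (hb : b * b ∈ annIdeal V) {k : ℤ} (hk : 0 < k) {e f : L} (he : e ∈ T.R k 0)
    (hf : f ∈ T.R (-k) 0) : V.act (br e f ⊗ₜ[ℂ] b) v = 0 := by
  have hx : br e f ∈ T.R 0 0 := by simpa using T.br_mem he hf
  obtain ⟨r, hr⟩ := hv.cartan _ (T.tmul_mem_tensor hx b)
  set E := V.act (e ⊗ₜ[ℂ] (1 : A))
  set F := V.act (f ⊗ₜ[ℂ] b)
  set X := V.act (br e f ⊗ₜ[ℂ] b)
  have hEF : ∀ u, E (F u) = F (E u) + X u := fun u => by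
    have h := V.act_br (tmul_mem_homog (T.le_homog _ _ he) (1 : A))
      (tmul_mem_homog (T.le_homog _ _ hf) b) u
    rw [mapSuper_br_tmul, one_mul, ksign_zero_left, one_smul] at h
    exact (add_eq_of_eq_sub' h).symm
  -- `[X, F]` comes from `[[e, f], f] ⊗ b²`, which acts by zero. Hence `X` is the same scalar `r` on
  -- every `F ^ m v`, and `E` maps `F ^ (m + 1) v` to `(m + 1) r F ^ m v`, without the quadratic
  -- correction of the `sl₂` formula.
  have hXF : ∀ u, X (F u) = F (X u) := fun u => by
    have h := V.act_br (tmul_mem_homog (T.le_homog _ _ hx) b)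
      (tmul_mem_homog (T.le_homog _ _ hf) b) u
    rw [mapSuper_br_tmul, act_tmul_of_mem_annIdeal hb, ksign_zero_left, one_smul] at h
    exact sub_eq_zero.1 h.symm
  have hXFm : ∀ m : ℕ, X ((F ^ m) v) = r • (F ^ m) v := by
    intro m
    induction m with
    | zero => exact hr
    | succ m ih => rw [pow_succ', Module.End.mul_apply, hXF, ih, map_smul]
  have hE : ∀ m : ℕ, E ((F ^ (m + 1)) v) = ((m + 1 : ℕ) * r) • (F ^ m) v := by
    intro m
    induction m with
    | zero =>
      rw [pow_one, hEF, hv.mem.2 k 0 hk _ (T.tmul_mem_tensor he 1), map_zero, zero_add]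
      simpa using hr
    | succ m ih =>
      rw [pow_succ', Module.End.mul_apply, hEF, ih, hXFm, map_smul, ← Module.End.mul_apply,
        ← pow_succ', ← add_smul]
      congr 1
      push_cast
      ring
  have hFm : ∀ m : ℕ, (F ^ m) v ∈ (T.tensor A).eig V (c + m * (-k : ℤ)) := by
    intro m
    induction m with
    | zero => simpa using hv.mem.1
    | succ m ih =>
      rw [pow_succ', Module.End.mul_apply]
      have := (T.tensor A).act_mem_eig (T.tmul_mem_tensor hf b) ih
      convert this using 2
      push_cast
      ring
  -- The nonzero vectors among the `F ^ m v` have pairwise distinct eigenvalues under `H`. If `r`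
  -- were nonzero, none of them could vanish.
  obtain ⟨m, hm⟩ : ∃ m : ℕ, (F ^ m) v = 0 := by
    by_contra! hne
    have hinj : Function.Injective fun m : ℕ => c + m * ((-k : ℤ) : ℂ) := by
      intro m m' h
      have hk0 : ((-k : ℤ) : ℂ) ≠ 0 := by
        rw [Int.cast_ne_zero]; omega
      exact_mod_cast mul_right_cancel₀ hk0 (add_left_cancel h)
    refine Set.infinite_range_of_injective hinj (((T.tensor A).finite_eig (V := V)).subset ?_)
    rintro _ ⟨m, rfl⟩
    exact (Submodule.ne_bot_iff _).2 ⟨_, hFm m, hne m⟩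
  rw [hr]
  by_contra hne
  have hr0 : r ≠ 0 := fun h => hne (by rw [h, zero_smul])
  have hdown : ∀ m : ℕ, (F ^ m) v ≠ 0 := by
    intro m
    induction m with
    | zero => exact hv.ne_zero
    | succ m ih =>
      intro h
      have h1 := hE m
      rw [h, map_zero] at h1
      rcases smul_eq_zero.1 h1.symm with h2 | h2
      · rcases mul_eq_zero.1 h2 with h3 | h3
        · exact Nat.cast_ne_zero.2 (Nat.succ_ne_zero m) h3
        · exact hr0 h3
      · exact ih h2
  exact hdown m hm

/-- On a highest weight vector `v`, the part of `L ⊗ bA` of positive weight acts by zero, and so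
does the part of weight zero, by the coroot computation applied to the multiples `b * a`. So `(L ⊗
bA) v` lies in lower weights; being graded and Borel stable, it is zero. The vectors killed by `L ⊗
bA` form a graded submodule, which contains `v` and hence is everything. -/
theorem mem_annIdeal_of_mul_self (hT : T.HasCoroots) (hV : V.IsIrreducible) {b : A}
    (hb : b * b ∈ annIdeal V) : b ∈ annIdeal V := by
  obtain ⟨c, v, hv⟩ := (T.tensor A).exists_isHighest hV.1
  have hcartan : ∀ x ∈ T.R 0 0, ∀ a : A, V.act (x ⊗ₜ[ℂ] (b * a)) v = 0 := by
    intro x hx a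
    have hx' := hT hx
    have hba : (b * a) * (b * a) ∈ annIdeal V := by
      have : (b * a) * (b * a) = (a * a) * (b * b) := by ring
      rw [this]
      exact Ideal.mul_mem_left _ _ hb
    clear hx
    induction hx' using Submodule.span_induction with
    | mem z h =>
      obtain ⟨k, hk, e, he, f, hf, rfl⟩ := h
      exact coroot_act_eq_zero hv hba hk he hf
    | zero => simp
    | add x y _ _ hx hy => rw [TensorProduct.add_tmul, map_add, LinearMap.add_apply, hx, hy, add_zero]
    | smul r x _ hx =>
      rw [← TensorProduct.smul_tmul', map_smul, LinearMap.smul_apply, hx, smul_zero]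
  let ev : L ⊗[ℂ] A →ₗ[ℂ] V.carrier := LinearMap.applyₗ v ∘ₗ V.act ∘ₗ mulA L b
  have hev : ∀ t, ev t = V.act (mulA L b t) v := fun t => rfl
  have hW : LinearMap.range ev = ⊥ := by
    refine hv.eq_bot_of_le_low hV ?_ ?_ ?_
    · refine fun i => V.grading.proj_mem_of_parity_mem ?_ i
      rintro _ ⟨t, rfl⟩
      induction t using homog_induction with
      | hadd s t hs ht => rw [map_add, map_add]; exact add_mem hs ht
      | h j t ht =>
        obtain ⟨l, hl⟩ := hv.homog
        rw [hev, V.grading.parity_of_mem (V.act_mem (mulA_mem_homog b ht) hl)]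
        exact Submodule.smul_mem _ _ ⟨t, rfl⟩
    · rintro k i hk y hy _ ⟨t, rfl⟩
      induction t using homog_induction with
      | hadd s t hs ht => rw [map_add, map_add]; exact add_mem hs ht
      | h j t ht =>
        have h := V.act_br ((T.tensor A).le_homog _ _ hy) (mulA_mem_homog b ht) v
        rw [eq_sub_iff_add_eq] at h
        rw [hev, ← h]
        obtain ⟨r, hr⟩ := hv.borel hk hy
        refine add_mem ⟨br y t, ?_⟩ (Submodule.smul_mem _ _ ?_)
        · have := mulA_br (L := L) 1 b y t
          rw [mulA_one, one_mul] at this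
          rw [hev, ← this]
        · rw [hr, map_smul]
          exact Submodule.smul_mem _ _ ⟨t, rfl⟩
    · rintro _ ⟨t, rfl⟩
      induction t with
      | zero => simp
      | add s t hs ht => rw [map_add]; exact add_mem hs ht
      | tmul x a =>
        rw [hev, mulA_tmul]
        induction x using T.induction with
        | h0 => simp
        | hadd x y hx hy =>
          rw [TensorProduct.add_tmul, map_add, LinearMap.add_apply]; exact add_mem hx hy
        | h k i x hx =>
          have hxa := T.tmul_mem_tensor hx (b * a)
          rcases lt_trichotomy k 0 with hk | rfl | hk
          · exact (T.tensor A).eig_le_low c hk ((T.tensor A).act_mem_eig hxa hv.mem.1)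
          · rcases zmod2_cases i with rfl | rfl
            · rw [hcartan x hx a]; exact zero_mem _
            · rw [T.zero_one, Submodule.mem_bot] at hx
              simp [hx]
          · rw [hv.mem.2 k i hk _ hxa]; exact zero_mem _
  have hker : ∀ t, V.act (mulA L b t) v = 0 := fun t => by
    have : ev t ∈ LinearMap.range ev := ⟨t, rfl⟩
    rwa [hW, Submodule.mem_bot] at this
  let N : Submodule ℂ V.carrier :=
    { carrier := {u | ∀ t, V.act (mulA L b t) u = 0}
      zero_mem' := fun t => map_zero _
      add_mem' := fun h h' t => by rw [map_add, h, h', add_zero]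
      smul_mem' := fun r u h t => by rw [map_smul, h, smul_zero] }
  have hN : N = ⊤ := by
    refine (hV.2 N (fun i => V.grading.proj_mem_of_parity_mem ?_ i) ?_).resolve_left ?_
    · intro u hu t
      induction t using homog_induction with
      | hadd s t hs ht => rw [map_add, map_add, LinearMap.add_apply, hs, ht, add_zero]
      | h j t ht =>
        rw [V.parity_act_parity (mulA_mem_homog b ht), hu, map_zero, smul_zero]
    · intro y u hu t
      induction t using homog_induction with
      | hadd s t hs ht => rw [map_add, map_add, LinearMap.add_apply, hs, ht, add_zero]
      | h j t ht =>
        induction y using homog_induction with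
        | hadd y y' hy hy' => rw [map_add, LinearMap.add_apply, map_add, hy, hy', add_zero]
        | h i y hy =>
          have h := V.act_br (mulA_mem_homog b ht) hy u
          have hbr := mulA_br (L := L) b 1 t y
          rw [mulA_one, mul_one] at hbr
          rw [hbr, hu, hu, map_zero, smul_zero, sub_zero] at h
          exact h.symm
    · intro h
      have hvN : v ∈ N := hker
      rw [h] at hvN
      exact hv.ne_zero hvN
  intro x a
  refine LinearMap.ext fun u => ?_
  have hu : u ∈ N := hN ▸ Submodule.mem_top
  exact hu (x ⊗ₜ a)

/-- The annihilator ideal of a finite-dimensional irreducible module is radical. -/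
theorem annIdeal_isRadical (hT : T.HasCoroots) (hV : V.IsIrreducible) : (annIdeal V).IsRadical := by
  -- Square roots can be extracted repeatedly; since `n < 2 ^ n`, a power `a ^ n` in the ideal
  -- yields `a ^ 2 ^ n` in it.
  have key : ∀ (k : ℕ) (a : A), a ^ 2 ^ k ∈ annIdeal V → a ∈ annIdeal V := by
    intro k
    induction k with
    | zero => intro a h; simpa using h
    | succ k ih =>
      intro a h
      refine ih a (mem_annIdeal_of_mul_self hT hV ?_)
      rwa [← pow_add, ← two_mul, ← pow_succ']
  rintro a ⟨n, hn⟩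
  exact key n a (Ideal.pow_mem_of_pow_mem _ hn Nat.lt_two_pow_self.le)

end Radical

end MapModules

end EquivMap
end

noncomputable section

namespace EquivMap

open LieSuperalgebra

/-! ### Contractions of tensor products -/

section Contraction

variable {V W : Type*} [AddCommGroup V] [Module ℂ V] [AddCommGroup W] [Module ℂ W]

/-- The contraction `V ⊗ W → W` with a linear functional on `V`. -/
def contract (W : Type*) [AddCommGroup W] [Module ℂ W] (φ : V →ₗ[ℂ] ℂ) : V ⊗[ℂ] W →ₗ[ℂ] W :=
  (TensorProduct.lid ℂ W).toLinearMap ∘ₗ φ.rTensor W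

@[simp] theorem contract_tmul (φ : V →ₗ[ℂ] ℂ) (v : V) (w : W) :
    contract W φ (v ⊗ₜ[ℂ] w) = φ v • w := by simp [contract]

/-- Rank one operators convert stability under `End V ⊗ 1` into statements about contractions. -/
theorem rTensor_smulRight (φ : V →ₗ[ℂ] ℂ) (v : V) (z : V ⊗[ℂ] W) :
    (φ.smulRight v).rTensor W z = v ⊗ₜ[ℂ] contract W φ z := by
  induction z with
  | zero => simp
  | add y z hy hz => simp only [map_add, hy, hz, TensorProduct.tmul_add]
  | tmul u w => simp [TensorProduct.smul_tmul]

/-- The identity of `V` is a sum of rank one operators, one for each vector of a basis. -/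
theorem eq_zero_of_forall_contract [FiniteDimensional ℂ V] {z : V ⊗[ℂ] W}
    (h : ∀ φ : V →ₗ[ℂ] ℂ, contract W φ z = 0) : z = 0 := by
  let b := Module.finBasis ℂ V
  have hid : (LinearMap.id : V →ₗ[ℂ] V) = ∑ i, (b.coord i).smulRight (b i) := by
    refine LinearMap.ext fun v => ?_
    simp only [LinearMap.id_apply, LinearMap.sum_apply, LinearMap.smulRight_apply,
      Module.Basis.coord_apply]
    exact (b.sum_repr v).symm
  have hz : (LinearMap.id : V →ₗ[ℂ] V).rTensor W z = z := by simp
  rw [← hz, hid, ← LinearMap.coe_rTensorHom, map_sum, LinearMap.sum_apply]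
  refine Finset.sum_eq_zero fun i _ => ?_
  rw [LinearMap.coe_rTensorHom, rTensor_smulRight, h, TensorProduct.tmul_zero]

end Contraction

/-! ### Submodules and spaces of intertwiners -/

/-- The grading by the eigenspaces of an involution. -/
def SuperGrading.ofInvolution {V : Type*} [AddCommGroup V] [Module ℂ V] (s : V →ₗ[ℂ] V)
    (hs : ∀ v, s (s v) = v) : SuperGrading V where
  gr i := LinearMap.eqLocus s (ksign 1 i • LinearMap.id)
  isCompl := by
    refine isCompl_of_parity _ _ s (fun v hv => ?_) (fun v hv => ?_) fun v _ => ?_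
    · simpa [LinearMap.mem_eqLocus, ksign_zero_right] using hv
    · simpa [LinearMap.mem_eqLocus, ksign_one_one] using hv
    · have h : v = (2⁻¹ : ℂ) • (v + s v) + (2⁻¹ : ℂ) • (v - s v) := by
        rw [← smul_add, add_add_sub_cancel, ← two_smul ℂ v, smul_smul]; simp
      rw [h]
      refine Submodule.add_mem_sup ?_ ?_
      · simp [LinearMap.mem_eqLocus, ksign_zero_right, hs, add_comm]
      · simp [LinearMap.mem_eqLocus, ksign_one_one, hs]

theorem SuperGrading.parity_ofInvolution {V : Type*} [AddCommGroup V] [Module ℂ V] {s : V →ₗ[ℂ] V}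
    {hs : ∀ v, s (s v) = v} (v : V) : (SuperGrading.ofInvolution s hs).parity v = s v := by
  set G := SuperGrading.ofInvolution s hs
  have h : ∀ i, s (G.proj i v) = ksign 1 i • G.proj i v := fun i => G.proj_mem i v
  conv_rhs => rw [← G.proj_add v, map_add, h, h, ksign_zero_right, ksign_one_one]
  simp [SuperGrading.parity, sub_eq_add_neg]

namespace SuperModule

variable {L L' : Type*} [AddCommGroup L'] [Module ℂ L'] [LieSuperalgebra L'] [AddCommGroup L]
  [Module ℂ L] [LieSuperalgebra L]

/-- A graded submodule as a module. -/
def sub (V : SuperModule L) (N : Submodule ℂ V.carrier) (hp : ∀ v ∈ N, V.grading.parity v ∈ N)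
    (hx : ∀ x, ∀ v ∈ N, V.act x v ∈ N) : SuperModule L where
  carrier := N
  grading := SuperGrading.ofInvolution (V.grading.parity.restrict hp)
    fun v => Subtype.ext (V.grading.parity_parity v.1)
  act :=
    { toFun := fun x => (V.act x).restrict (hx x)
      map_add' := fun x y => LinearMap.ext fun v => Subtype.ext (by simp)
      map_smul' := fun c x => LinearMap.ext fun v => Subtype.ext (by simp) }
  act_mem := by
    intro i j x v hx hv
    have hv' : v.1 ∈ V.grading.gr j := (V.grading.mem_gr_iff _ _).2 (congrArg Subtype.val hv)
    exact Subtype.ext ((V.grading.mem_gr_iff _ _).1 (V.act_mem hx hv'))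
  act_br := fun hx hy v => Subtype.ext (V.act_br hx hy v.1)

theorem isIrreducible_sub {V : SuperModule L} {N : Submodule ℂ V.carrier}
    (hp : ∀ v ∈ N, V.grading.parity v ∈ N) (hx : ∀ x, ∀ v ∈ N, V.act x v ∈ N) (hN : N ≠ ⊥)
    (hmin : ∀ M ≤ N, ((∀ v ∈ M, V.grading.parity v ∈ M) ∧ ∀ x, ∀ v ∈ M, V.act x v ∈ M) →
      M = ⊥ ∨ M = N) : (V.sub N hp hx).IsIrreducible := by
  refine ⟨(Submodule.nontrivial_iff_ne_bot).2 hN, fun M h1 h2 => ?_⟩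
  have h1' := SuperGrading.parity_mem _ h1
  let M' : Submodule ℂ N := M
  have hM' : M'.map N.subtype ≤ N := Submodule.map_subtype_le _ _
  have hst : (∀ v ∈ M'.map N.subtype, V.grading.parity v ∈ M'.map N.subtype) ∧
      ∀ x, ∀ v ∈ M'.map N.subtype, V.act x v ∈ M'.map N.subtype := by
    constructor
    · rintro _ ⟨v, hv, rfl⟩
      exact ⟨_, h1' v hv, congrArg Subtype.val (SuperGrading.parity_ofInvolution (V := N)
        (hs := fun v => Subtype.ext (V.grading.parity_parity v.1)) v)⟩
    · rintro x _ ⟨v, hv, rfl⟩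
      exact ⟨_, h2 x v hv, rfl⟩
  have hinj := Submodule.map_injective_of_injective N.injective_subtype
  rcases hmin (M'.map N.subtype) hM' hst with h | h
  · exact Or.inl (hinj (a₂ := (⊥ : Submodule ℂ N)) (h.trans (Submodule.map_bot _).symm))
  · exact Or.inr (hinj (a₂ := (⊤ : Submodule ℂ N)) (h.trans (Submodule.map_subtype_top N).symm))

/-- Every nonzero finite-dimensional module has an irreducible graded submodule. -/
theorem exists_irreducible_sub (V : SuperModule L) [FiniteDimensional ℂ V.carrier]
    (hV : Nontrivial V.carrier) : ∃ (N : Submodule ℂ V.carrier)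
      (hp : ∀ v ∈ N, V.grading.parity v ∈ N) (hx : ∀ x, ∀ v ∈ N, V.act x v ∈ N),
      (V.sub N hp hx).IsIrreducible := by
  obtain ⟨N, ⟨hp, hx⟩, h0, hmin⟩ := exists_minimal_submodule
    (fun M : Submodule ℂ V.carrier =>
      (∀ v ∈ M, V.grading.parity v ∈ M) ∧ ∀ x, ∀ v ∈ M, V.act x v ∈ M)
    (N := ⊤) ⟨fun _ _ => Submodule.mem_top, fun _ _ _ => Submodule.mem_top⟩ top_ne_bot
  exact ⟨N, hp, hx, isIrreducible_sub hp hx h0 hmin⟩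

section Intertwiners

variable (S : SuperModule L) (V : SuperModule L') (φ : L →ₗ[ℂ] Module.End ℂ V.carrier)

/-- The linear maps from an `L`-module that intertwine the action with `φ`. -/
def intertwiners : Submodule ℂ (S.carrier →ₗ[ℂ] V.carrier) where
  carrier := {f | ∀ x s, f (S.act x s) = φ x (f s)}
  zero_mem' := fun x s => by simp
  add_mem' := fun hf hg x s => by simp [hf x s, hg x s]
  smul_mem' := fun c f hf x s => by simp [hf x s]

variable {S V φ}

theorem mem_intertwiners_of_homog {f : S.carrier →ₗ[ℂ] V.carrier}
    (h : ∀ i, ∀ x ∈ homog L i, ∀ s, f (S.act x s) = φ x (f s)) : f ∈ intertwiners S V φ := by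
  intro x
  induction x using homog_induction with
  | hadd x y hx hy => intro s; simp [hx, hy]
  | h i x hx => exact h i x hx

variable (S V φ) in
/-- The operators `φ x` are homogeneous of the degree of `x` and supercommute with the action on
`V`. -/
structure SuperCommute : Prop where
  parity : ∀ {i : ZMod 2} {x : L}, x ∈ homog L i → ∀ v,
    V.grading.parity (φ x v) = ksign 1 i • φ x (V.grading.parity v)
  comm : ∀ {i j : ZMod 2} {x : L} {t : L'}, x ∈ homog L i → t ∈ homog L' j → ∀ v,
    φ x (V.act t v) = ksign i j • V.act t (φ x v)

/-- Conjugation of linear maps by the parity operators. -/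
def conjParity (S : SuperModule L) (V : SuperModule L') :
    (S.carrier →ₗ[ℂ] V.carrier) →ₗ[ℂ] (S.carrier →ₗ[ℂ] V.carrier) where
  toFun f := V.grading.parity ∘ₗ f ∘ₗ S.grading.parity
  map_add' f g := by ext; simp
  map_smul' c f := by ext; simp

@[simp] theorem conjParity_apply (f : S.carrier →ₗ[ℂ] V.carrier) (s : S.carrier) :
    conjParity S V f s = V.grading.parity (f (S.grading.parity s)) := rfl

theorem conjParity_conjParity (f : S.carrier →ₗ[ℂ] V.carrier) :
    conjParity S V (conjParity S V f) = f := by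
  ext s
  simp [SuperGrading.parity_parity]

theorem conjParity_parity (f : S.carrier →ₗ[ℂ] V.carrier) (s : S.carrier) :
    conjParity S V f (S.grading.parity s) = V.grading.parity (f s) := by
  rw [conjParity_apply, SuperGrading.parity_parity]

theorem conjParity_mem (h : SuperCommute V φ) {f : S.carrier →ₗ[ℂ] V.carrier}
    (hf : f ∈ intertwiners S V φ) : conjParity S V f ∈ intertwiners S V φ := by
  refine mem_intertwiners_of_homog fun i x hx s => ?_
  simp only [conjParity_apply]
  rw [S.parity_act hx, map_smul, hf, map_smul, h.parity hx, smul_smul, ksign_mul_self, one_smul]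

/-- The power of the parity operator with exponent in `ℤ/2`. -/
def parityPow (S : SuperModule L) (i : ZMod 2) : S.carrier →ₗ[ℂ] S.carrier :=
  if i = 0 then LinearMap.id else S.grading.parity

@[simp] theorem parityPow_zero (s : S.carrier) : S.parityPow 0 s = s := rfl

@[simp] theorem parityPow_one (s : S.carrier) : S.parityPow 1 s = S.grading.parity s := rfl

theorem parityPow_parityPow (i j : ZMod 2) (s : S.carrier) :
    S.parityPow i (S.parityPow j s) = S.parityPow (i + j) s := by
  rcases zmod2_cases i with rfl | rfl <;> rcases zmod2_cases j with rfl | rfl <;>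
    simp [zmod2_one_add_one, SuperGrading.parity_parity]

theorem parityPow_act (j : ZMod 2) {i : ZMod 2} {x : L} (hx : x ∈ homog L i) (s : S.carrier) :
    S.parityPow j (S.act x s) = ksign i j • S.act x (S.parityPow j s) := by
  rcases zmod2_cases j with rfl | rfl
  · simp [ksign_zero_right]
  · rw [parityPow_one, S.parity_act hx]
    congr 1
    rcases zmod2_cases i with rfl | rfl <;> simp [ksign_zero_left, ksign_zero_right]

/-- The action of `L'` on linear maps: `t` of degree `j` acts by `f ↦ t ∘ f ∘ p ^ j`. -/
def homAct (S : SuperModule L) (V : SuperModule L') (t : L') :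
    (S.carrier →ₗ[ℂ] V.carrier) →ₗ[ℂ] (S.carrier →ₗ[ℂ] V.carrier) where
  toFun f := V.act ((LieSuperalgebra.grading (L := L')).proj 0 t) ∘ₗ f +
    V.act ((LieSuperalgebra.grading (L := L')).proj 1 t) ∘ₗ f ∘ₗ S.grading.parity
  map_add' f g := by ext; simp; abel
  map_smul' c f := by ext; simp

theorem homAct_apply (t : L') (f : S.carrier →ₗ[ℂ] V.carrier) (s : S.carrier) :
    homAct S V t f s = V.act ((LieSuperalgebra.grading (L := L')).proj 0 t) (f s) +
      V.act ((LieSuperalgebra.grading (L := L')).proj 1 t) (f (S.grading.parity s)) := rfl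

theorem homAct_of_mem {j : ZMod 2} {t : L'} (ht : t ∈ homog L' j)
    (f : S.carrier →ₗ[ℂ] V.carrier) (s : S.carrier) :
    homAct S V t f s = V.act t (f (S.parityPow j s)) := by
  rw [homAct_apply, SuperGrading.proj_of_mem _ 0 ht, SuperGrading.proj_of_mem _ 1 ht]
  rcases zmod2_cases j with rfl | rfl <;> simp

/-- This makes evaluation `s ⊗ f ↦ f s` compatible with the tensor product action: the parity that
the latter puts on `s` cancels the one built into `homAct`. -/
theorem homAct_proj_add (t : L') (f : S.carrier →ₗ[ℂ] V.carrier) (s : S.carrier) :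
    homAct S V ((LieSuperalgebra.grading (L := L')).proj 0 t) f s +
      homAct S V ((LieSuperalgebra.grading (L := L')).proj 1 t) f (S.grading.parity s) =
        V.act t (f s) := by
  rw [homAct_of_mem (SuperGrading.proj_mem _ 0 t), homAct_of_mem (SuperGrading.proj_mem _ 1 t),
    parityPow_zero, parityPow_one, SuperGrading.parity_parity, ← LinearMap.add_apply, ← map_add,
    SuperGrading.proj_add]

/-- The sign from moving `φ x` past `t` cancels against the sign from moving `x` past the power of
parity on `S`; the parity in `homAct` is there for this reason. -/
theorem homAct_mem (h : SuperCommute V φ) {f : S.carrier →ₗ[ℂ] V.carrier}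
    (hf : f ∈ intertwiners S V φ) (t : L') : homAct S V t f ∈ intertwiners S V φ := by
  have hadd : ∀ t t', homAct S V (t + t') f = homAct S V t f + homAct S V t' f := fun t t' => by
    ext s
    simp only [homAct_apply, map_add, LinearMap.add_apply]
    abel
  induction t using homog_induction with
  | hadd t t' ht ht' => rw [hadd]; exact add_mem ht ht'
  | h j t ht =>
    refine mem_intertwiners_of_homog fun i x hx s => ?_
    rw [homAct_of_mem ht, homAct_of_mem ht, parityPow_act j hx, map_smul, hf, map_smul,
      h.comm hx ht]

/-- The space of intertwiners as a module over the second superalgebra. -/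
def homModule (S : SuperModule L) (V : SuperModule L') {φ : L →ₗ[ℂ] Module.End ℂ V.carrier}
    (h : SuperCommute V φ) : SuperModule L' where
  carrier := intertwiners S V φ
  grading := SuperGrading.ofInvolution
    ((conjParity S V).restrict fun _ hf => conjParity_mem h hf)
    fun f => Subtype.ext (conjParity_conjParity f.1)
  act :=
    { toFun := fun t => (homAct S V t).restrict fun _ hf => homAct_mem h hf t
      map_add' := fun t t' => by
        ext f s
        simp only [LinearMap.coe_restrict_apply, LinearMap.add_apply, Submodule.coe_add,
          homAct_apply, map_add]
        abel
      map_smul' := fun c t => by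
        ext f s
        simp [homAct_apply] }
  act_mem := by
    intro i j t f ht hf
    refine Subtype.ext (LinearMap.ext fun s => ?_)
    have hf' : ∀ s, V.grading.parity (f.1 (S.grading.parity s)) = ksign 1 j • f.1 s := fun s =>
      LinearMap.congr_fun (congrArg Subtype.val hf) s
    change conjParity S V (homAct S V t f.1) s = ksign 1 (i + j) • homAct S V t f.1 s
    rw [conjParity_apply, homAct_of_mem ht, homAct_of_mem ht, V.parity_act ht]
    have hp : S.parityPow i (S.grading.parity s) = S.grading.parity (S.parityPow i s) := by
      rw [← parityPow_one, ← parityPow_one, parityPow_parityPow, parityPow_parityPow, add_comm]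
    rw [hp, hf', map_smul, smul_smul]
    congr 1
    rcases zmod2_cases i with rfl | rfl <;> rcases zmod2_cases j with rfl | rfl <;>
      simp [zmod2_one_add_one, ksign_zero_right, ksign_one_one]
  act_br := by
    intro i j x y hx hy f
    refine Subtype.ext (LinearMap.ext fun s => ?_)
    change homAct S V (br x y) f.1 s = homAct S V x (homAct S V y f.1) s -
      ksign i j • homAct S V y (homAct S V x f.1) s
    rw [homAct_of_mem (br_mem hx hy), homAct_of_mem hx, homAct_of_mem hy, homAct_of_mem hy,
      homAct_of_mem hx, V.act_br hx hy, parityPow_parityPow, parityPow_parityPow, add_comm j i]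

end Intertwiners

/-- An irreducible module `U` with a space `W` of linear maps `S → U` that intertwine the action on
`S` with a part `φ` of the action on `U` is the tensor product of `S` and `W`. -/
theorem tensor_decomposition {S U W : SuperModule L} [FiniteDimensional ℂ S.carrier]
    (hU : U.IsIrreducible) (hS : S.FullOn Set.univ) [Nontrivial S.carrier] [Nontrivial W.carrier]
    {φ ψ : L →ₗ[ℂ] Module.End ℂ U.carrier} (ι : W.carrier →ₗ[ℂ] S.carrier →ₗ[ℂ] U.carrier)
    (hι : Function.Injective ι) (hact : ∀ t u, U.act t u = φ t u + ψ t u)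
    (hφ : ∀ t f s, ι f (S.act t s) = φ t (ι f s))
    (hψ : ∀ t f s, ι (W.act ((LieSuperalgebra.grading (L := L)).proj 0 t) f) s +
      ι (W.act ((LieSuperalgebra.grading (L := L)).proj 1 t) f) (S.grading.parity s) = ψ t (ι f s))
    (hpar : ∀ f s, U.grading.parity (ι f s) = ι (W.grading.parity f) (S.grading.parity s)) :
    W.IsIrreducible ∧ PlainIso U (tensor S W) := by
  let ev : S.carrier ⊗[ℂ] W.carrier →ₗ[ℂ] U.carrier := TensorProduct.lift ι.flip
  have hev : ∀ s f, ev (s ⊗ₜ f) = ι f s := fun s f => TensorProduct.lift.tmul s f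
  have hval : ∀ t f s, U.act t (ι f s) = ι f (S.act t s) +
      (ι (W.act ((LieSuperalgebra.grading (L := L)).proj 0 t) f) s +
        ι (W.act ((LieSuperalgebra.grading (L := L)).proj 1 t) f) (S.grading.parity s)) :=
    fun t f s => by rw [hact, hφ, hψ]
  -- The image of `S ⊗ N` is a nonzero graded submodule of the irreducible `U`. The case `N = ⊤`
  -- gives surjectivity of `ev`, the general case the irreducibility of `W`.
  have himage : ∀ N : Submodule ℂ W.carrier, N ≠ ⊥ →
      (∀ f ∈ N, W.grading.parity f ∈ N) → (∀ t, ∀ f ∈ N, W.act t f ∈ N) →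
      Submodule.map ev (Submodule.span ℂ {z | ∃ s, ∃ f ∈ N, z = s ⊗ₜ f}) = ⊤ := by
    intro N hN0 hNp hNt
    set K := Submodule.span ℂ {z : S.carrier ⊗[ℂ] W.carrier | ∃ s, ∃ f ∈ N, z = s ⊗ₜ f}
    have hK : ∀ s, ∀ f ∈ N, ι f s ∈ Submodule.map ev K := fun s f hf =>
      ⟨s ⊗ₜ f, Submodule.subset_span ⟨s, f, hf, rfl⟩, hev s f⟩
    have hind : ∀ M : Module.End ℂ U.carrier, (∀ s, ∀ f ∈ N, M (ι f s) ∈ Submodule.map ev K) →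
        ∀ v ∈ Submodule.map ev K, M v ∈ Submodule.map ev K := by
      rintro M hq _ ⟨z, hz, rfl⟩
      induction hz using Submodule.span_induction with
      | mem z hz =>
        obtain ⟨s, f, hf, rfl⟩ := hz
        rw [hev]
        exact hq s f hf
      | zero => simp
      | add x y _ _ hx hy => rw [map_add, map_add]; exact add_mem hx hy
      | smul c x _ hx => rw [map_smul, map_smul]; exact Submodule.smul_mem _ _ hx
    refine (hU.2 _ (fun i => U.grading.proj_mem_of_parity_mem (hind _ fun s f hf => ?_) i)
      (fun t => hind _ fun s f hf => ?_)).resolve_left ?_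
    · rw [hpar]
      exact hK _ _ (hNp f hf)
    · rw [hval]
      exact add_mem (hK _ _ hf) (add_mem (hK _ _ (hNt _ f hf)) (hK _ _ (hNt _ f hf)))
    · intro hbot
      obtain ⟨f, hf, hf0⟩ := (Submodule.ne_bot_iff _).1 hN0
      refine hf0 (hι (LinearMap.ext fun s => ?_))
      have h1 := hK s f hf
      rw [hbot, Submodule.mem_bot] at h1
      simpa using h1
  have hsurj : Function.Surjective ev := by
    rw [← LinearMap.range_eq_top, eq_top_iff, ← himage ⊤ top_ne_bot (fun _ _ => Submodule.mem_top)
      fun _ _ _ => Submodule.mem_top]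
    exact LinearMap.map_le_range
  have hinj : Function.Injective ev := by
    rw [injective_iff_map_eq_zero]
    intro z hz
    -- The kernel of `ev` is stable under the operators of `S`, hence under all operators on `S` by
    -- fullness. A rank one operator turns an element `z` of the kernel into `s ⊗ f` with `f` a
    -- contraction of `z`, and then `ι f s = 0` for every `s`.
    have hstab : ∀ a : Module.End ℂ S.carrier, ∀ z, ev z = 0 → ev (a.rTensor _ z) = 0 := by
      intro a
      have ha : a ∈ Algebra.adjoin ℂ (S.act '' Set.univ) := hS.ge Algebra.mem_top
      induction ha using Algebra.adjoin_induction with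
      | mem a ha =>
        obtain ⟨x, _, rfl⟩ := ha
        have h1 : ev ∘ₗ (S.act x).rTensor _ = φ x ∘ₗ ev := TensorProduct.ext' fun s f => by
          simp only [LinearMap.comp_apply, LinearMap.rTensor_tmul, hev]
          exact hφ x f s
        intro z hz
        have h2 := LinearMap.congr_fun h1 z
        rw [LinearMap.comp_apply, LinearMap.comp_apply, hz, map_zero] at h2
        exact h2
      | algebraMap r =>
        intro z hz
        have h1 : (algebraMap ℂ (Module.End ℂ S.carrier) r).rTensor W.carrier z = r • z := by
          rw [Algebra.algebraMap_eq_smul_one, LinearMap.rTensor_smul, LinearMap.smul_apply,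
            Module.End.one_eq_id, LinearMap.rTensor_id, LinearMap.id_apply]
        rw [h1, map_smul, hz, smul_zero]
      | add a b _ _ ha hb =>
        intro z hz
        rw [LinearMap.rTensor_add, LinearMap.add_apply, map_add, ha z hz, hb z hz, add_zero]
      | mul a b _ _ ha hb =>
        intro z hz
        rw [LinearMap.rTensor_mul, Module.End.mul_apply]
        exact ha _ (hb z hz)
    refine eq_zero_of_forall_contract fun χ => hι (LinearMap.ext fun s => ?_)
    have h1 := hstab (χ.smulRight s) z hz
    rw [rTensor_smulRight, hev] at h1
    simpa using h1
  refine ⟨⟨inferInstance, fun N hNp hNt => ?_⟩, ?_⟩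
  · by_cases hN0 : N = ⊥
    · exact Or.inl hN0
    right
    have h1 := himage N hN0 (W.grading.parity_mem hNp) hNt
    set K := Submodule.span ℂ {z : S.carrier ⊗[ℂ] W.carrier | ∃ s, ∃ f ∈ N, z = s ⊗ₜ f}
    have h2 : K = ⊤ := by
      refine Submodule.map_injective_of_injective hinj ?_
      rw [h1, Submodule.map_top, LinearMap.range_eq_top.2 hsurj]
    -- As `ev` is bijective, `S ⊗ N` is all of `S ⊗ W`; contracting with `χ`, where `χ s = 1`, shows
    -- that every `g` belongs to `N`.
    obtain ⟨s, hs⟩ := exists_ne (0 : S.carrier)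
    obtain ⟨χ, hχ⟩ := exists_dual_eq_one hs
    refine eq_top_iff.2 fun g _ => ?_
    have h4 : ∀ z ∈ K, contract W.carrier χ z ∈ N := by
      intro z hz
      induction hz using Submodule.span_induction with
      | mem z hz =>
        obtain ⟨s, f, hf, rfl⟩ := hz
        rw [contract_tmul]
        exact Submodule.smul_mem _ _ hf
      | zero => rw [map_zero]; exact zero_mem _
      | add x y _ _ hx hy => rw [map_add]; exact add_mem hx hy
      | smul c x _ hx => rw [map_smul]; exact Submodule.smul_mem _ _ hx
    have h5 := h4 (s ⊗ₜ g) (h2 ▸ Submodule.mem_top)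
    rwa [contract_tmul, hχ, one_smul] at h5
  · refine PlainIso.symm ⟨LinearEquiv.ofBijective ev ⟨hinj, hsurj⟩, fun t => LinearMap.congr_fun
      (f := ev ∘ₗ tensorAct S W t) (g := U.act t ∘ₗ ev) (TensorProduct.ext' fun s f => ?_)⟩
    rw [LinearMap.comp_apply, LinearMap.comp_apply, tensorAct_apply_tmul, map_add, map_add]
    simp only [hev, hval]

/-- The tensor decomposition with `W` the space of all intertwiners. -/
theorem tensor_decomposition_homModule {S : SuperModule L} {U V : SuperModule L'}
    [FiniteDimensional ℂ S.carrier] [FiniteDimensional ℂ V.carrier]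
    (hU : U.IsIrreducible) (p : SuperHom L' L) (hp : Function.Surjective p.toFun)
    (hS : S.FullOn Set.univ) [hnt : Nontrivial S.carrier]
    {φ : L →ₗ[ℂ] Module.End ℂ V.carrier} (h : SuperCommute V φ)
    (e : V.carrier ≃ₗ[ℂ] U.carrier)
    (hep : ∀ u, U.grading.parity (e u) = e (V.grading.parity u))
    (he : ∀ t u, U.act t (e u) = e (φ (p.toFun t) u) + e (V.act t u))
    {f₀ : S.carrier →ₗ[ℂ] V.carrier} (hf₀ : f₀ ∈ intertwiners S V φ) (hf₀' : f₀ ≠ 0) :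
    FiniteDimensional ℂ (homModule S V h).carrier ∧ (homModule S V h).IsIrreducible ∧
      PlainIso U (tensor (S.pullback p) (homModule S V h)) := by
  have hW : Nontrivial (homModule S V h).carrier :=
    ⟨⟨⟨f₀, hf₀⟩, 0, fun hh => hf₀' (congrArg Subtype.val hh)⟩⟩
  have hS' : Nontrivial (S.pullback p).carrier := hnt
  have hSf : FiniteDimensional ℂ (S.pullback p).carrier := ‹FiniteDimensional ℂ S.carrier›
  have hfd : FiniteDimensional ℂ (intertwiners S V φ) := inferInstance
  refine ⟨hfd, ?_⟩
  let conj : Module.End ℂ V.carrier →ₗ[ℂ] Module.End ℂ U.carrier := e.conj.toLinearMap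
  have hconj : ∀ a u, conj a (e u) = e (a u) := fun a u => by
    simp [conj, LinearEquiv.conj_apply]
  let ι : intertwiners S V φ →ₗ[ℂ] S.carrier →ₗ[ℂ] U.carrier :=
    (LinearMap.llcomp ℂ S.carrier V.carrier U.carrier e.toLinearMap) ∘ₗ
      (intertwiners S V φ).subtype
  have hι : ∀ f s, ι f s = e (f.1 s) := fun f s => rfl
  refine tensor_decomposition (S := S.pullback p) (W := homModule S V h) hU ?_
    (φ := conj ∘ₗ φ ∘ₗ p.toFun) (ψ := conj ∘ₗ V.act) ι ?_ ?_ ?_ ?_ ?_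
  · refine eq_top_iff.2 (hS.ge.trans (Algebra.adjoin_mono ?_))
    rintro _ ⟨x, _, rfl⟩
    obtain ⟨t, rfl⟩ := hp x
    exact ⟨t, Set.mem_univ t, rfl⟩
  · intro f g hfg
    refine Subtype.ext (LinearMap.ext fun s => e.injective ?_)
    exact LinearMap.congr_fun hfg s
  · intro t u
    obtain ⟨u, rfl⟩ := e.surjective u
    rw [he]
    simp only [LinearMap.comp_apply, hconj]
  · intro t f s
    refine (congrArg e (f.2 (p.toFun t) s)).trans ?_
    exact (hconj _ _).symm
  · intro t f s
    refine (map_add e _ _).symm.trans (Eq.trans ?_ (hconj _ _).symm)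
    exact congrArg e (homAct_proj_add t _ _)
  · intro f s
    have h1 : (homModule S V h).grading.parity f = _ :=
      SuperGrading.parity_ofInvolution (V := intertwiners S V φ)
        (hs := fun f => Subtype.ext (conjParity_conjParity f.1)) f
    refine (hep _).trans (congrArg e ?_)
    rw [h1]
    exact (conjParity_parity _ _).symm

end SuperModule

end EquivMap
end

noncomputable section

namespace EquivMap

open LieSuperalgebra SuperModule

/-! ### Points of the spectrum and values of functions -/

section Residue

variable {A : Type*} [CommRing A]

/-- Finitely many maximal ideals different from `m` are separated from `m`. -/
theorem exists_separating (m : MaximalSpectrum A) (l : List (MaximalSpectrum A)) (hm : m ∉ l) :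
    ∃ a : A, 1 - a ∈ m.asIdeal ∧ ∀ m' ∈ l, a ∈ m'.asIdeal := by
  induction l with
  | nil => exact ⟨1, by simp, by simp⟩
  | cons m' l ih =>
    obtain ⟨a, ha, hal⟩ := ih fun h => hm (List.mem_cons_of_mem _ h)
    have hne : m'.asIdeal ≠ m.asIdeal := fun h =>
      hm (List.mem_cons.2 (Or.inl (MaximalSpectrum.ext h.symm)))
    have htop : m'.asIdeal ⊔ m.asIdeal = ⊤ := m'.isMaximal.coprime_of_ne m.isMaximal hne
    obtain ⟨b, hb, c, hc, hbc⟩ := Submodule.mem_sup.1 (htop ▸ Submodule.mem_top : (1 : A) ∈ _)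
    refine ⟨a * b, ?_, fun m'' hm'' => ?_⟩
    · have : 1 - a * b = (1 - a) * b + c := by linear_combination -hbc
      rw [this]
      exact add_mem (Ideal.mul_mem_right _ _ ha) hc
    · rcases List.mem_cons.1 hm'' with rfl | h
      · exact Ideal.mul_mem_left _ _ hb
      · exact Ideal.mul_mem_right _ _ (hal m'' h)

variable [Algebra ℂ A] [Algebra.FiniteType ℂ A]

theorem residue_eq_zero_iff (m : MaximalSpectrum A) (a : A) : residue m a = 0 ↔ a ∈ m.asIdeal := by
  rw [← Ideal.Quotient.eq_zero_iff_mem]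
  exact EmbeddingLike.map_eq_zero_iff (f := (AlgEquiv.ofBijective (Algebra.ofId ℂ (A ⧸ m.asIdeal))
    (residue_bijective m)).symm)

theorem residue_eq_one (m : MaximalSpectrum A) {a : A} (h : 1 - a ∈ m.asIdeal) :
    residue m a = 1 := by
  rw [← residue_eq_zero_iff, map_sub, map_one, sub_eq_zero] at h
  exact h.symm

theorem sub_residue_mem (m : MaximalSpectrum A) (a : A) :
    a - algebraMap ℂ A (residue m a) ∈ m.asIdeal := by
  rw [← residue_eq_zero_iff, map_sub, AlgHom.commutes]
  simp

end Residue

/-! ### Irreducible modules of `L ⊗ A` supported at finitely many points -/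

section Decomposition

variable {L : Type*} [AddCommGroup L] [Module ℂ L] [LieSuperalgebra L]
  {A : Type*} [CommRing A] [Algebra ℂ A]

theorem act_mulA_of_mem_annIdeal {V : SuperModule (L ⊗[ℂ] A)} {a : A} (h : a ∈ annIdeal V)
    (t : L ⊗[ℂ] A) : V.act (mulA L a t) = 0 := by
  induction t with
  | zero => simp
  | add s t hs ht => rw [map_add, map_add, hs, ht, add_zero]
  | tmul x b => exact h x b

theorem act_mulA_congr {V : SuperModule (L ⊗[ℂ] A)} {a b : A} (h : a - b ∈ annIdeal V)
    (t : L ⊗[ℂ] A) : V.act (mulA L a t) = V.act (mulA L b t) := by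
  have h1 : mulA L a t = mulA L (a - b) t + mulA L b t := by rw [← mulA_add, sub_add_cancel]
  rw [h1, map_add, act_mulA_of_mem_annIdeal h, zero_add]

/-- The `L ⊗ A`-module in which `t` acts as `e t`, for `e` idempotent modulo the annihilator. -/
def idemModule (V : SuperModule (L ⊗[ℂ] A)) {e : A} (he : e * e - e ∈ annIdeal V) :
    SuperModule (L ⊗[ℂ] A) where
  carrier := V.carrier
  grading := V.grading
  act := V.act ∘ₗ mulA L e
  act_mem := fun hx hv => V.act_mem (mulA_mem_homog e hx) hv
  act_br := fun hx hy v => by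
    simp only [LinearMap.comp_apply]
    rw [← act_mulA_congr he, ← mulA_br]
    exact V.act_br (mulA_mem_homog e hx) (mulA_mem_homog e hy) v

variable (L) in
/-- The inclusion `x ↦ x ⊗ 1`. -/
def constHom (A : Type*) [CommRing A] [Algebra ℂ A] : SuperHom L (L ⊗[ℂ] A) where
  toFun := (TensorProduct.mk ℂ L A).flip 1
  map_mem := fun hx => tmul_mem_homog hx 1
  map_br := fun x y => by simp [mapSuper_br_tmul]

theorem evalHom_tmul [Algebra.FiniteType ℂ A] (m : MaximalSpectrum A) (x : L) (a : A) :
    (evalHom L m).toFun (x ⊗ₜ[ℂ] a) = residue m a • x := by simp [evalHom]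

theorem evalHom_surjective [Algebra.FiniteType ℂ A] (m : MaximalSpectrum A) :
    Function.Surjective (evalHom L m).toFun := fun x => ⟨x ⊗ₜ 1, by simp [evalHom_tmul]⟩

/-- An irreducible module over `L ⊗ A` that is annihilated by the functions vanishing at finitely
many points is a tensor product of evaluation modules. -/
theorem exists_evaluation_decomposition [Algebra.FiniteType ℂ A] (T : Triangular L)
    (l : List (MaximalSpectrum A)) (hl : l.Nodup) (V : SuperModule (L ⊗[ℂ] A))
    (hfd : FiniteDimensional ℂ V.carrier) (hV : V.IsIrreducible)
    (hk : ∀ c : A, (∀ m ∈ l, c ∈ m.asIdeal) → c ∈ annIdeal V) :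
    ∃ S : MaximalSpectrum A → SuperModule L,
      (∀ m, FiniteDimensional ℂ (S m).carrier ∧ (S m).IsIrreducible) ∧
      PlainIso V (tensorList (l.map fun m => (S m).pullback (evalHom L m))) := by
  induction l generalizing V with
  | nil =>
    refine ⟨fun _ => SuperModule.trivial L, fun _ => ⟨inferInstanceAs (FiniteDimensional ℂ ℂ),
      trivial_irreducible⟩, (hV.iso_trivial fun t v => ?_).plainIso⟩
    have := act_mulA_of_mem_annIdeal (hk 1 (by simp)) t
    rw [mulA_one] at this
    rw [this, LinearMap.zero_apply]
  | cons m l ih =>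
    obtain ⟨hml, hl⟩ := List.nodup_cons.1 hl
    -- Modulo the annihilator `a` is an idempotent, equal to `1` at `m` and to `0` at the remaining
    -- points. It splits the action into a part at `m` and a part elsewhere, which supercommute
    -- because `a * (1 - a)` acts by zero.
    obtain ⟨a, ha, hal⟩ := exists_separating m l hml
    have haa : a * (1 - a) ∈ annIdeal V := hk _ fun m' hm' => by
      rcases List.mem_cons.1 hm' with rfl | h
      · exact Ideal.mul_mem_left _ _ ha
      · exact Ideal.mul_mem_right _ _ (hal m' h)
    have he₁ : a * a - a ∈ annIdeal V := by
      rw [show a * a - a = -(a * (1 - a)) by ring]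
      exact neg_mem haa
    have he₂ : (1 - a) * (1 - a) - (1 - a) ∈ annIdeal V := by
      rw [show (1 - a) * (1 - a) - (1 - a) = -(a * (1 - a)) by ring]
      exact neg_mem haa
    let V₁ : SuperModule L := (idemModule V he₁).pullback (constHom L A)
    let V₂ : SuperModule (L ⊗[ℂ] A) := idemModule V he₂
    have hfd₁ : FiniteDimensional ℂ V₁.carrier := hfd
    have hfd₂ : FiniteDimensional ℂ V₂.carrier := hfd
    let φ : L →ₗ[ℂ] Module.End ℂ V.carrier := V₁.act
    have hφ : ∀ x, φ x = V.act (x ⊗ₜ[ℂ] a) := fun x => by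
      change V.act (mulA L a (x ⊗ₜ[ℂ] 1)) = _
      rw [mulA_tmul, mul_one]
    have hcomm : SuperCommute V₂ φ := by
      refine ⟨fun hx v => V₁.parity_act hx v, fun {i j x t} hx ht (v : V.carrier) => ?_⟩
      change V.act (mulA L a (x ⊗ₜ[ℂ] 1)) (V.act (mulA L (1 - a) t) v) =
        ksign i j • V.act (mulA L (1 - a) t) (V.act (mulA L a (x ⊗ₜ[ℂ] 1)) v)
      have h := V.act_br (mulA_mem_homog a (tmul_mem_homog hx (1 : A))) (mulA_mem_homog (1 - a) ht) v
      rw [mulA_br, act_mulA_of_mem_annIdeal haa, LinearMap.zero_apply] at h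
      exact sub_eq_zero.1 h.symm
    -- The tensor factor at `m` is any irreducible submodule of `V` for the part of the action at
    -- `m`; its inclusion is the nonzero intertwiner that the decomposition needs.
    obtain ⟨N, hp, hx, hS⟩ := V₁.exists_irreducible_sub hV.1
    let S := V₁.sub N hp hx
    have hSfd : FiniteDimensional ℂ S.carrier :=
      inferInstanceAs (FiniteDimensional ℂ N)
    have hSnt : Nontrivial S.carrier := hS.1
    let f₀ : S.carrier →ₗ[ℂ] V₂.carrier := N.subtype
    have hf₀ : f₀ ∈ intertwiners S V₂ φ := fun x s => rfl
    have hf₀' : f₀ ≠ 0 := by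
      obtain ⟨s, hs⟩ := exists_ne (0 : S.carrier)
      exact fun h0 => hs (Subtype.ext (LinearMap.congr_fun h0 s))
    -- The function `a * (b - b(m))` vanishes at all points of the list, so `a t` acts through the
    -- value of `t` at `m`.
    have hact : ∀ t u, V.act t u = φ ((evalHom L m).toFun t) u + V.act (mulA L (1 - a) t) u := by
      intro t u
      rw [hφ, ← LinearMap.add_apply, ← map_add]
      congr 1
      induction t with
      | zero => simp
      | add s t hs ht =>
        rw [map_add, hs, ht, ← map_add]
        congr 1
        simp only [map_add, TensorProduct.add_tmul]
        abel
      | tmul x b =>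
        rw [evalHom_tmul, mulA_tmul, ← sub_eq_zero, ← map_sub]
        have hmem : a * (b - algebraMap ℂ A (residue m b)) ∈ annIdeal V := hk _ fun m' hm' => by
          rcases List.mem_cons.1 hm' with rfl | h
          · exact Ideal.mul_mem_left _ _ (sub_residue_mem _ b)
          · exact Ideal.mul_mem_right _ _ (hal m' h)
        rw [← act_tmul_of_mem_annIdeal hmem x]
        congr 1
        rw [TensorProduct.smul_tmul, ← TensorProduct.tmul_add, ← TensorProduct.tmul_sub,
          Algebra.smul_def]
        congr 1
        ring
    obtain ⟨hWfd, hW, hiso⟩ := tensor_decomposition_homModule (U := V) hV (evalHom L m)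
      (evalHom_surjective m) (T.fullOn_univ hS) hcomm (LinearEquiv.refl ℂ V.carrier)
      (fun u => rfl) hact hf₀ hf₀'
    -- On the intertwiners only the part `(1 - a) t` acts, and `(1 - a) * c` vanishes at `m`
    -- already. The hypothesis of the induction thus concerns the shorter list.
    have hk' : ∀ c : A, (∀ m' ∈ l, c ∈ m'.asIdeal) → c ∈ annIdeal (homModule S V₂ hcomm) := by
      intro c hc x b
      have h0 : ∀ y : L, V₂.act (y ⊗ₜ[ℂ] (c * b)) = 0 := fun y => by
        change V.act (mulA L (1 - a) (y ⊗ₜ[ℂ] (c * b))) = 0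
        rw [mulA_tmul, ← mul_assoc]
        refine (hk ((1 - a) * c) fun m' hm' => ?_) y b
        rcases List.mem_cons.1 hm' with rfl | h
        · exact Ideal.mul_mem_right _ _ ha
        · exact Ideal.mul_mem_left _ _ (hc m' h)
      refine LinearMap.ext fun f => Subtype.ext (LinearMap.ext fun s => ?_)
      refine (homAct_apply (S := S) (V := V₂) _ _ _).trans ?_
      rw [mapSuper_proj_tmul, mapSuper_proj_tmul, h0, h0]
      exact add_zero 0
    obtain ⟨S', hS', hiso'⟩ := ih hl (homModule S V₂ hcomm) hWfd hW hk'
    classical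
    refine ⟨Function.update S' m S, fun m' => ?_, ?_⟩
    · by_cases h : m' = m
      · subst h; rw [Function.update_self]; exact ⟨hSfd, hS⟩
      · rw [Function.update_of_ne h]; exact hS' m'
    · rw [List.map_cons, Function.update_self]
      have hmap : (l.map fun m' => (Function.update S' m S m').pullback (evalHom L m')) =
          l.map fun m' => (S' m').pullback (evalHom L m') := by
        refine List.map_congr_left fun m' hm' => ?_
        have hne : m' ≠ m := fun h => hml (h ▸ hm')
        rw [Function.update_of_ne hne]
      rw [hmap]
      exact hiso.trans (plainIso_tensor (Iso.refl _) hiso')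

end Decomposition

end EquivMap
end

noncomputable section

namespace EquivMap

open LieSuperalgebra SuperModule

/-! ### Equivariant map superalgebras -/

section Equivariant

variable {L : Type*} [AddCommGroup L] [Module ℂ L] [LieSuperalgebra L]
  {A : Type*} [CommRing A] [Algebra ℂ A] {Γ : Type*} [Group Γ]
  (σ : Γ →* superAut L) (τ : Γ →* (A ≃ₐ[ℂ] A))

@[simp] theorem diagAct_tmul (γ : Γ) (x : L) (a : A) :
    diagAct σ τ γ (x ⊗ₜ[ℂ] a) = (σ γ : L ≃ₗ[ℂ] L) x ⊗ₜ[ℂ] τ γ a := rfl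

theorem diagAct_diagAct (γ δ : Γ) (t : L ⊗[ℂ] A) :
    diagAct σ τ γ (diagAct σ τ δ t) = diagAct σ τ (γ * δ) t := by
  induction t with
  | zero => simp
  | add s t hs ht => simp only [map_add, hs, ht]
  | tmul x a => simp

theorem diagAct_one (t : L ⊗[ℂ] A) : diagAct σ τ 1 t = t := by
  induction t with
  | zero => simp
  | add s t hs ht => simp only [map_add, hs, ht]
  | tmul x a => simp

theorem diagAct_mulA (γ : Γ) (a : A) (t : L ⊗[ℂ] A) :
    diagAct σ τ γ (mulA L a t) = mulA L (τ γ a) (diagAct σ τ γ t) := by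
  induction t with
  | zero => simp
  | add s t hs ht => simp only [map_add, hs, ht]
  | tmul x b => simp

theorem diagAct_br (γ : Γ) (s t : L ⊗[ℂ] A) :
    diagAct σ τ γ (br s t) = br (diagAct σ τ γ s) (diagAct σ τ γ t) := by
  induction s with
  | zero => simp
  | add s s' h h' => simp only [map_add, LinearMap.add_apply, h, h']
  | tmul x a =>
    induction t with
    | zero => simp
    | add t t' h h' => simp only [map_add, h, h']
    | tmul y b =>
      simp only [mapSuper_br_tmul, diagAct_tmul, map_mul]
      exact congrArg (· ⊗ₜ[ℂ] _) ((σ γ).2.2 x y)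

theorem diagAct_mem_homog (γ : Γ) {i : ZMod 2} {t : L ⊗[ℂ] A} (ht : t ∈ homog (L ⊗[ℂ] A) i) :
    diagAct σ τ γ t ∈ homog (L ⊗[ℂ] A) i := by
  induction ht using Submodule.span_induction with
  | mem t h =>
    obtain ⟨x, hx, a, rfl⟩ := h
    exact tmul_mem_homog (((σ γ).2.1 i x).2 hx) _
  | zero => simp
  | add t t' _ _ h h' => rw [map_add]; exact add_mem h h'
  | smul c t _ h => rw [map_smul]; exact Submodule.smul_mem _ _ h

theorem diagAct_val (γ : Γ) (u : (equivMap σ τ).Elt) :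
    diagAct σ τ γ ((equivMap σ τ).val u) = (equivMap σ τ).val u := u.2 γ

theorem val_br (u w : (equivMap σ τ).Elt) : (equivMap σ τ).val (br u w) =
    br ((equivMap σ τ).val u) ((equivMap σ τ).val w) := rfl

theorem mem_homog_equivMap {i : ZMod 2} {u : (equivMap σ τ).Elt} :
    u ∈ homog (equivMap σ τ).Elt i ↔ (equivMap σ τ).val u ∈ homog (L ⊗[ℂ] A) i := Iff.rfl

variable [Fintype Γ]

/-- The sum over the group, `L ⊗ A → (L ⊗ A)^Γ`. -/
def avg : L ⊗[ℂ] A →ₗ[ℂ] (equivMap σ τ).Elt :=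
  LinearMap.codRestrict (equivMap σ τ).carrier (∑ γ, diagAct σ τ γ) fun t δ => by
    simp only [LinearMap.sum_apply, map_sum, diagAct_diagAct]
    exact Fintype.sum_equiv (Equiv.mulLeft δ) _ _ fun γ => rfl

theorem val_avg (t : L ⊗[ℂ] A) :
    (equivMap σ τ).val (avg σ τ t) = ∑ γ, diagAct σ τ γ t := by
  change (∑ γ, diagAct σ τ γ) t = _
  rw [LinearMap.sum_apply]

theorem avg_mem_homog {i : ZMod 2} {t : L ⊗[ℂ] A} (ht : t ∈ homog (L ⊗[ℂ] A) i) :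
    avg σ τ t ∈ homog (equivMap σ τ).Elt i := by
  rw [mem_homog_equivMap, val_avg]
  exact sum_mem fun γ _ => diagAct_mem_homog σ τ γ ht

theorem avg_val (u : (equivMap σ τ).Elt) :
    avg σ τ ((equivMap σ τ).val u) = (Fintype.card Γ : ℂ) • u := by
  refine (equivMap σ τ).val_injective ?_
  rw [val_avg, map_smul]
  simp [diagAct_val, ← Nat.cast_smul_eq_nsmul ℂ]

theorem eq_smul_avg_val (u : (equivMap σ τ).Elt) :
    u = (Fintype.card Γ : ℂ)⁻¹ • avg σ τ ((equivMap σ τ).val u) := by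
  rw [avg_val, smul_smul, inv_mul_cancel₀ (Nat.cast_ne_zero.2 Fintype.card_ne_zero), one_smul]

theorem avg_diagAct (γ : Γ) (t : L ⊗[ℂ] A) : avg σ τ (diagAct σ τ γ t) = avg σ τ t := by
  refine (equivMap σ τ).val_injective ?_
  rw [val_avg, val_avg]
  simp only [diagAct_diagAct]
  exact Fintype.sum_equiv (Equiv.mulRight γ) _ _ fun δ => rfl

/-- The trace of an element of `A`. -/
def tr (a : A) : A := ∑ γ, τ γ a

theorem map_tr (γ : Γ) (a : A) : τ γ (tr τ a) = tr τ a := by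
  simp only [tr, map_sum, ← AlgEquiv.mul_apply, ← map_mul]
  exact Fintype.sum_equiv (Equiv.mulLeft γ) _ _ fun δ => rfl

/-- Multiplication by the trace of an element of `A`, on the fixed points. -/
def trAct (a : A) : (equivMap σ τ).Elt →ₗ[ℂ] (equivMap σ τ).Elt :=
  avg σ τ ∘ₗ mulA L a ∘ₗ (equivMap σ τ).val

theorem val_trAct (a : A) (u : (equivMap σ τ).Elt) :
    (equivMap σ τ).val (trAct σ τ a u) = mulA L (tr τ a) ((equivMap σ τ).val u) := by
  simp only [trAct, LinearMap.comp_apply, val_avg, diagAct_mulA, diagAct_val, tr, mulA_sum]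

/-- The bracket of `L ⊗ A` is bilinear over `A`, and multiplication by a trace preserves the fixed
points. -/
theorem trAct_br (a : A) (u w : (equivMap σ τ).Elt) :
    trAct σ τ a (br u w) = br (trAct σ τ a u) w := by
  refine (equivMap σ τ).val_injective ?_
  have := mulA_br (tr τ a) 1 ((equivMap σ τ).val u) ((equivMap σ τ).val w)
  rw [mulA_one, mul_one] at this
  rw [val_trAct, val_br, val_br, val_trAct, this]

theorem avg_mulA_tr (a : A) (t : L ⊗[ℂ] A) :
    avg σ τ (mulA L (tr τ a) t) = trAct σ τ a (avg σ τ t) := by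
  refine (equivMap σ τ).val_injective ?_
  rw [val_avg, val_trAct, val_avg, map_sum]
  simp only [diagAct_mulA, map_tr]

/-- A Galois system for the action on `A`. -/
def IsGaloisSystem (s : Finset (A × A)) : Prop :=
  ∀ γ : Γ, (γ = 1 → ∑ p ∈ s, p.1 * τ γ p.2 = 1) ∧ (γ ≠ 1 → ∑ p ∈ s, p.1 * τ γ p.2 = 0)

variable {τ} in
/-- An action that is free on the maximal spectrum is Galois. -/
theorem exists_isGaloisSystem (hfree : ∀ (γ : Γ) (m : MaximalSpectrum A), maxAct τ γ m = m → γ = 1) :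
    ∃ s : Finset (A × A), IsGaloisSystem τ s := by
  classical
  let Ψ : Γ → (A ⊗[ℂ] A →ₐ[ℂ] A) := fun γ =>
    Algebra.TensorProduct.productMap (AlgHom.id ℂ A) (τ γ : A →ₐ[ℂ] A)
  have hΨ : ∀ γ a b, Ψ γ (a ⊗ₜ b) = a * τ γ b := fun γ a b => by simp [Ψ]
  -- The differences `Ψ 1 z - Ψ γ z` form an ideal. If it were contained in a maximal ideal `m`,
  -- then `a - γ a` would lie in `m` for all `a`, so `γ` would fix `m`, against freeness.
  have hsep : ∀ γ : Γ, γ ≠ 1 → ∃ z, Ψ 1 z = 1 ∧ Ψ γ z = 0 := by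
    intro γ hγ
    let I : Ideal A :=
      { carrier := {c | ∃ z, Ψ 1 z - Ψ γ z = c}
        zero_mem' := ⟨0, by simp⟩
        add_mem' := by
          rintro _ _ ⟨z, rfl⟩ ⟨z', rfl⟩
          exact ⟨z + z', by simp only [map_add]; ring⟩
        smul_mem' := by
          rintro a _ ⟨z, rfl⟩
          exact ⟨(a ⊗ₜ 1) * z, by simp only [map_mul, hΨ, map_one, smul_eq_mul]; ring⟩ }
    have hI : I = ⊤ := by
      by_contra hne
      obtain ⟨m, hm, hIm⟩ := Ideal.exists_le_maximal I hne
      refine hγ (hfree γ ⟨m, hm⟩ (MaximalSpectrum.ext ?_))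
      have hmap : m.map (τ γ) ≤ m := by
        rw [Ideal.map_le_iff_le_comap]
        intro a ha
        have h1 : a - τ γ a ∈ m := hIm ⟨1 ⊗ₜ a, by simp [hΨ]⟩
        rw [Ideal.mem_comap]
        simpa using sub_mem ha h1
      exact (maxAct τ γ ⟨m, hm⟩).isMaximal.eq_of_le hm.ne_top hmap
    obtain ⟨z, hz⟩ : (1 : A) ∈ I := hI ▸ Submodule.mem_top
    -- Subtracting `Ψ γ z ⊗ 1` lowers both values by `Ψ γ z`: the difference `1` is kept and the
    -- value at `γ` becomes zero. The product of these elements over `γ ≠ 1` gives the Galois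
    -- system.
    refine ⟨z - (Ψ γ z) ⊗ₜ 1, ?_, ?_⟩
    · rw [map_sub, hΨ, map_one, mul_one, hz]
    · rw [map_sub, hΨ, map_one, mul_one, sub_self]
  choose! z hz1 hz2 using hsep
  let Z := ∏ γ ∈ Finset.univ.erase (1 : Γ), z γ
  obtain ⟨s, hs⟩ := TensorProduct.exists_finset Z
  have hsum : ∀ γ, ∑ p ∈ s, p.1 * τ γ p.2 = Ψ γ Z := fun γ => by
    rw [hs, map_sum]
    exact Finset.sum_congr rfl fun p _ => (hΨ γ p.1 p.2).symm
  refine ⟨s, fun γ => ⟨?_, fun hγ => ?_⟩⟩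
  · rintro rfl
    rw [hsum, map_prod]
    exact Finset.prod_eq_one fun δ hδ => hz1 δ (Finset.ne_of_mem_erase hδ)
  · rw [hsum, map_prod]
    exact Finset.prod_eq_zero (Finset.mem_erase.2 ⟨hγ, Finset.mem_univ γ⟩) (hz2 γ hγ)

variable {σ τ} {s : Finset (A × A)}

/-- Expanding the traces, only the term of `γ = 1` survives. The formula recovers an element of `A`
from traces. -/
theorem IsGaloisSystem.sum_mul_tr (hs : IsGaloisSystem τ s) (c : A) :
    ∑ p ∈ s, p.1 * tr τ (p.2 * c) = c := by
  classical
  simp only [tr, map_mul, Finset.mul_sum]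
  rw [Finset.sum_comm, Finset.sum_eq_single (1 : Γ)]
  · simp only [← mul_assoc, ← Finset.sum_mul, (hs 1).1 rfl]
    simp
  · intro γ _ hγ
    simp only [← mul_assoc, ← Finset.sum_mul, (hs γ).2 hγ, zero_mul]
  · simp

/-- Galois descent for `L ⊗ A`: the fixed points span it over `A`, with explicit coefficients. -/
theorem IsGaloisSystem.sum_mulA_avg (hs : IsGaloisSystem τ s) (t : L ⊗[ℂ] A) :
    ∑ p ∈ s, mulA L p.1 ((equivMap σ τ).val (avg σ τ (mulA L p.2 t))) = t := by
  simp only [val_avg, map_sum, diagAct_mulA, ← mulA_mul]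
  rw [Finset.sum_comm, Finset.sum_eq_single (1 : Γ)]
  · rw [← mulA_sum, (hs 1).1 rfl, mulA_one, diagAct_one]
  · intro γ _ hγ
    rw [← mulA_sum, (hs γ).2 hγ]
    simpa using mulA_smul (L := L) 0 (0 : A) (diagAct σ τ γ t)
  · simp

/-- A Lie superalgebra spanned by brackets. -/
def Perfect (L : Type*) [AddCommGroup L] [Module ℂ L] [LieSuperalgebra L] : Prop :=
  Submodule.span ℂ {z : L | ∃ x y, z = br x y} = ⊤

/-- By descent a bracket in `L ⊗ A` is an `A`-combination of brackets `[u, w]` of fixed points.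
Summing over `Γ` turns the coefficients into traces, which can be moved into the first argument.
Perfectness of `L` provides enough brackets. -/
theorem IsGaloisSystem.perfect (hs : IsGaloisSystem τ s) (hL : Perfect L) :
    Perfect (equivMap σ τ).Elt := by
  rw [Perfect, eq_top_iff]
  intro u _
  set D := Submodule.span ℂ {z : (equivMap σ τ).Elt | ∃ x y, z = br x y}
  have hbr : ∀ r t : L ⊗[ℂ] A, avg σ τ (br r t) ∈ D := by
    intro r t
    rw [← hs.sum_mulA_avg (σ := σ) r, ← hs.sum_mulA_avg (σ := σ) t]
    simp only [map_sum, LinearMap.sum_apply, mulA_br, ← val_br]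
    refine sum_mem fun p _ => sum_mem fun q _ => ?_
    change trAct σ τ _ _ ∈ D
    rw [trAct_br]
    exact Submodule.subset_span ⟨_, _, rfl⟩
  have hall : ∀ t : L ⊗[ℂ] A, avg σ τ t ∈ D := by
    intro t
    induction t with
    | zero => simp
    | add r t hr ht => rw [map_add]; exact add_mem hr ht
    | tmul x a =>
      have hx : x ∈ Submodule.span ℂ {z : L | ∃ x y, z = br x y} := by
        rw [show Submodule.span ℂ {z : L | ∃ x y, z = br x y} = ⊤ from hL]
        exact Submodule.mem_top
      induction hx using Submodule.span_induction with
      | mem x hx =>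
        obtain ⟨y, z, rfl⟩ := hx
        have := hbr (y ⊗ₜ 1) (z ⊗ₜ a)
        rwa [mapSuper_br_tmul, one_mul] at this
      | zero => simp
      | add x y _ _ hx hy => rw [TensorProduct.add_tmul, map_add]; exact add_mem hx hy
      | smul c x _ hx => rw [← TensorProduct.smul_tmul', map_smul]; exact D.smul_mem _ hx
  rw [eq_smul_avg_val σ τ u]
  exact D.smul_mem _ (hall _)

end Equivariant

/-! ### Finite codimension of the annihilator -/

section Codimension

/-- The homogeneous components of an element that acts by zero act by zero. -/
theorem act_proj_eq_zero {L : Type*} [AddCommGroup L] [Module ℂ L] [LieSuperalgebra L]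
    (V : SuperModule L) {x : L} (hx : V.act x = 0) (i : ZMod 2) :
    V.act ((LieSuperalgebra.grading (L := L)).proj i x) = 0 := by
  have hsum : ∀ v, V.act ((LieSuperalgebra.grading (L := L)).proj 0 x) v + V.act ((LieSuperalgebra.grading (L := L)).proj 1 x) v = 0 :=
    fun v => by
      rw [← LinearMap.add_apply, ← map_add, SuperGrading.proj_add, hx, LinearMap.zero_apply]
  -- Conjugation by parity reverses the sign of the odd component, so the difference of the
  -- components acts by zero along with their sum.
  have hdiff : ∀ v, V.act ((LieSuperalgebra.grading (L := L)).proj 0 x) v - V.act ((LieSuperalgebra.grading (L := L)).proj 1 x) v = 0 := by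
    intro v
    have h := congrArg V.grading.parity (hsum (V.grading.parity v))
    rw [map_add, V.parity_act (SuperGrading.proj_mem _ 0 x), V.parity_act (SuperGrading.proj_mem _ 1 x),
      SuperGrading.parity_parity, ksign_zero_right, ksign_one_one, one_smul, neg_smul, one_smul,
      map_zero, ← sub_eq_add_neg] at h
    exact h
  have h0 : ∀ v, V.act ((LieSuperalgebra.grading (L := L)).proj 0 x) v = 0 := fun v => by
    have h : (2 : ℂ) • V.act ((LieSuperalgebra.grading (L := L)).proj 0 x) v = 0 := by
      rw [two_smul]
      calc _ = (V.act ((LieSuperalgebra.grading (L := L)).proj 0 x) v + V.act ((LieSuperalgebra.grading (L := L)).proj 1 x) v) +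
            (V.act ((LieSuperalgebra.grading (L := L)).proj 0 x) v - V.act ((LieSuperalgebra.grading (L := L)).proj 1 x) v) := by abel
        _ = 0 := by rw [hsum, hdiff, add_zero]
    exact (smul_eq_zero.1 h).resolve_left two_ne_zero
  refine LinearMap.ext fun v => ?_
  rcases zmod2_cases i with rfl | rfl
  · exact h0 v
  · have := hsum v
    rwa [h0, zero_add] at this

/-- The span of the brackets `[u, k]` with `k` acting by zero. -/
def brKer {L : Type*} [AddCommGroup L] [Module ℂ L] [LieSuperalgebra L] (V : SuperModule L) :
    Submodule ℂ L := Submodule.span ℂ {z | ∃ u k, V.act k = 0 ∧ z = br u k}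

variable {L : Type*} [AddCommGroup L] [Module ℂ L] [LieSuperalgebra L] (V : SuperModule L)

/-- The kernel of the action is a graded ideal; its elements are split into homogeneous components
before the formula for the action of a bracket is used. -/
theorem act_of_mem_brKer {x : L} (hx : x ∈ brKer V) : V.act x = 0 := by
  induction hx using Submodule.span_induction with
  | mem z hz =>
    obtain ⟨u, k, hk, rfl⟩ := hz
    induction u using homog_induction with
    | hadd u w hu hw => rw [map_add, LinearMap.add_apply, map_add, hu, hw, add_zero]
    | h i u hu =>
      have h : ∀ j, V.act (br u ((LieSuperalgebra.grading (L := L)).proj j k)) = 0 := fun j => by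
        refine LinearMap.ext fun v => ?_
        rw [V.act_br hu (SuperGrading.proj_mem _ j k), act_proj_eq_zero V hk]
        simp
      rw [← (LieSuperalgebra.grading (L := L)).proj_add k, map_add, map_add, h, h, add_zero]
  | zero => exact map_zero _
  | add x y _ _ hx hy => rw [map_add, hx, hy, add_zero]
  | smul c x _ hx => rw [map_smul, hx, smul_zero]

theorem br_left_mem_brKer {k : L} (hk : V.act k = 0) (w : L) : br k w ∈ brKer V := by
  have h : ∀ i j, br ((LieSuperalgebra.grading (L := L)).proj i k) ((LieSuperalgebra.grading (L := L)).proj j w) ∈ brKer V := by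
    intro i j
    rw [br_skew (SuperGrading.proj_mem _ i k) (SuperGrading.proj_mem _ j w)]
    exact neg_mem (Submodule.smul_mem _ _ (Submodule.subset_span ⟨_, _, act_proj_eq_zero V hk i, rfl⟩))
  rw [← (LieSuperalgebra.grading (L := L)).proj_add k, ← (LieSuperalgebra.grading (L := L)).proj_add w]
  simp only [map_add, LinearMap.add_apply]
  exact add_mem (add_mem (h 0 0) (h 1 0)) (add_mem (h 0 1) (h 1 1))

/-- For a finite-dimensional module over a perfect superalgebra, the brackets with the kernel span
a subspace of finite codimension. -/
theorem exists_finite_sup_brKer [FiniteDimensional ℂ V.carrier] (hL : Perfect L) :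
    ∃ E : Submodule ℂ L, FiniteDimensional ℂ E ∧ E ⊔ brKer V = ⊤ := by
  -- A complement `C` of the kernel embeds in the finite-dimensional `End V`. By perfectness `L` is
  -- spanned by `[C, C]` and brackets with the kernel.
  obtain ⟨C, hC⟩ := Submodule.exists_isCompl (LinearMap.ker V.act)
  have hCfd : FiniteDimensional ℂ C := by
    refine Module.Finite.of_injective (V.act.domRestrict C) ?_
    rw [injective_iff_map_eq_zero]
    intro c hc
    exact Subtype.ext (Submodule.disjoint_def.1 hC.1 c.1 hc c.2)
  refine ⟨Submodule.map₂ br C C, ?_, ?_⟩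
  · exact Module.Finite.iff_fg.2 (Submodule.FG.map₂ br (Module.Finite.iff_fg.1 hCfd)
      (Module.Finite.iff_fg.1 hCfd))
  · rw [eq_top_iff, ← show Submodule.span ℂ {z : L | ∃ x y, z = br x y} = ⊤ from hL,
      Submodule.span_le]
    rintro _ ⟨x, y, rfl⟩
    have hdec : ∀ x : L, ∃ k, V.act k = 0 ∧ ∃ c ∈ C, k + c = x := fun x => by
      obtain ⟨k, hk, c, hc, h⟩ := Submodule.mem_sup.1
        (hC.sup_eq_top ▸ Submodule.mem_top : x ∈ LinearMap.ker V.act ⊔ C)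
      exact ⟨k, hk, c, hc, h⟩
    obtain ⟨k, hk, c, hc, rfl⟩ := hdec x
    obtain ⟨k', hk', c', hc', rfl⟩ := hdec y
    simp only [map_add, LinearMap.add_apply]
    refine add_mem (add_mem ?_ ?_) (add_mem ?_ ?_)
    · exact Submodule.mem_sup_right (br_left_mem_brKer V hk _)
    · exact Submodule.mem_sup_right (Submodule.subset_span ⟨c, k', hk', rfl⟩)
    · exact Submodule.mem_sup_right (br_left_mem_brKer V hk _)
    · exact Submodule.mem_sup_left (Submodule.apply_mem_map₂ _ hc hc')

end Codimension

/-! ### The annihilator ideal in `A` of a module over the fixed points -/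

section FixedAnn

variable {L : Type*} [AddCommGroup L] [Module ℂ L] [LieSuperalgebra L]
  {A : Type*} [CommRing A] [Algebra ℂ A] {Γ : Type*} [Group Γ] [Fintype Γ]
  {σ : Γ →* superAut L} {τ : Γ →* (A ≃ₐ[ℂ] A)}

/-- The largest ideal `I` of `A` such that the sums over `Γ` of elements of `L ⊗ I` act by zero. -/
def fixedAnn (V : SuperModule (equivMap σ τ).Elt) : Ideal A where
  carrier := {a | ∀ t, V.act (avg σ τ (mulA L a t)) = 0}
  zero_mem' := fun t => by
    have := mulA_smul (L := L) 0 (0 : A) t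
    simp only [zero_smul] at this
    rw [this, map_zero, map_zero]
  add_mem' := fun ha hb t => by rw [mulA_add, map_add, map_add, ha, hb, add_zero]
  smul_mem' := fun c a ha t => by rw [smul_eq_mul, mul_comm, mulA_mul]; exact ha _

variable {V : SuperModule (equivMap σ τ).Elt}

/-- The sum over `Γ` does not change when its argument is translated by `γ`. -/
theorem map_mem_fixedAnn (γ : Γ) {a : A} (ha : a ∈ fixedAnn V) : τ γ a ∈ fixedAnn V := by
  intro t
  have h : mulA L (τ γ a) t = diagAct σ τ γ (mulA L a (diagAct σ τ γ⁻¹ t)) := by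
    rw [diagAct_mulA, diagAct_diagAct, mul_inv_cancel, diagAct_one]
  rw [h, avg_diagAct]
  exact ha _

/-- The span of the elements `a t` with `a` in the ideal. -/
def idealSpan (L : Type*) [AddCommGroup L] [Module ℂ L] (I : Ideal A) : Submodule ℂ (L ⊗[ℂ] A) :=
  Submodule.span ℂ {z | ∃ a ∈ I, ∃ t, z = mulA L a t}

theorem act_avg_of_mem_idealSpan {z : L ⊗[ℂ] A} (hz : z ∈ idealSpan L (fixedAnn V)) :
    V.act (avg σ τ z) = 0 := by
  induction hz using Submodule.span_induction with
  | mem z hz =>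
    obtain ⟨a, ha, t, rfl⟩ := hz
    exact ha t
  | zero => simp
  | add x y _ _ hx hy => rw [map_add, map_add, hx, hy, add_zero]
  | smul c x _ hx => rw [map_smul, map_smul, hx, smul_zero]

/-- Up to the factor `|Γ|`, a fixed point equals its own sum over the group. -/
theorem act_eq_zero_of_val_mem {u : (equivMap σ τ).Elt}
    (hu : (equivMap σ τ).val u ∈ idealSpan L (fixedAnn V)) : V.act u = 0 := by
  rw [eq_smul_avg_val σ τ u, map_smul, act_avg_of_mem_idealSpan hu, smul_zero]

theorem act_congr_of_val_sub_mem {u w : (equivMap σ τ).Elt}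
    (hu : (equivMap σ τ).val u - (equivMap σ τ).val w ∈ idealSpan L (fixedAnn V)) :
    V.act u = V.act w := by
  rw [← map_sub] at hu
  exact sub_eq_zero.1 ((map_sub _ _ _).symm.trans (act_eq_zero_of_val_mem hu))

/-- The annihilator ideal of a finite-dimensional module has finite codimension. -/
theorem finite_quotient_fixedAnn [FiniteDimensional ℂ V.carrier] {s : Finset (A × A)}
    (hs : IsGaloisSystem τ s) (hL : Perfect L) : Module.Finite ℂ (A ⧸ fixedAnn V) := by
  obtain ⟨E, hEfd, hE⟩ := exists_finite_sup_brKer V (hs.perfect (σ := σ) hL)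
  set K := brKer V
  -- The brackets with the kernel are used instead of the kernel itself because their span is
  -- visibly stable under traces: `tr a • [u, k] = [tr a • u, k]`.
  have hKtr : ∀ a, ∀ u ∈ K, trAct σ τ a u ∈ K := by
    intro a u hu
    induction hu using Submodule.span_induction with
    | mem z hz =>
      obtain ⟨u, k, hk, rfl⟩ := hz
      rw [trAct_br]
      exact Submodule.subset_span ⟨_, k, hk, rfl⟩
    | zero => simp
    | add x y _ _ hx hy => rw [map_add]; exact add_mem hx hy
    | smul c x _ hx => rw [map_smul]; exact K.smul_mem _ hx
  have hQ : Module.Finite ℂ ((equivMap σ τ).Elt ⧸ K) := by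
    refine Module.Finite.of_surjective (K.mkQ ∘ₗ E.subtype) fun q => ?_
    obtain ⟨u, rfl⟩ := K.mkQ_surjective q
    obtain ⟨e, he, k, hk, rfl⟩ := Submodule.mem_sup.1 (hE ▸ Submodule.mem_top : u ∈ E ⊔ K)
    refine ⟨⟨e, he⟩, ?_⟩
    have hk0 : K.mkQ k = 0 := by simpa using hk
    rw [map_add, hk0, add_zero]
    rfl
  have hadd : ∀ a b u, trAct σ τ (a + b) u = trAct σ τ a u + trAct σ τ b u := fun a b u => by
    simp only [trAct, LinearMap.comp_apply, mulA_add, map_add]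
  have hsmul : ∀ (c : ℂ) a u, trAct σ τ (c • a) u = c • trAct σ τ a u := fun c a u => by
    simp only [trAct, LinearMap.comp_apply, mulA_smul, map_smul]
  let Φ : A →ₗ[ℂ] (s → E →ₗ[ℂ] ((equivMap σ τ).Elt ⧸ K)) :=
    { toFun := fun c p => K.mkQ ∘ₗ trAct σ τ (p.1.2 * c) ∘ₗ E.subtype
      map_add' := fun c d => by
        ext p e
        simp only [mul_add, LinearMap.comp_apply, hadd, Pi.add_apply, LinearMap.add_apply, map_add]
      map_smul' := fun r c => by
        ext p e
        simp only [mul_smul_comm, LinearMap.comp_apply, hsmul, Pi.smul_apply, LinearMap.smul_apply,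
          map_smul, RingHom.id_apply] }
  -- If `Φ c = 0`, then multiplication by each `tr (p.2 * c)` sends both `E` and `K` into `K`, hence
  -- everything. As `c` is the sum of the `p.1 * tr (p.2 * c)`, the sum over `Γ` of `c t` lies in
  -- `K` and acts by zero. The target of `Φ` is finite-dimensional.
  have hker : ∀ c, Φ c = 0 → c ∈ fixedAnn V := by
    intro c hc t
    have hmem : ∀ p ∈ s, ∀ u, trAct σ τ (p.2 * c) u ∈ K := by
      intro p hp u
      obtain ⟨e, he, k, hk, rfl⟩ := Submodule.mem_sup.1 (hE ▸ Submodule.mem_top : u ∈ E ⊔ K)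
      rw [map_add]
      refine add_mem ?_ (hKtr _ k hk)
      have h1 := LinearMap.congr_fun (congrFun hc ⟨p, hp⟩) ⟨e, he⟩
      exact (Submodule.Quotient.mk_eq_zero K).1 h1
    have h1 : mulA L c t = ∑ p ∈ s, mulA L (tr τ (p.2 * c)) (mulA L p.1 t) := by
      conv_lhs => rw [← hs.sum_mul_tr c, mulA_sum]
      refine Finset.sum_congr rfl fun p _ => ?_
      rw [mul_comm, mulA_mul]
    rw [h1, map_sum, map_sum]
    refine Finset.sum_eq_zero fun p hp => ?_
    rw [avg_mulA_tr]
    exact act_of_mem_brKer V (hmem p hp _)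
  have hfin : Module.Finite ℂ (A ⧸ LinearMap.ker Φ) :=
    Module.Finite.equiv (LinearMap.quotKerEquivRange Φ).symm
  refine Module.Finite.of_surjective
    ((LinearMap.ker Φ).liftQ (Ideal.Quotient.mkₐ ℂ (fixedAnn V)).toLinearMap fun c hc => ?_) ?_
  · exact Ideal.Quotient.eq_zero_iff_mem.2 (hker c hc)
  · intro q
    obtain ⟨c, rfl⟩ := Ideal.Quotient.mk_surjective q
    exact ⟨(LinearMap.ker Φ).mkQ c, rfl⟩

/-- Only finitely many maximal ideals contain an ideal of finite codimension. -/
theorem finite_setOf_le {A : Type*} [CommRing A] [Algebra ℂ A] (I : Ideal A)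
    [Module.Finite ℂ (A ⧸ I)] : {m : MaximalSpectrum A | I ≤ m.asIdeal}.Finite := by
  have : IsArtinianRing (A ⧸ I) := IsArtinianRing.of_finite ℂ (A ⧸ I)
  have hsurj := Ideal.Quotient.mk_surjective (I := I)
  let f : MaximalSpectrum (A ⧸ I) → MaximalSpectrum A := fun m =>
    ⟨m.asIdeal.comap (Ideal.Quotient.mk I),
      have := m.isMaximal
      Ideal.comap_isMaximal_of_surjective _ hsurj⟩
  refine (Set.finite_range f).subset fun m hm => ?_
  have hcm : (m.asIdeal.map (Ideal.Quotient.mk I)).comap (Ideal.Quotient.mk I) = m.asIdeal := by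
    rw [Ideal.comap_map_of_surjective _ hsurj, ← RingHom.ker_eq_comap_bot, Ideal.mk_ker]
    exact sup_eq_left.2 hm
  have := m.isMaximal
  refine ⟨⟨m.asIdeal.map (Ideal.Quotient.mk I), ?_⟩, MaximalSpectrum.ext hcm⟩
  rcases Ideal.map_eq_top_or_isMaximal_of_surjective _ hsurj this with h | h
  · exfalso
    rw [h, Ideal.comap_top] at hcm
    exact this.ne_top hcm.symm
  · exact h

end FixedAnn

end EquivMap
end

noncomputable section

namespace EquivMap

open LieSuperalgebra SuperModule

/-! ### Extension of modules from the fixed points -/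

section Idempotents

variable {A : Type*} [CommRing A]

theorem exists_separating_list (l l' : List (MaximalSpectrum A)) (h : ∀ m ∈ l, m ∉ l') :
    ∃ a : A, (∀ m ∈ l, 1 - a ∈ m.asIdeal) ∧ ∀ m' ∈ l', a ∈ m'.asIdeal := by
  induction l with
  | nil => exact ⟨0, by simp, fun m' _ => zero_mem _⟩
  | cons m l ih =>
    obtain ⟨a, ha, ha'⟩ := ih fun m' hm' => h m' (List.mem_cons_of_mem _ hm')
    obtain ⟨b, hb, hb'⟩ := exists_separating m l' (h m List.mem_cons_self)
    have hab : 1 - (a + b - a * b) = (1 - a) * (1 - b) := by ring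
    refine ⟨a + b - a * b, fun m' hm' => ?_, fun m' hm' => ?_⟩
    · rw [hab]
      rcases List.mem_cons.1 hm' with rfl | hm'
      · exact Ideal.mul_mem_left _ _ hb
      · exact Ideal.mul_mem_right _ _ (ha m' hm')
    · exact sub_mem (add_mem (ha' m' hm') (hb' m' hm')) (Ideal.mul_mem_right _ _ (ha' m' hm'))

/-- An element that is nilpotent and idempotent modulo an ideal belongs to it. -/
theorem mem_of_mem_radical_of_mul_self {I : Ideal A} {x : A} (hx : x ∈ I.radical)
    (h : x * x - x ∈ I) : x ∈ I := by
  obtain ⟨k, hk⟩ := hx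
  rw [← Ideal.Quotient.eq_zero_iff_mem] at h hk ⊢
  have h' : IsIdempotentElem (Ideal.Quotient.mk I x) := by
    rwa [map_sub, map_mul, sub_eq_zero] at h
  rw [map_pow] at hk
  rcases Nat.eq_zero_or_pos k with rfl | hk0
  · rw [pow_zero] at hk
    rw [← mul_one (Ideal.Quotient.mk I x), hk, mul_zero]
  · rwa [h'.pow_eq hk0.ne'] at hk

/-- The Nullstellensatz in a Jacobson ring: a radical ideal is an intersection of maximal ideals. -/
theorem mem_of_forall_maximal [IsJacobsonRing A] {I : Ideal A} (hI : I.IsRadical) {x : A}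
    (h : ∀ m : MaximalSpectrum A, I ≤ m.asIdeal → x ∈ m.asIdeal) : x ∈ I := by
  rw [← IsJacobsonRing.out ‹_› hI, Ideal.jacobson, Ideal.mem_sInf]
  intro J hJ
  exact h ⟨J, hJ.2⟩ hJ.1

theorem mem_radical_of_forall_maximal [IsJacobsonRing A] {I : Ideal A} {x : A}
    (h : ∀ m : MaximalSpectrum A, I ≤ m.asIdeal → x ∈ m.asIdeal) : x ∈ I.radical :=
  mem_of_forall_maximal I.radical_isRadical fun m hm => h m (I.le_radical.trans hm)

end Idempotents

/-! ### The action on points, and idempotents adapted to orbit representatives -/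

section MaxAct

variable {A : Type*} [CommRing A] [Algebra ℂ A] {Γ : Type*} [Group Γ] (τ : Γ →* (A ≃ₐ[ℂ] A))

theorem mem_maxAct {γ : Γ} {m : MaximalSpectrum A} {a : A} :
    a ∈ (maxAct τ γ m).asIdeal ↔ τ γ⁻¹ a ∈ m.asIdeal := by
  have h : (maxAct τ γ m).asIdeal = m.asIdeal.comap (τ γ : A ≃+* A).symm :=
    Ideal.map_comap_of_equiv (τ γ : A ≃+* A)
  rw [h, Ideal.mem_comap, map_inv]
  rfl

theorem map_mem_maxAct {γ : Γ} {m : MaximalSpectrum A} {a : A} :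
    τ γ a ∈ (maxAct τ γ m).asIdeal ↔ a ∈ m.asIdeal := by
  rw [mem_maxAct, ← AlgEquiv.mul_apply, ← map_mul, inv_mul_cancel, map_one, AlgEquiv.one_apply]

theorem maxAct_one (m : MaximalSpectrum A) : maxAct τ 1 m = m := by
  ext a
  simp [mem_maxAct]

theorem maxAct_maxAct (γ δ : Γ) (m : MaximalSpectrum A) :
    maxAct τ γ (maxAct τ δ m) = maxAct τ (γ * δ) m := by
  ext a
  rw [mem_maxAct, mem_maxAct, mem_maxAct, mul_inv_rev, map_mul, AlgEquiv.mul_apply]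

variable {τ}

theorem maxAct_ne_of_pairwise {l : List (MaximalSpectrum A)}
    (hl : l.Pairwise fun m m' => ∀ γ, maxAct τ γ m ≠ m') {m m' : MaximalSpectrum A} (hm : m ∈ l)
    (hm' : m' ∈ l) (hne : m ≠ m') (γ : Γ) : maxAct τ γ m ≠ m' := by
  have : Std.Symm fun m m' : MaximalSpectrum A => ∀ γ, maxAct τ γ m ≠ m' :=
    ⟨fun a b h γ hγ => h γ⁻¹ (by rw [← hγ, maxAct_maxAct, inv_mul_cancel, maxAct_one])⟩
  exact hl.forall hm hm' hne γ

theorem eq_one_of_maxAct_mem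
    (hfree : ∀ (γ : Γ) (m : MaximalSpectrum A), maxAct τ γ m = m → γ = 1)
    {l : List (MaximalSpectrum A)} (hl : l.Pairwise fun m m' => ∀ γ, maxAct τ γ m ≠ m')
    {m : MaximalSpectrum A} (hm : m ∈ l) {γ : Γ} (hγ : maxAct τ γ m ∈ l) : γ = 1 := by
  by_contra hne
  exact maxAct_ne_of_pairwise hl hm hγ (fun h => hne (hfree γ m h.symm)) γ rfl

variable [Fintype Γ]

/-- Given representatives of the orbits of points that contain an invariant ideal `I`, there is an
idempotent modulo `I` with support the representatives, whose conjugates are orthogonal and add up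
to `1` modulo `I`. -/
theorem exists_idempotent [IsJacobsonRing A]
    (hfree : ∀ (γ : Γ) (m : MaximalSpectrum A), maxAct τ γ m = m → γ = 1)
    {I : Ideal A} (hI : ∀ γ, ∀ a ∈ I, τ γ a ∈ I) (l : List (MaximalSpectrum A))
    (hl : l.Pairwise fun m m' => ∀ γ, maxAct τ γ m ≠ m')
    (hlI : ∀ m : MaximalSpectrum A, I ≤ m.asIdeal → ∃ γ, maxAct τ γ m ∈ l) :
    ∃ e : A, e * e - e ∈ I ∧ (∀ γ, γ ≠ 1 → e * τ γ e ∈ I) ∧ 1 - tr τ e ∈ I ∧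
      ∀ m : MaximalSpectrum A, I ≤ m.asIdeal → m ∉ l → e ∈ m.asIdeal := by
  classical
  -- The conjugates of the chosen points that are not chosen themselves; every other point
  -- containing `I` is among them. The function `a` below is `1` on `l` and `0` on `l'`.
  let l' : List (MaximalSpectrum A) :=
    (l.flatMap fun m => (Finset.univ : Finset Γ).toList.map fun γ => maxAct τ γ m).filter (· ∉ l)
  have hl' : ∀ m : MaximalSpectrum A, I ≤ m.asIdeal → m ∉ l → m ∈ l' := by
    intro m hm hml
    obtain ⟨γ, hγ⟩ := hlI m hm
    refine List.mem_filter.2 ⟨List.mem_flatMap.2 ⟨_, hγ, List.mem_map.2 ⟨γ⁻¹, by simp, ?_⟩⟩,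
      by simpa using hml⟩
    rw [maxAct_maxAct, inv_mul_cancel, maxAct_one]
  obtain ⟨a, ha, ha'⟩ := exists_separating_list l l' fun m hm hm' => by
    have := (List.mem_filter.1 hm').2
    simp only [decide_not, Bool.not_eq_eq_eq_not, Bool.not_true, decide_eq_false_iff_not] at this
    exact this hm
  have hrad : a * (1 - a) ∈ I.radical := mem_radical_of_forall_maximal fun m hm => by
    by_cases hml : m ∈ l
    · exact Ideal.mul_mem_left _ _ (ha m hml)
    · exact Ideal.mul_mem_right _ _ (ha' m (hl' m hm hml))
  obtain ⟨N, hN⟩ := hrad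
  have hdvd1 : ∀ (x : A) (k : ℕ), x ∣ 1 - (1 - x) ^ k := fun x k => by
    have := sub_dvd_pow_sub_pow (1 : A) (1 - x) k
    simpa using this
  -- Idempotent lifting: `e` is divisible by `a ^ (N + 1)`, and `1 - e` by `(1 - a) ^ (N + 1)` since
  -- `1 - a` divides `1 - a ^ (N + 1)`. The exponent is `N + 1` so as to be positive even if `N =
  -- 0`; thus `e` vanishes where `a` does.
  obtain ⟨e, he⟩ : ∃ e, e = 1 - (1 - a ^ (N + 1)) ^ (N + 1) := ⟨_, rfl⟩
  have hea : a ^ (N + 1) ∣ e := he ▸ hdvd1 _ _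
  have hea' : (1 - a) ^ (N + 1) ∣ 1 - e := by
    rw [he, sub_sub_cancel]
    refine pow_dvd_pow_of_dvd ?_ _
    have := hdvd1 (1 - a) (N + 1)
    rwa [sub_sub_cancel] at this
  have hidem : e * e - e ∈ I := by
    have h1 : (a * (1 - a)) ^ (N + 1) ∈ I := by
      rw [pow_succ]
      exact Ideal.mul_mem_right _ _ hN
    have h2 : e * (1 - e) ∈ I := by
      refine Ideal.mem_of_dvd _ ?_ h1
      rw [mul_pow]
      exact mul_dvd_mul hea hea'
    have h3 : e * e - e = -(e * (1 - e)) := by ring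
    rw [h3]
    exact neg_mem h2
  have hmem : ∀ m : MaximalSpectrum A, I ≤ m.asIdeal → m ∉ l → e ∈ m.asIdeal := fun m hm hml =>
    Ideal.mem_of_dvd _ ((dvd_pow_self a N.succ_ne_zero).trans hea) (ha' m (hl' m hm hml))
  have hmem' : ∀ m ∈ l, 1 - e ∈ m.asIdeal := fun m hm =>
    Ideal.mem_of_dvd _ ((dvd_pow_self (1 - a) N.succ_ne_zero).trans hea') (ha m hm)
  have hstab : ∀ (γ : Γ) (m : MaximalSpectrum A), I ≤ m.asIdeal → I ≤ (maxAct τ γ m).asIdeal :=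
    fun γ m hm a ha => (mem_maxAct τ).2 (hm (hI _ _ ha))
  -- Modulo `I` the product is idempotent, so it suffices that it vanishes at every point `m`
  -- containing `I`. Otherwise `m` and `γ⁻¹ m` would both be chosen points, which freeness and the
  -- choice of one point per orbit exclude for `γ ≠ 1`.
  have horth : ∀ γ, γ ≠ 1 → e * τ γ e ∈ I := by
    intro γ hγ
    refine mem_of_mem_radical_of_mul_self (mem_radical_of_forall_maximal fun m hm => ?_) ?_
    · by_cases hml : m ∈ l
      · by_cases hml' : maxAct τ γ⁻¹ m ∈ l
        · exact absurd (inv_eq_one.1 (eq_one_of_maxAct_mem hfree hl hml hml')) hγ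
        · refine Ideal.mul_mem_left _ _ ?_
          have h := hmem _ (hstab γ⁻¹ m hm) hml'
          rwa [mem_maxAct, inv_inv] at h
      · exact Ideal.mul_mem_right _ _ (hmem m hm hml)
    · have h2 := hI γ _ hidem
      rw [map_sub, map_mul] at h2
      have h : e * τ γ e * (e * τ γ e) - e * τ γ e =
          (e * e - e) * (τ γ e * τ γ e) + (τ γ e * τ γ e - τ γ e) * e := by ring
      rw [h]
      exact add_mem (Ideal.mul_mem_right _ _ hidem) (Ideal.mul_mem_right _ _ h2)
  have horth' : ∀ γ δ, γ ≠ δ → τ γ e * τ δ e ∈ I := by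
    intro γ δ hne
    have h := hI γ _ (horth (γ⁻¹ * δ) fun h => hne (inv_mul_eq_one.1 h))
    rwa [map_mul, ← AlgEquiv.mul_apply, ← map_mul, mul_inv_cancel_left] at h
  refine ⟨e, hidem, horth, ?_, hmem⟩
  -- Again an idempotent modulo `I` is tested at points. At each `m` exactly one conjugate of `e`
  -- takes the value `1`; by orthogonality the others vanish there.
  refine mem_of_mem_radical_of_mul_self (mem_radical_of_forall_maximal fun m hm => ?_) ?_
  · obtain ⟨γ, hγ⟩ := hlI m hm
    have h1 : 1 - τ γ⁻¹ e ∈ m.asIdeal := by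
      have h := hmem' _ hγ
      rwa [mem_maxAct, map_sub, map_one] at h
    have hm1 := m.isMaximal.isPrime
    have h2 : τ γ⁻¹ e ∉ m.asIdeal := fun h =>
      hm1.ne_top ((Ideal.eq_top_iff_one _).2 (by simpa using add_mem h1 h))
    have h3 : 1 - tr τ e = 1 - τ γ⁻¹ e - ∑ δ ∈ Finset.univ.erase γ⁻¹, τ δ e := by
      rw [tr, ← Finset.add_sum_erase _ _ (Finset.mem_univ γ⁻¹)]
      ring
    rw [h3]
    refine sub_mem h1 (sum_mem fun δ hδ => ?_)
    exact (hm1.mem_or_mem (hm (horth' δ γ⁻¹ (Finset.mem_erase.1 hδ).1))).resolve_right h2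
  · have h1 : tr τ e * tr τ e - tr τ e ∈ I := by
      have h : tr τ e * tr τ e - tr τ e =
          ∑ γ, ∑ δ, (τ γ e * τ δ e - if γ = δ then τ γ e else 0) := by
        simp only [Finset.sum_sub_distrib, Finset.sum_ite_eq, Finset.mem_univ, if_true]
        rw [tr, Finset.sum_mul_sum]
      rw [h]
      refine sum_mem fun γ _ => sum_mem fun δ _ => ?_
      split_ifs with hγ
      · subst hγ
        have := hI γ _ hidem
        rwa [map_sub, map_mul] at this
      · rw [sub_zero]
        exact horth' γ δ hγ
    have h : (1 - tr τ e) * (1 - tr τ e) - (1 - tr τ e) = tr τ e * tr τ e - tr τ e := by ring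
    rwa [h]

end MaxAct

/-! ### Extending a module from the fixed points to `L ⊗ A` -/

section Extend

variable {L : Type*} [AddCommGroup L] [Module ℂ L] {A : Type*} [CommRing A] [Algebra ℂ A]

theorem mulA_mem_idealSpan {I : Ideal A} {a : A} (ha : a ∈ I) (t : L ⊗[ℂ] A) :
    mulA L a t ∈ idealSpan L I := Submodule.subset_span ⟨a, ha, t, rfl⟩

theorem mulA_sub (a b : A) (t : L ⊗[ℂ] A) : mulA L (a - b) t = mulA L a t - mulA L b t := by
  rw [eq_sub_iff_add_eq, ← mulA_add, sub_add_cancel]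

variable [LieSuperalgebra L] {Γ : Type*} [Group Γ] [Fintype Γ]
  {σ : Γ →* superAut L} {τ : Γ →* (A ≃ₐ[ℂ] A)}

/-- The extension of a module over the fixed points to the map superalgebra, given by an element
that is idempotent, and orthogonal to its conjugates, modulo the annihilator. -/
def extendModule (V : SuperModule (equivMap σ τ).Elt) (e : A) (he : e * e - e ∈ fixedAnn V)
    (he' : ∀ γ, γ ≠ 1 → e * τ γ e ∈ fixedAnn V) : SuperModule (L ⊗[ℂ] A) where
  carrier := V.carrier
  grading := V.grading
  act := V.act ∘ₗ avg σ τ ∘ₗ mulA L e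
  act_mem := fun hx hv => V.act_mem (avg_mem_homog σ τ (mulA_mem_homog e hx)) hv
  act_br := by
    classical
    intro i j s t hs ht v
    simp only [LinearMap.comp_apply]
    rw [← V.act_br (avg_mem_homog σ τ (mulA_mem_homog e hs))
      (avg_mem_homog σ τ (mulA_mem_homog e ht))]
    refine LinearMap.congr_fun (act_congr_of_val_sub_mem ?_) v
    rw [val_br, val_avg, val_avg, val_avg]
    -- The bracket of the two sums is a double sum over `Γ`. Its diagonal terms differ from the
    -- expected ones by conjugates of `e * e - e`; the off-diagonal terms contain a product of two
    -- different conjugates of `e`.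
    have h : ∑ γ, diagAct σ τ γ (mulA L e (br s t)) -
        br (∑ γ, diagAct σ τ γ (mulA L e s)) (∑ γ, diagAct σ τ γ (mulA L e t)) =
        ∑ γ, ∑ δ, ((if γ = δ then diagAct σ τ γ (mulA L e (br s t)) else 0) -
          br (diagAct σ τ γ (mulA L e s)) (diagAct σ τ δ (mulA L e t))) := by
      simp only [Finset.sum_sub_distrib, Finset.sum_ite_eq, Finset.mem_univ, if_true]
      simp only [map_sum, LinearMap.sum_apply]
      rw [Finset.sum_comm]
    rw [h]
    refine sum_mem fun γ _ => sum_mem fun δ _ => ?_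
    split_ifs with hγ
    · subst hγ
      rw [← diagAct_br, mulA_br, ← map_sub, ← mulA_sub, diagAct_mulA, ← neg_sub, map_neg]
      exact mulA_mem_idealSpan (neg_mem (map_mem_fixedAnn γ he)) _
    · rw [zero_sub, diagAct_mulA, diagAct_mulA, mulA_br]
      refine neg_mem (mulA_mem_idealSpan ?_ _)
      have h := map_mem_fixedAnn γ (he' (γ⁻¹ * δ) fun h => hγ (inv_mul_eq_one.1 h))
      rwa [map_mul, ← AlgEquiv.mul_apply, ← map_mul, mul_inv_cancel_left] at h

variable {V : SuperModule (equivMap σ τ).Elt} {e : A} {he : e * e - e ∈ fixedAnn V}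
  {he' : ∀ γ, γ ≠ 1 → e * τ γ e ∈ fixedAnn V}

/-- For a fixed point `u` the sum of the conjugates of `e u` is `tr e • u`, and `tr e` is `1` modulo
the annihilator. So the extension restricts to `V`. -/
theorem extendModule_act_val (htr : 1 - tr τ e ∈ fixedAnn V) (u : (equivMap σ τ).Elt) :
    (extendModule V e he he').act ((equivMap σ τ).val u) = V.act u := by
  refine (act_congr_of_val_sub_mem ?_).symm
  have h : (equivMap σ τ).val (avg σ τ (mulA L e ((equivMap σ τ).val u))) = _ := val_trAct σ τ e u
  have h1 := mulA_mem_idealSpan (L := L) htr ((equivMap σ τ).val u)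
  rw [mulA_sub, mulA_one, ← h] at h1
  exact h1

theorem le_annIdeal_extendModule : fixedAnn V ≤ annIdeal (extendModule V e he he') := by
  intro a ha x b
  change V.act (avg σ τ (mulA L e (x ⊗ₜ[ℂ] (a * b)))) = 0
  rw [mulA_tmul, mul_left_comm]
  exact ha (x ⊗ₜ[ℂ] (e * b))

/-- Confines the support of the extension to the chosen points, since `e` lies in every other
maximal ideal that contains `fixedAnn V`. -/
theorem one_sub_mem_annIdeal_extendModule : 1 - e ∈ annIdeal (extendModule V e he he') := by
  intro x b
  change V.act (avg σ τ (mulA L e (x ⊗ₜ[ℂ] ((1 - e) * b)))) = 0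
  have h : e * ((1 - e) * b) = -(e * e - e) * b := by ring
  rw [mulA_tmul, h]
  exact neg_mem he (x ⊗ₜ[ℂ] b)

/-- A finite-dimensional irreducible module over the fixed points is a tensor product of
evaluation modules. -/
theorem exists_evalModule_decomposition [Algebra.FiniteType ℂ A] (T : Triangular L)
    (hT : T.HasCoroots)
    (hfree : ∀ (γ : Γ) (m : MaximalSpectrum A), maxAct τ γ m = m → γ = 1)
    (hfd : FiniteDimensional ℂ V.carrier) (hV : V.IsIrreducible) (l : List (MaximalSpectrum A))
    (hl : l.Pairwise fun m m' => ∀ γ, maxAct τ γ m ≠ m')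
    (hlV : ∀ m : MaximalSpectrum A, fixedAnn V ≤ m.asIdeal → ∃ γ, maxAct τ γ m ∈ l) :
    ∃ S : MaximalSpectrum A → SuperModule L,
      (∀ m, FiniteDimensional ℂ (S m).carrier ∧ (S m).IsIrreducible) ∧
      PlainIso V (tensorList (l.map fun m => evalModule σ τ m (S m))) := by
  have : IsJacobsonRing A := isJacobsonRing_of_finiteType (A := ℂ)
  obtain ⟨e, he, he', htr, hel⟩ := exists_idempotent hfree
    (fun γ a ha => map_mem_fixedAnn (V := V) γ ha) l hl hlV
  let V' := extendModule V e he he'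
  have hact := fun u => extendModule_act_val (he := he) (he' := he') htr u
  have hirr : V'.IsIrreducible := ⟨hV.1, fun N h1 h2 => hV.2 N h1 fun u v hv =>
    LinearMap.congr_fun (hact u) v ▸ h2 ((equivMap σ τ).val u) v hv⟩
  obtain ⟨S, hS, hiso⟩ := exists_evaluation_decomposition T l
    (hl.imp fun {m m'} h hmm' => h 1 ((maxAct_one τ m).trans hmm')) V' hfd hirr fun c hc => by
      have hfd' : FiniteDimensional ℂ V'.carrier := hfd
      -- Radicality reduces membership in the annihilator to the points containing it. Such a point
      -- is in `l`: otherwise its ideal would contain both `e` and `1 - e`.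
      refine mem_of_forall_maximal (annIdeal_isRadical hT hirr) fun m hm => hc m ?_
      by_contra hml
      have h1 := hel m (le_annIdeal_extendModule.trans hm) hml
      have h2 := hm one_sub_mem_annIdeal_extendModule
      exact m.isMaximal.ne_top ((Ideal.eq_top_iff_one _).2 (by simpa using add_mem h2 h1))
  refine ⟨S, hS, ?_⟩
  have h1 : PlainIso V (V'.pullback (equivMap σ τ).incl) :=
    ⟨LinearEquiv.refl _ _, fun u v => (LinearMap.congr_fun (hact u) v).symm⟩
  refine (h1.trans (hiso.pullback _)).trans ((plainIso_pullback_tensorList _ _).trans ?_)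
  rw [List.map_map]
  exact PlainIso.refl _

end Extend

end EquivMap
end

noncomputable section

namespace EquivMap

open LieSuperalgebra SuperModule

/-! ### Evaluation at points of distinct orbits -/

section TensorList

variable {L : Type*} [AddCommGroup L] [Module ℂ L] [LieSuperalgebra L]

theorem tensor_act_eq_zero {V W : SuperModule L} {i : ZMod 2} {x : L} (hx : x ∈ homog L i)
    (hV : V.act x = 0) (hW : W.act x = 0) : (tensor V W).act x = 0 := by
  refine tensor_hom_ext V W fun j v hv w => ?_
  refine (tensorAct_tmul V W hx hv w).trans ?_
  rw [hV, hW, LinearMap.zero_apply, LinearMap.zero_apply, TensorProduct.zero_tmul,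
    TensorProduct.tmul_zero, smul_zero, add_zero]
  rfl

theorem tensorList_act_eq_zero {l : List (SuperModule L)} {i : ZMod 2} {x : L}
    (hx : x ∈ homog L i) (h : ∀ V ∈ l, V.act x = 0) : (tensorList l).act x = 0 := by
  induction l with
  | nil => rfl
  | cons V l ih =>
    exact tensor_act_eq_zero hx (h V List.mem_cons_self)
      (ih fun W hW => h W (List.mem_cons_of_mem _ hW))

theorem finiteDimensional_tensorList {l : List (SuperModule L)}
    (h : ∀ V ∈ l, FiniteDimensional ℂ V.carrier) : FiniteDimensional ℂ (tensorList l).carrier := by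
  induction l with
  | nil => exact inferInstanceAs (FiniteDimensional ℂ ℂ)
  | cons V l ih =>
    have h1 := h V List.mem_cons_self
    have h2 := ih fun W hW => h W (List.mem_cons_of_mem _ hW)
    exact inferInstanceAs (FiniteDimensional ℂ (V.carrier ⊗[ℂ] (tensorList l).carrier))

theorem nontrivial_tensorList {l : List (SuperModule L)}
    (h : ∀ V ∈ l, Nontrivial V.carrier) : Nontrivial (tensorList l).carrier := by
  induction l with
  | nil => exact inferInstanceAs (Nontrivial ℂ)
  | cons V l ih =>
    have h1 := h V List.mem_cons_self
    have h2 := ih fun W hW => h W (List.mem_cons_of_mem _ hW)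
    exact inferInstanceAs (Nontrivial (V.carrier ⊗[ℂ] (tensorList l).carrier))

/-- The automorphism of `V ⊗ W` that applies the parity of `W` on the odd part of `V`. -/
def parityTwist (V W : SuperModule L) :
    V.carrier ⊗[ℂ] W.carrier →ₗ[ℂ] V.carrier ⊗[ℂ] W.carrier :=
  TensorProduct.map (V.grading.proj 0) LinearMap.id +
    TensorProduct.map (V.grading.proj 1) W.grading.parity

theorem parityTwist_tmul (V W : SuperModule L) {j : ZMod 2} {v : V.carrier}
    (hv : v ∈ V.grading.gr j) (w : W.carrier) :
    parityTwist V W (v ⊗ₜ[ℂ] w) = v ⊗ₜ[ℂ] (if j = 0 then w else W.grading.parity w) := by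
  simp only [parityTwist, LinearMap.add_apply, TensorProduct.map_tmul,
    V.grading.proj_of_mem _ hv, LinearMap.id_apply]
  rcases zmod2_cases j with rfl | rfl <;> simp

theorem parityTwist_involutive (V W : SuperModule L) :
    Function.Involutive (parityTwist V W) := by
  intro z
  refine LinearMap.congr_fun (f := parityTwist V W ∘ₗ parityTwist V W) (g := LinearMap.id)
    (tensor_hom_ext V W fun j v hv w => ?_) z
  simp only [LinearMap.comp_apply, parityTwist_tmul V W hv, LinearMap.id_apply]
  split_ifs <;> simp [SuperGrading.parity_parity]

/-- The parity twist removes the sign from the action of elements that act by zero on the first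
factor. -/
theorem parityTwist_act (V W : SuperModule L) {i : ZMod 2} {x : L} (hx : x ∈ homog L i)
    (hV : V.act x = 0) (z : V.carrier ⊗[ℂ] W.carrier) :
    parityTwist V W (tensorAct V W x z) = (W.act x).lTensor V.carrier (parityTwist V W z) := by
  refine LinearMap.congr_fun (f := parityTwist V W ∘ₗ tensorAct V W x)
    (g := (W.act x).lTensor V.carrier ∘ₗ parityTwist V W)
    (tensor_hom_ext V W fun j v hv w => ?_) z
  simp only [LinearMap.comp_apply]
  rw [tensorAct_tmul V W hx hv, hV, LinearMap.zero_apply, TensorProduct.zero_tmul, zero_add,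
    map_smul, parityTwist_tmul V W hv, parityTwist_tmul V W hv, LinearMap.lTensor_tmul]
  rcases zmod2_cases j with rfl | rfl
  · simp [ksign_zero_right]
  · rw [if_neg one_ne_zero, if_neg one_ne_zero, parity_act_parity W hx, TensorProduct.tmul_smul]
    congr 1
    simp [ksign, mul_comm]

theorem comm_tensorAct (V W : SuperModule L) {i : ZMod 2} {x : L} (hx : x ∈ homog L i)
    (hW : W.act x = 0) (z : V.carrier ⊗[ℂ] W.carrier) :
    TensorProduct.comm ℂ V.carrier W.carrier (tensorAct V W x z) =
      (V.act x).lTensor W.carrier (TensorProduct.comm ℂ V.carrier W.carrier z) := by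
  refine LinearMap.congr_fun
    (f := (TensorProduct.comm ℂ V.carrier W.carrier).toLinearMap ∘ₗ tensorAct V W x)
    (g := (V.act x).lTensor W.carrier ∘ₗ (TensorProduct.comm ℂ V.carrier W.carrier).toLinearMap)
    (tensor_hom_ext V W fun j v hv w => ?_) z
  rw [LinearMap.comp_apply, tensorAct_tmul _ _ hx hv, hW, LinearMap.zero_apply,
    TensorProduct.tmul_zero, smul_zero, add_zero]
  rfl

theorem contract_lTensor {U V W : Type*} [AddCommGroup U] [Module ℂ U] [AddCommGroup V]
    [Module ℂ V] [AddCommGroup W] [Module ℂ W] (φ : U →ₗ[ℂ] ℂ) (f : V →ₗ[ℂ] W)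
    (z : U ⊗[ℂ] V) : contract W φ (f.lTensor U z) = f (contract V φ z) := by
  induction z with
  | zero => simp
  | add y z hy hz => simp only [map_add, hy, hz]
  | tmul u v => simp

end TensorList

section Points

variable {L : Type*} [AddCommGroup L] [Module ℂ L] [LieSuperalgebra L]
  {A : Type*} [CommRing A] [Algebra ℂ A] [Algebra.FiniteType ℂ A] {Γ : Type*} [Group Γ]
  (σ : Γ →* superAut L) (τ : Γ →* (A ≃ₐ[ℂ] A))

/-- The evaluation at `m`, restricted to the fixed points. -/
abbrev evalAt (m : MaximalSpectrum A) : SuperHom (equivMap σ τ).Elt L :=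
  (evalHom L m).comp (equivMap σ τ).incl

theorem residue_maxAct (γ : Γ) (m : MaximalSpectrum A) (a : A) :
    residue (maxAct τ γ m) (τ γ a) = residue m a := by
  have h := (map_mem_maxAct τ (γ := γ)).2 (sub_residue_mem m a)
  rw [map_sub, AlgEquiv.commutes, ← residue_eq_zero_iff, map_sub, AlgHom.commutes] at h
  exact sub_eq_zero.1 h

theorem evalHom_diagAct (γ : Γ) (m : MaximalSpectrum A) (t : L ⊗[ℂ] A) :
    (evalHom L (maxAct τ γ m)).toFun (diagAct σ τ γ t) =
      (σ γ : L ≃ₗ[ℂ] L) ((evalHom L m).toFun t) := by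
  induction t with
  | zero => simp
  | add s t hs ht => simp only [map_add, hs, ht]
  | tmul x a => rw [diagAct_tmul, evalHom_tmul, evalHom_tmul, residue_maxAct, map_smul]

theorem evalAt_maxAct (γ : Γ) (m : MaximalSpectrum A) (u : (equivMap σ τ).Elt) :
    (evalAt σ τ (maxAct τ γ m)).toFun u = (σ γ : L ≃ₗ[ℂ] L) ((evalAt σ τ m).toFun u) := by
  refine Eq.trans ?_ (evalHom_diagAct σ τ γ m ((equivMap σ τ).val u))
  rw [diagAct_val]
  rfl

/-- The homogeneous elements of the fixed points that vanish at the points of a list. -/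
def vanishing (F : List (MaximalSpectrum A)) : Set (equivMap σ τ).Elt :=
  {u | (∃ i, u ∈ homog (equivMap σ τ).Elt i) ∧ ∀ m ∈ F, (evalAt σ τ m).toFun u = 0}

theorem vanishing_anti {F F' : List (MaximalSpectrum A)} (h : F ⊆ F') :
    vanishing σ τ F' ⊆ vanishing σ τ F := fun _ hu => ⟨hu.1, fun m hm => hu.2 m (h hm)⟩

theorem evalModule_act_eq_zero {F : List (MaximalSpectrum A)} {m : MaximalSpectrum A} (hm : m ∈ F)
    (S : SuperModule L) {u : (equivMap σ τ).Elt} (hu : u ∈ vanishing σ τ F) :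
    (evalModule σ τ m S).act u = 0 :=
  (congrArg S.act (hu.2 m hm)).trans (map_zero _)

variable {τ}

/-- Elements of `L` can be interpolated at points of distinct orbits. -/
theorem exists_evalAt_eq [Finite Γ] (hfree : ∀ (γ : Γ) (m : MaximalSpectrum A), maxAct τ γ m = m → γ = 1)
    {m : MaximalSpectrum A} {F : List (MaximalSpectrum A)}
    (hF : ∀ m' ∈ F, ∀ γ, maxAct τ γ m ≠ m') {i : ZMod 2} {x : L} (hx : x ∈ homog L i) :
    ∃ u ∈ vanishing σ τ F, (evalAt σ τ m).toFun u = x := by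
  classical
  have := Fintype.ofFinite Γ
  -- At a point `m'` the sum over `Γ` of the conjugates of `x ⊗ a` has the value `∑ a(γ⁻¹ m') γ x`.
  -- So `a` is required to be `1` at `m` and `0` at the conjugates of `m` by `γ ≠ 1` and at all
  -- conjugates of the points of `F`.
  obtain ⟨a, ha, ha'⟩ := exists_separating m
    ((((Finset.univ : Finset Γ).erase 1).toList.map fun γ => maxAct τ γ⁻¹ m) ++
      F.flatMap fun m' => (Finset.univ : Finset Γ).toList.map fun γ => maxAct τ γ⁻¹ m') (by
    rw [List.mem_append, List.mem_map, List.mem_flatMap]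
    rintro (⟨γ, hγ, h⟩ | ⟨m', hm', h⟩)
    · simp only [Finset.mem_toList, Finset.mem_erase] at hγ
      exact hγ.1 (inv_eq_one.1 (hfree _ _ h))
    · obtain ⟨γ, -, h⟩ := List.mem_map.1 h
      refine hF m' hm' γ ?_
      rw [← h, maxAct_maxAct, mul_inv_cancel, maxAct_one])
  have hval : ∀ m', (evalAt σ τ m').toFun (avg σ τ (x ⊗ₜ[ℂ] a)) =
      ∑ γ, residue m' (τ γ a) • (σ γ : L ≃ₗ[ℂ] L) x := by
    intro m'
    change (evalHom L m').toFun ((equivMap σ τ).val (avg σ τ (x ⊗ₜ[ℂ] a))) = _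
    rw [val_avg, map_sum]
    exact Finset.sum_congr rfl fun γ _ => by rw [diagAct_tmul, evalHom_tmul]
  have hres : ∀ (m' : MaximalSpectrum A) (γ : Γ), a ∈ (maxAct τ γ⁻¹ m').asIdeal →
      residue m' (τ γ a) = 0 := by
    intro m' γ h
    rw [residue_eq_zero_iff]
    rwa [mem_maxAct, inv_inv] at h
  refine ⟨avg σ τ (x ⊗ₜ[ℂ] a), ⟨⟨i, avg_mem_homog σ τ (tmul_mem_homog hx a)⟩, fun m' hm' => ?_⟩, ?_⟩
  · rw [hval]
    refine Finset.sum_eq_zero fun γ _ => ?_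
    rw [hres, zero_smul]
    refine ha' _ (List.mem_append_right _ (List.mem_flatMap.2 ⟨m', hm', ?_⟩))
    exact List.mem_map.2 ⟨γ, by simp, rfl⟩
  · rw [hval, Finset.sum_eq_single 1]
    · simp [residue_eq_one m ha]
    · intro γ _ hγ
      rw [hres, zero_smul]
      refine ha' _ (List.mem_append_left _ (List.mem_map.2 ⟨γ, ?_, rfl⟩))
      simpa using hγ
    · simp

/-- By interpolation, the elements that vanish on `F` still take every homogeneous value of `L` at
`m`. -/
theorem fullOn_evalModule [Finite Γ] (hfree : ∀ (γ : Γ) (m : MaximalSpectrum A), maxAct τ γ m = m → γ = 1)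
    {m : MaximalSpectrum A} {F : List (MaximalSpectrum A)}
    (hF : ∀ m' ∈ F, ∀ γ, maxAct τ γ m ≠ m') {S : SuperModule L} (hS : S.FullOn Set.univ) :
    (evalModule σ τ m S).FullOn (vanishing σ τ F) := by
  refine top_le_iff.1 ((ge_of_eq hS).trans (Algebra.adjoin_le ?_))
  rintro _ ⟨x, -, rfl⟩
  refine homog_induction (p := fun x => S.act x ∈
    Algebra.adjoin ℂ ((evalModule σ τ m S).act '' vanishing σ τ F)) (fun x y hx hy => ?_)
    (fun i x hx => ?_) x
  · rw [map_add]
    exact add_mem hx hy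
  · obtain ⟨u, hu, rfl⟩ := exists_evalAt_eq σ hfree hF hx
    exact Algebra.subset_adjoin ⟨u, hu, rfl⟩

/-- Tensor products of evaluation modules at points of distinct orbits are simple. -/
theorem fullOn_tensorList_evalModule [Finite Γ]
    (hfree : ∀ (γ : Γ) (m : MaximalSpectrum A), maxAct τ γ m = m → γ = 1)
    {S : MaximalSpectrum A → SuperModule L} (hfd : ∀ m, FiniteDimensional ℂ (S m).carrier)
    (hS : ∀ m, (S m).FullOn Set.univ) {l : List (MaximalSpectrum A)}
    (hl : l.Pairwise fun m m' => ∀ γ, maxAct τ γ m ≠ m') (F : List (MaximalSpectrum A))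
    (hF : ∀ m ∈ l, ∀ m' ∈ F, ∀ γ, maxAct τ γ m ≠ m') :
    (tensorList (l.map fun m => evalModule σ τ m (S m))).FullOn (vanishing σ τ F) := by
  induction l generalizing F with
  | nil => exact fullOn_trivial _
  | cons m l ih =>
    rw [List.pairwise_cons] at hl
    -- Elements vanishing at the points of `l` generate the operators on the first factor, elements
    -- vanishing at `m` those on the rest. The auxiliary list `F` grows along the induction to
    -- record the points already split off.
    have h1 := fullOn_evalModule σ hfree (m := m) (F := l ++ F) (fun m' hm' => by
      rcases List.mem_append.1 hm' with h | h
      · exact hl.1 m' h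
      · exact hF m List.mem_cons_self m' h) (hS m)
    have h2 := ih hl.2 (m :: F) fun m' hm' m'' hm'' => by
      rcases List.mem_cons.1 hm'' with rfl | h
      · intro γ hγ
        refine hl.1 m' hm' γ⁻¹ ?_
        rw [← hγ, maxAct_maxAct, inv_mul_cancel, maxAct_one]
      · exact hF m' (List.mem_cons_of_mem _ hm') m'' h
    have hfd1 : FiniteDimensional ℂ (evalModule σ τ m (S m)).carrier := hfd m
    have hfd2 : FiniteDimensional ℂ
        (tensorList (l.map fun m => evalModule σ τ m (S m))).carrier :=
      finiteDimensional_tensorList fun V hV => by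
        obtain ⟨m, -, rfl⟩ := List.mem_map.1 hV
        exact hfd m
    refine (FullOn.tensor (fun u hu => hu.1) (fun u hu => hu.1) (fun u hu => ?_)
      (fun u hu => evalModule_act_eq_zero σ τ List.mem_cons_self _ hu) h1 h2).mono
        (Set.union_subset (vanishing_anti σ τ (List.subset_append_right _ _))
          (vanishing_anti σ τ (List.subset_cons_self _ _)))
    obtain ⟨i, hi⟩ := hu.1
    refine tensorList_act_eq_zero hi fun V hV => ?_
    obtain ⟨m', hm', rfl⟩ := List.mem_map.1 hV
    exact evalModule_act_eq_zero σ τ (List.mem_append_left _ hm') _ hu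

/-! ### Isotypic modules -/

/-- `V` is isotypic of type `S` at `m`: under the elements that vanish at finitely many points of
other orbits it is a multiple of the evaluation of `S` at `m`. -/
def IsIsotypic (V : SuperModule (equivMap σ τ).Elt) (m : MaximalSpectrum A) (S : SuperModule L) :
    Prop :=
  ∃ F : List (MaximalSpectrum A), (∀ m' ∈ F, ∀ γ, maxAct τ γ m ≠ m') ∧
    ∃ (W : Type) (_ : AddCommGroup W) (_ : Module ℂ W) (_ : FiniteDimensional ℂ W)
      (f : V.carrier ≃ₗ[ℂ] W ⊗[ℂ] S.carrier), ∀ u ∈ vanishing σ τ F, ∀ v,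
        f (V.act u v) = (S.act ((evalAt σ τ m).toFun u)).lTensor W (f v)

variable {σ}

theorem IsIsotypic.congr {V V' : SuperModule (equivMap σ τ).Elt} {m : MaximalSpectrum A}
    {S : SuperModule L} (h : IsIsotypic σ V m S) (hV : PlainIso V V') : IsIsotypic σ V' m S := by
  obtain ⟨F, hF, W, _, _, hW, f, hf⟩ := h
  obtain ⟨g, hg⟩ := hV.symm
  exact ⟨F, hF, W, _, _, hW, g.trans f, fun u hu v => by
    rw [LinearEquiv.trans_apply, LinearEquiv.trans_apply, hg, hf u hu]⟩

/-- The type at a point is unique. -/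
theorem IsIsotypic.iso [Finite Γ] (hfree : ∀ (γ : Γ) (m : MaximalSpectrum A), maxAct τ γ m = m → γ = 1)
    {V : SuperModule (equivMap σ τ).Elt} {m : MaximalSpectrum A} {S S' : SuperModule L}
    (hV : Nontrivial V.carrier) (hS : S.FullOn Set.univ) (hS' : S'.FullOn Set.univ)
    (h : IsIsotypic σ V m S) (h' : IsIsotypic σ V m S') : Iso S S' := by
  obtain ⟨F, hF, W, _, _, hW, f, hf⟩ := h
  obtain ⟨F', hF', W', _, _, hW', f', hf'⟩ := h'
  let g : W ⊗[ℂ] S.carrier ≃ₗ[ℂ] W' ⊗[ℂ] S'.carrier := f.symm.trans f'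
  -- Every homogeneous `x` is the value at `m` of an element vanishing on both exceptional lists,
  -- where both descriptions of `V` apply; hence the comparison map is linear over `L`.
  have hg : ∀ x z, g ((S.act x).lTensor W z) = (S'.act x).lTensor W' (g z) := by
    intro x z
    refine homog_induction (p := fun x => g ((S.act x).lTensor W z) =
      (S'.act x).lTensor W' (g z)) (fun x y hx hy => ?_) (fun i x hx => ?_) x
    · simp only [map_add, LinearMap.lTensor_add, LinearMap.add_apply, hx, hy]
    · obtain ⟨u, hu, rfl⟩ := exists_evalAt_eq σ hfree (F := F ++ F') (fun m' hm' => by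
        rcases List.mem_append.1 hm' with h | h
        · exact hF m' h
        · exact hF' m' h) hx
      obtain ⟨v, rfl⟩ := f.surjective z
      rw [← hf u (vanishing_anti σ τ (List.subset_append_left _ _) hu)]
      simp only [g, LinearEquiv.trans_apply, LinearEquiv.symm_apply_apply]
      exact hf' u (vanishing_anti σ τ (List.subset_append_right _ _) hu) v
  obtain ⟨w, s, hws⟩ : ∃ w s, g (w ⊗ₜ[ℂ] s) ≠ 0 := by
    by_contra! h0
    have h1 : (g : W ⊗[ℂ] S.carrier →ₗ[ℂ] W' ⊗[ℂ] S'.carrier) = 0 := TensorProduct.ext' h0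
    obtain ⟨v, hv⟩ := exists_ne (0 : V.carrier)
    exact hv (f.map_eq_zero_iff.1 (g.map_eq_zero_iff.1 (LinearMap.congr_fun h1 (f v))))
  obtain ⟨φ, hφ⟩ : ∃ φ : W' →ₗ[ℂ] ℂ, contract S'.carrier φ (g (w ⊗ₜ[ℂ] s)) ≠ 0 := by
    by_contra! h0
    exact hws (eq_zero_of_forall_contract h0)
  -- A nonzero matrix coefficient of `g`, with respect to the multiplicity spaces, is an intertwiner
  -- from `S` to `S'`. By fullness it has zero kernel and full range.
  let k : S.carrier →ₗ[ℂ] S'.carrier :=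
    contract S'.carrier φ ∘ₗ g.toLinearMap ∘ₗ TensorProduct.mk ℂ W S.carrier w
  have hk : ∀ x s, k (S.act x s) = S'.act x (k s) := by
    intro x s
    have h1 := congrArg (contract S'.carrier φ) (hg x (w ⊗ₜ[ℂ] s))
    rwa [contract_lTensor, LinearMap.lTensor_tmul] at h1
  have hinj : LinearMap.ker k = ⊥ := by
    refine (hS.eq_bot_or_top (LinearMap.ker k) fun x _ s hs => ?_).resolve_right fun h => hφ ?_
    · rw [LinearMap.mem_ker] at hs ⊢
      rw [hk, hs, map_zero]
    · have : s ∈ LinearMap.ker k := h ▸ Submodule.mem_top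
      exact this
  have hsurj : LinearMap.range k = ⊤ := by
    refine (hS'.eq_bot_or_top (LinearMap.range k) ?_).resolve_left fun h => hφ ?_
    · rintro x _ _ ⟨s, rfl⟩
      exact ⟨S.act x s, hk x s⟩
    · have : k s ∈ LinearMap.range k := ⟨s, rfl⟩
      rw [h, Submodule.mem_bot] at this
      exact this
  exact PlainIso.iso hS ⟨LinearEquiv.ofBijective k
    ⟨LinearMap.ker_eq_bot.1 hinj, LinearMap.range_eq_top.1 hsurj⟩, hk⟩

theorem IsIsotypic.twist {V : SuperModule (equivMap σ τ).Elt} {m : MaximalSpectrum A}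
    {S : SuperModule L} (h : IsIsotypic σ V m S) (γ : Γ) :
    IsIsotypic σ V (maxAct τ γ m) (S.twist (σ γ)) := by
  obtain ⟨F, hF, W, _, _, hW, f, hf⟩ := h
  refine ⟨F, fun m' hm' δ => ?_, W, _, _, hW, f, fun u hu v => (hf u hu v).trans ?_⟩
  · rw [maxAct_maxAct]
    exact hF m' hm' _
  · have h1 : (S.twist (σ γ)).act ((evalAt σ τ (maxAct τ γ m)).toFun u) =
        S.act ((evalAt σ τ m).toFun u) := by
      rw [evalAt_maxAct]
      exact congrArg S.act ((σ γ : L ≃ₗ[ℂ] L).symm_apply_apply _)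
    exact congrArg (fun k : Module.End ℂ S.carrier => LinearMap.lTensor W k (f v)) h1.symm

/-- The space of `V` itself serves as the multiplicity space. -/
theorem isIsotypic_trivial {V : SuperModule (equivMap σ τ).Elt} (hV : FiniteDimensional ℂ V.carrier)
    {m : MaximalSpectrum A} {F : List (MaximalSpectrum A)}
    (hF : ∀ m' ∈ F, ∀ γ, maxAct τ γ m ≠ m') (h : ∀ u ∈ vanishing σ τ F, V.act u = 0) :
    IsIsotypic σ V m (trivial L) := by
  refine ⟨F, hF, V.carrier, _, _, hV, (TensorProduct.rid ℂ V.carrier).symm, fun u hu v => ?_⟩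
  rw [h u hu]
  have h1 : (trivial L).act ((evalAt σ τ m).toFun u) = 0 := rfl
  rw [h1, LinearMap.lTensor_zero]
  exact map_zero _

theorem isIsotypic_tensor_left {m : MaximalSpectrum A} (S : SuperModule L)
    {V : SuperModule (equivMap σ τ).Elt} (hV : FiniteDimensional ℂ V.carrier)
    {F : List (MaximalSpectrum A)} (hF : ∀ m' ∈ F, ∀ γ, maxAct τ γ m ≠ m')
    (h : ∀ u ∈ vanishing σ τ F, V.act u = 0) :
    IsIsotypic σ (tensor (evalModule σ τ m S) V) m S := by
  refine ⟨F, hF, V.carrier, _, _, hV, TensorProduct.comm ℂ S.carrier V.carrier, fun u hu v => ?_⟩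
  obtain ⟨i, hi⟩ := hu.1
  exact comm_tensorAct (evalModule σ τ m S) V hi (h u hu) v

/-- Elements that act by zero on `V` act on the second factor only, up to a sign depending on the
degree in `V`. The parity twist removes the sign, and `V` joins the multiplicity space. -/
theorem IsIsotypic.tensor_right {m : MaximalSpectrum A} {S : SuperModule L}
    {V W : SuperModule (equivMap σ τ).Elt} (hW : IsIsotypic σ W m S)
    (hV : FiniteDimensional ℂ V.carrier) {F : List (MaximalSpectrum A)}
    (hF : ∀ m' ∈ F, ∀ γ, maxAct τ γ m ≠ m') (h : ∀ u ∈ vanishing σ τ F, V.act u = 0) :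
    IsIsotypic σ (tensor V W) m S := by
  obtain ⟨F', hF', X, _, _, hX, f, hf⟩ := hW
  refine ⟨F ++ F', fun m' hm' => ?_, V.carrier ⊗[ℂ] X, inferInstance, inferInstance,
    inferInstance, ((LinearEquiv.ofInvolutive (parityTwist V W) (parityTwist_involutive V W)).trans
      (TensorProduct.congr (LinearEquiv.refl ℂ V.carrier) f)).trans
        (TensorProduct.assoc ℂ V.carrier X S.carrier).symm, fun u hu z => ?_⟩
  · rcases List.mem_append.1 hm' with h | h
    · exact hF m' h
    · exact hF' m' h
  obtain ⟨i, hi⟩ := hu.1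
  have hV0 := h u (vanishing_anti σ τ (List.subset_append_left _ _) hu)
  have key : ∀ y : V.carrier ⊗[ℂ] W.carrier,
      (TensorProduct.assoc ℂ V.carrier X S.carrier).symm
        (TensorProduct.congr (LinearEquiv.refl ℂ V.carrier) f ((W.act u).lTensor V.carrier y)) =
      (S.act ((evalAt σ τ m).toFun u)).lTensor (V.carrier ⊗[ℂ] X)
        ((TensorProduct.assoc ℂ V.carrier X S.carrier).symm
          (TensorProduct.congr (LinearEquiv.refl ℂ V.carrier) f y)) := by
    intro y
    induction y with
    | zero => simp
    | add y y' hy hy' => simp only [map_add, hy, hy']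
    | tmul v w =>
      rw [LinearMap.lTensor_tmul, TensorProduct.congr_tmul, TensorProduct.congr_tmul,
        hf u (vanishing_anti σ τ (List.subset_append_right _ _) hu)]
      induction f w with
      | zero => simp
      | add y y' hy hy' => simp only [map_add, TensorProduct.tmul_add, hy, hy']
      | tmul x s => simp
  exact (congrArg _ (congrArg _ (parityTwist_act V W hi hV0 z))).trans (key _)

/-- A tensor product of evaluation modules is isotypic at the points of evaluation. -/
theorem isIsotypic_tensorList {S : MaximalSpectrum A → SuperModule L}
    (hfd : ∀ m, FiniteDimensional ℂ (S m).carrier) {l : List (MaximalSpectrum A)}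
    (hl : l.Pairwise fun m m' => ∀ γ, maxAct τ γ m ≠ m') {m : MaximalSpectrum A} (hm : m ∈ l) :
    IsIsotypic σ (tensorList (l.map fun m => evalModule σ τ m (S m))) m (S m) := by
  induction l with
  | nil => exact absurd hm List.not_mem_nil
  | cons m' l ih =>
    rw [List.pairwise_cons] at hl
    rcases List.mem_cons.1 hm with rfl | hm
    · refine isIsotypic_tensor_left (S m) (finiteDimensional_tensorList fun V hV => ?_) hl.1
        fun u hu => ?_
      · obtain ⟨m, -, rfl⟩ := List.mem_map.1 hV
        exact hfd m
      · obtain ⟨i, hi⟩ := hu.1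
        refine tensorList_act_eq_zero hi fun V hV => ?_
        obtain ⟨m', hm', rfl⟩ := List.mem_map.1 hV
        exact evalModule_act_eq_zero σ τ hm' _ hu
    · refine (ih hl.2 hm).tensor_right (hfd m') (F := [m']) (fun m'' hm'' γ hγ => ?_) fun u hu =>
        evalModule_act_eq_zero σ τ List.mem_cons_self _ hu
      rw [List.mem_singleton] at hm''
      refine hl.1 m hm γ⁻¹ ?_
      rw [← hm'', ← hγ, maxAct_maxAct, inv_mul_cancel, maxAct_one]

/-- A tensor product of evaluation modules has trivial type at the points of other orbits. -/
theorem isIsotypic_tensorList_trivial {S : MaximalSpectrum A → SuperModule L}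
    (hfd : ∀ m, FiniteDimensional ℂ (S m).carrier) {l : List (MaximalSpectrum A)}
    {m : MaximalSpectrum A} (hm : ∀ γ, maxAct τ γ m ∉ l) :
    IsIsotypic σ (tensorList (l.map fun m => evalModule σ τ m (S m))) m (trivial L) := by
  refine isIsotypic_trivial (finiteDimensional_tensorList fun V hV => ?_) (F := l)
    (fun m' hm' γ hγ => hm γ (hγ ▸ hm')) fun u hu => ?_
  · obtain ⟨m, -, rfl⟩ := List.mem_map.1 hV
    exact hfd m
  · obtain ⟨i, hi⟩ := hu.1
    refine tensorList_act_eq_zero hi fun V hV => ?_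
    obtain ⟨m', hm', rfl⟩ := List.mem_map.1 hV
    exact evalModule_act_eq_zero σ τ hm' _ hu

end Points

end EquivMap
end

noncomputable section

namespace EquivMap

open LieSuperalgebra SuperModule

/-! ### The classification -/

section Classes

variable {L : Type*} [AddCommGroup L] [Module ℂ L] [LieSuperalgebra L]

theorem rep_spec (c : Irred L) : FiniteDimensional ℂ c.rep.carrier ∧ c.rep.IsIrreducible :=
  (Quotient.out c).2

theorem isoClass_rep (c : Irred L) : isoClass c.rep (rep_spec c) = c := Quotient.out_eq c

theorem isoClass_eq_iff {V W : SuperModule L} {hV : FiniteDimensional ℂ V.carrier ∧ V.IsIrreducible}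
    {hW : FiniteDimensional ℂ W.carrier ∧ W.IsIrreducible} :
    isoClass V hV = isoClass W hW ↔ Iso V W := Quotient.eq (r := isoSetoid L)

theorem twist_spec (f : superAut L) {V : SuperModule L}
    (h : FiniteDimensional ℂ V.carrier ∧ V.IsIrreducible) :
    FiniteDimensional ℂ (V.twist f).carrier ∧ (V.twist f).IsIrreducible :=
  ⟨h.1, twist_irreducible f h.2⟩

theorem twist_trivialClass (f : superAut L) : (trivialClass L).twist f = trivialClass L :=
  (isoClass_eq_iff (hV := ⟨inferInstanceAs (FiniteDimensional ℂ ℂ),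
    twist_irreducible f trivial_irreducible⟩)).2
    ⟨0, LinearEquiv.refl ℂ ℂ, fun i v => by rw [add_zero]; exact Iff.rfl, fun i x _ v => by
      rw [ksign_zero_left, one_smul]; rfl⟩

end Classes

section Representatives

variable {A : Type*} [CommRing A] [Algebra ℂ A] {Γ : Type*} [Group Γ] (τ : Γ →* (A ≃ₐ[ℂ] A))

/-- A list of points of distinct orbits can be completed to one that meets all the orbits of a
finite set. -/
theorem exists_orbit_representatives {Z : Set (MaximalSpectrum A)} (hZ : Z.Finite)
    {l : List (MaximalSpectrum A)} (hl : l.Pairwise fun m m' => ∀ γ, maxAct τ γ m ≠ m') :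
    ∃ l' : List (MaximalSpectrum A), (∀ m ∈ l', m ∈ Z) ∧
      (l ++ l').Pairwise (fun m m' => ∀ γ, maxAct τ γ m ≠ m') ∧
      ∀ m ∈ Z, ∃ γ, maxAct τ γ m ∈ l ++ l' := by
  induction Z, hZ using Set.Finite.induction_on with
  | empty => exact ⟨[], by simp, by simpa using hl, by simp⟩
  | @insert z Z _ _ ih =>
    obtain ⟨l', h1, h2, h3⟩ := ih
    by_cases hz : ∃ γ, maxAct τ γ z ∈ l ++ l'
    · exact ⟨l', fun m hm => Set.mem_insert_of_mem _ (h1 m hm), h2, fun m hm => by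
        rcases hm with rfl | hm
        · exact hz
        · exact h3 m hm⟩
    · refine ⟨l' ++ [z], fun m hm => ?_, ?_, fun m hm => ?_⟩
      · rcases List.mem_append.1 hm with hm | hm
        · exact Set.mem_insert_of_mem _ (h1 m hm)
        · exact Or.inl (List.mem_singleton.1 hm)
      · rw [← List.append_assoc, List.pairwise_append]
        refine ⟨h2, List.pairwise_singleton _ _, fun m hm m' hm' γ hγ => hz ⟨γ⁻¹, ?_⟩⟩
        rw [List.mem_singleton] at hm'
        rwa [← hm', ← hγ, maxAct_maxAct, inv_mul_cancel, maxAct_one]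
      · rcases hm with rfl | hm
        · exact ⟨1, by rw [maxAct_one]; simp⟩
        · obtain ⟨γ, hγ⟩ := h3 m hm
          exact ⟨γ, by rw [← List.append_assoc]; exact List.mem_append_left _ hγ⟩

end Representatives

section Classification

variable {L : Type*} [AddCommGroup L] [Module ℂ L] [LieSuperalgebra L]
  {A : Type*} [CommRing A] [Algebra ℂ A] {Γ : Type*} [Group Γ]
  {σ : Γ →* superAut L} {τ : Γ →* (A ≃ₐ[ℂ] A)}

theorem exists_isSuppStar {π : MaximalSpectrum A → Irred L} (hπ : π ∈ FinSuppMaps σ τ) :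
    ∃ l, IsSuppStar τ π l := by
  obtain ⟨l, h1, h2, h3⟩ := exists_orbit_representatives τ hπ.2 (l := []) List.Pairwise.nil
  rw [List.nil_append] at h2 h3
  exact ⟨l, h1, h3, h2⟩

variable [Algebra.FiniteType ℂ A]

theorem finiteDimensional_evalProduct (π : MaximalSpectrum A → Irred L)
    (l : List (MaximalSpectrum A)) : FiniteDimensional ℂ (evalProduct σ τ π l).carrier :=
  finiteDimensional_tensorList fun V hV => by
    obtain ⟨m, -, rfl⟩ := List.mem_map.1 hV
    exact (rep_spec (π m)).1

theorem nontrivial_evalProduct (π : MaximalSpectrum A → Irred L)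
    (l : List (MaximalSpectrum A)) : Nontrivial (evalProduct σ τ π l).carrier :=
  nontrivial_tensorList fun V hV => by
    obtain ⟨m, -, rfl⟩ := List.mem_map.1 hV
    exact (rep_spec (π m)).2.1

/-- A representative of the value of `π` is the type of `𝒱(π)` at each point. -/
theorem exists_isIsotypic_evalProduct {π : MaximalSpectrum A → Irred L}
    (hπ : π ∈ FinSuppMaps σ τ) {l : List (MaximalSpectrum A)} (hl : IsSuppStar τ π l)
    (m : MaximalSpectrum A) :
    ∃ (S : SuperModule L) (hS : FiniteDimensional ℂ S.carrier ∧ S.IsIrreducible),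
      isoClass S hS = π m ∧ IsIsotypic σ (evalProduct σ τ π l) m S := by
  have hfd : ∀ m, FiniteDimensional ℂ (π m).rep.carrier := fun m => (rep_spec (π m)).1
  by_cases hm : π m = trivialClass L
  · refine ⟨trivial L, ⟨inferInstanceAs (FiniteDimensional ℂ ℂ), trivial_irreducible⟩, hm.symm,
      isIsotypic_tensorList_trivial hfd fun γ hγ => hl.1 _ hγ ?_⟩
    rw [hπ.1, hm, twist_trivialClass]
  -- The point `m` need not be in the list. The type is transported from the representative of its
  -- orbit, in step with the equivariance of `π`.
  · obtain ⟨γ, hγ⟩ := hl.2.1 m hm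
    have h := (isIsotypic_tensorList (σ := σ) hfd hl.2.2 hγ).twist γ⁻¹
    rw [maxAct_maxAct, inv_mul_cancel, maxAct_one] at h
    refine ⟨_, twist_spec _ (rep_spec _), ?_, h⟩
    have h1 := hπ.1 γ⁻¹ (maxAct τ γ m)
    rw [maxAct_maxAct, inv_mul_cancel, maxAct_one] at h1
    rw [h1]
    conv_rhs => rw [← isoClass_rep (π (maxAct τ γ m))]
    rfl

variable [Finite Γ]

theorem fullOn_evalProduct (T : Triangular L)
    (hfree : ∀ (γ : Γ) (m : MaximalSpectrum A), maxAct τ γ m = m → γ = 1)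
    (π : MaximalSpectrum A → Irred L) {l : List (MaximalSpectrum A)}
    (hl : IsSuppStar τ π l) : (evalProduct σ τ π l).FullOn (vanishing σ τ []) :=
  fullOn_tensorList_evalModule σ hfree (fun m => (rep_spec (π m)).1)
    (fun m => have := (rep_spec (π m)).1; T.fullOn_univ (rep_spec (π m)).2) hl.2.2 [] (by simp)

/-- The type of a module at a point is determined up to isomorphism. -/
theorem isoClass_eq_of_isIsotypic (T : Triangular L)
    (hfree : ∀ (γ : Γ) (m : MaximalSpectrum A), maxAct τ γ m = m → γ = 1)
    {V : SuperModule (equivMap σ τ).Elt} (hV : Nontrivial V.carrier)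
    {m : MaximalSpectrum A} {S S' : SuperModule L}
    (hS : FiniteDimensional ℂ S.carrier ∧ S.IsIrreducible)
    (hS' : FiniteDimensional ℂ S'.carrier ∧ S'.IsIrreducible)
    (h : IsIsotypic σ V m S) (h' : IsIsotypic σ V m S') : isoClass S hS = isoClass S' hS' := by
  have h1 := hS.1
  have h2 := hS'.1
  exact isoClass_eq_iff.2 (h.iso hfree hV (T.fullOn_univ hS.2) (T.fullOn_univ hS'.2) h')

/-- The value of the function at each point is the class of the type of the module there, which an
ungraded isomorphism preserves. -/
theorem eq_of_iso_evalProduct (T : Triangular L)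
    (hfree : ∀ (γ : Γ) (m : MaximalSpectrum A), maxAct τ γ m = m → γ = 1)
    {π π' : MaximalSpectrum A → Irred L}
    (hπ : π ∈ FinSuppMaps σ τ) (hπ' : π' ∈ FinSuppMaps σ τ) {l l' : List (MaximalSpectrum A)}
    (hl : IsSuppStar τ π l) (hl' : IsSuppStar τ π' l')
    (h : PlainIso (evalProduct σ τ π l) (evalProduct σ τ π' l')) : π = π' := by
  funext m
  obtain ⟨S, hS, hSm, h1⟩ := exists_isIsotypic_evalProduct hπ hl m
  obtain ⟨S', hS', hSm', h2⟩ := exists_isIsotypic_evalProduct hπ' hl' m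
  rw [← hSm, ← hSm']
  exact isoClass_eq_of_isIsotypic T hfree (nontrivial_evalProduct π' l') hS hS' (h1.congr h) h2

/-- The types of a finite-dimensional irreducible module form an equivariant function of finite
support. -/
theorem exists_types (T : Triangular L)
    (hfree : ∀ (γ : Γ) (m : MaximalSpectrum A), maxAct τ γ m = m → γ = 1)
    (hT : T.HasCoroots) (hL : Perfect L) {V : SuperModule (equivMap σ τ).Elt}
    (hV : FiniteDimensional ℂ V.carrier ∧ V.IsIrreducible) :
    ∃ π ∈ FinSuppMaps σ τ, ∀ m, ∃ (S : SuperModule L)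
      (hS : FiniteDimensional ℂ S.carrier ∧ S.IsIrreducible),
      isoClass S hS = π m ∧ IsIsotypic σ V m S := by
  have := Fintype.ofFinite Γ
  have hfd := hV.1
  obtain ⟨s, hs⟩ := exists_isGaloisSystem hfree
  have := finite_quotient_fixedAnn (V := V) hs hL
  obtain ⟨l, -, hl, hlV⟩ := exists_orbit_representatives τ (finite_setOf_le (fixedAnn V)) (l := [])
    List.Pairwise.nil
  rw [List.nil_append] at hl hlV
  obtain ⟨S, hS, hiso⟩ := exists_evalModule_decomposition T hT hfree hV.1 hV.2 l hl hlV
  have htriv : ∀ m, (∀ γ, maxAct τ γ m ∉ l) → IsIsotypic σ V m (trivial L) := fun m hm =>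
    (isIsotypic_tensorList_trivial (fun m => (hS m).1) hm).congr hiso.symm
  have htriv' : FiniteDimensional ℂ (trivial L).carrier ∧ (trivial L).IsIrreducible :=
    ⟨inferInstanceAs (FiniteDimensional ℂ ℂ), trivial_irreducible⟩
  have hex : ∀ m, ∃ (S : SuperModule L) (_ : FiniteDimensional ℂ S.carrier ∧ S.IsIrreducible),
      IsIsotypic σ V m S := by
    intro m
    by_cases hm : ∃ γ, maxAct τ γ m ∈ l
    · obtain ⟨γ, hγ⟩ := hm
      have h := ((isIsotypic_tensorList (σ := σ) (fun m => (hS m).1) hl hγ).congr hiso.symm).twist γ⁻¹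
      rw [maxAct_maxAct, inv_mul_cancel, maxAct_one] at h
      exact ⟨_, twist_spec _ (hS _), h⟩
    · exact ⟨trivial L, htriv', htriv m fun γ hγ => hm ⟨γ, hγ⟩⟩
  choose R hR hRm using hex
  refine ⟨fun m => isoClass (R m) (hR m), ⟨fun γ m => ?_, ?_⟩, fun m => ⟨R m, hR m, rfl, hRm m⟩⟩
  · exact isoClass_eq_of_isIsotypic T hfree hV.2.1 (hR _) (twist_spec _ (hR m))
      (hRm _) ((hRm m).twist γ)
  -- The type is trivial outside the orbits of the finite list, and these orbits are finite.
  · refine Set.Finite.subset (s := ⋃ γ : Γ, (maxAct τ γ) '' {m | m ∈ l})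
      (Set.finite_iUnion fun γ => l.finite_toSet.image _) fun m hm => ?_
    by_contra hml
    refine hm (isoClass_eq_of_isIsotypic T hfree hV.2.1 (hR m) htriv' (hRm m)
      (htriv m fun γ hγ => hml ?_))
    refine Set.mem_iUnion.2 ⟨γ⁻¹, maxAct τ γ m, hγ, ?_⟩
    rw [maxAct_maxAct, inv_mul_cancel, maxAct_one]

/-- A finite-dimensional irreducible module is determined by its types. -/
theorem plainIso_evalProduct (T : Triangular L)
    (hfree : ∀ (γ : Γ) (m : MaximalSpectrum A), maxAct τ γ m = m → γ = 1)
    (hT : T.HasCoroots) (hL : Perfect L)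
    {V : SuperModule (equivMap σ τ).Elt}
    (hV : FiniteDimensional ℂ V.carrier ∧ V.IsIrreducible) {π : MaximalSpectrum A → Irred L}
    (hπ : ∀ m, ∃ (S : SuperModule L) (hS : FiniteDimensional ℂ S.carrier ∧ S.IsIrreducible),
      isoClass S hS = π m ∧ IsIsotypic σ V m S)
    {l : List (MaximalSpectrum A)} (hl : IsSuppStar τ π l) :
    PlainIso V (evalProduct σ τ π l) := by
  have := Fintype.ofFinite Γ
  have hfd := hV.1
  obtain ⟨s, hs⟩ := exists_isGaloisSystem hfree
  have := finite_quotient_fixedAnn (V := V) hs hL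
  -- The decomposition needs a list meeting all orbits of points that contain `fixedAnn V`. The list
  -- prescribed for `π` is therefore completed by `l'`; the types at the added points turn out to be
  -- trivial, because every orbit in the support of `π` already meets `l`.
  obtain ⟨l', -, hll', hlV⟩ := exists_orbit_representatives τ (finite_setOf_le (fixedAnn V)) hl.2.2
  obtain ⟨S, hS, hiso⟩ := exists_evalModule_decomposition T hT hfree hV.1 hV.2 (l ++ l') hll' hlV
  have hSm : ∀ m ∈ l ++ l', isoClass (S m) (hS m) = π m := by
    intro m hm
    obtain ⟨R, hR, hRm, h⟩ := hπ m
    rw [← hRm]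
    exact isoClass_eq_of_isIsotypic T hfree hV.2.1 _ _
      ((isIsotypic_tensorList (fun m => (hS m).1) hll' hm).congr hiso.symm) h
  have hl' : ∀ m ∈ l', π m = trivialClass L := by
    intro m hm
    by_contra hne
    obtain ⟨γ, hγ⟩ := hl.2.1 m hne
    refine (List.pairwise_append.1 hll').2.2 _ hγ m hm γ⁻¹ ?_
    rw [maxAct_maxAct, inv_mul_cancel, maxAct_one]
  have heval : ∀ (m : MaximalSpectrum A) {S S' : SuperModule L}, Iso S S' →
      Iso (evalModule σ τ m S) (evalModule σ τ m S') := by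
    rintro m S S' ⟨d, f, h1, h2⟩
    exact ⟨d, f, h1, fun i x hx v => h2 i _ ((evalAt σ τ m).map_mem hx) v⟩
  rw [List.map_append] at hiso
  refine hiso.trans ((plainIso_tensorList_append fun W hW => ?_).trans
    (plainIso_tensorList ?_))
  · obtain ⟨m, hm, rfl⟩ := List.mem_map.1 hW
    have h1 : Iso (S m) (trivial L) := isoClass_eq_iff.1
      ((hSm m (List.mem_append_right _ hm)).trans (hl' m hm))
    exact (heval m h1).trans ⟨0, LinearEquiv.refl ℂ ℂ, fun i v => by rw [add_zero]; exact Iff.rfl,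
      fun i x _ v => by rw [ksign_zero_left, one_smul]; rfl⟩
  · rw [List.forall₂_map_left_iff, List.forall₂_map_right_iff, List.forall₂_same]
    intro m hm
    exact heval m (isoClass_eq_iff.1
      ((hSm m (List.mem_append_left _ hm)).trans (isoClass_rep (π m)).symm))

/-- The classification of the finite-dimensional irreducible modules of an equivariant map
superalgebra, for a perfect Lie superalgebra with a triangular decomposition. -/
theorem bijective_isoClass_evalProduct (T : Triangular L)
    (hfree : ∀ (γ : Γ) (m : MaximalSpectrum A), maxAct τ γ m = m → γ = 1)
    (hT : T.HasCoroots) (hL : Perfect L)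
    (s : FinSuppMaps σ τ → List (MaximalSpectrum A)) (hs : ∀ π, IsSuppStar τ π.1 (s π)) :
    ∃ h : ∀ π, FiniteDimensional ℂ (evalProduct σ τ π.1 (s π)).carrier ∧
        (evalProduct σ τ π.1 (s π)).IsIrreducible,
      Function.Bijective fun π : FinSuppMaps σ τ =>
        isoClass (evalProduct σ τ π.1 (s π)) (h π) := by
  refine ⟨fun π => ⟨finiteDimensional_evalProduct _ _, (fullOn_evalProduct T hfree π.1
    (hs π)).isIrreducible (nontrivial_evalProduct _ _)⟩, fun π π' h => ?_, fun c => ?_⟩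
  · exact Subtype.ext (eq_of_iso_evalProduct T hfree π.2 π'.2 (hs π) (hs π')
      (isoClass_eq_iff.1 h).plainIso)
  · obtain ⟨π, hπ, h⟩ := exists_types T hfree hT hL (rep_spec c)
    refine ⟨⟨π, hπ⟩, ?_⟩
    have h1 := plainIso_evalProduct T hfree hT hL (rep_spec c) h (hs ⟨π, hπ⟩)
    refine Eq.trans (isoClass_eq_iff.2 ?_) (isoClass_rep c)
    exact h1.symm.iso (fullOn_evalProduct T hfree π (hs ⟨π, hπ⟩))

end Classification

end EquivMap
end

noncomputable section

namespace EquivMap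

open LieSuperalgebra SuperModule

/-! ### The periplectic Lie superalgebra -/

/-- A vector `x` of nonzero weight `k` equals `[H, x] / k`; weight zero is covered by the coroots,
since the odd part there is zero. -/
theorem Triangular.perfect {L : Type*} [AddCommGroup L] [Module ℂ L] [LieSuperalgebra L]
    {T : Triangular L} (hT : T.HasCoroots) : Perfect L := by
  refine eq_top_iff.2 (T.iSup_eq_top.symm.le.trans (iSup_le fun k => iSup_le fun i => ?_))
  by_cases hk : k = 0
  · subst hk
    rcases zmod2_cases i with rfl | rfl
    · refine hT.trans (Submodule.span_mono ?_)
      rintro _ ⟨k, -, e, -, f, -, rfl⟩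
      exact ⟨e, f, rfl⟩
    · rw [T.zero_one]
      exact bot_le
  · intro x hx
    have h : x = (k : ℂ)⁻¹ • br T.H x := by
      rw [T.br_H hx, smul_smul, inv_mul_cancel₀ (Int.cast_ne_zero.2 hk), one_smul]
    rw [h]
    exact Submodule.smul_mem _ _ (Submodule.subset_span ⟨_, _, rfl⟩)

section Peri

variable {n : ℕ}

/-- The element of `p(n)` with given blocks. -/
def periMk (A B C : Matrix (Fin (n + 1)) (Fin (n + 1)) ℂ) (hA : A.trace = 0)
    (hB : B.transpose = B) (hC : C.transpose = -C) : Peri n :=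
  ⟨Matrix.fromBlocks A B C (-A.transpose), A, B, C, hA, hB, hC, rfl⟩

theorem transpose_zero_eq_neg :
    (0 : Matrix (Fin (n + 1)) (Fin (n + 1)) ℂ).transpose = -0 := by
  rw [Matrix.transpose_zero, neg_zero]

theorem val_periMk {A B C : Matrix (Fin (n + 1)) (Fin (n + 1)) ℂ} {hA : A.trace = 0}
    {hB : B.transpose = B} {hC : C.transpose = -C} :
    (periplectic n).val (periMk A B C hA hB hC) = Matrix.fromBlocks A B C (-A.transpose) := rfl

theorem exists_periMk (x : Peri n) : ∃ A B C hA hB hC, x = periMk A B C hA hB hC := by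
  obtain ⟨_, A, B, C, hA, hB, hC, rfl⟩ := x
  exact ⟨A, B, C, hA, hB, hC, rfl⟩

theorem periMk_mem_even {A : Matrix (Fin (n + 1)) (Fin (n + 1)) ℂ} {hA : A.trace = 0}
    {hB : Matrix.transpose 0 = 0} {hC : Matrix.transpose 0 = -0} :
    periMk A 0 0 hA hB hC ∈ homog (Peri n) 0 := ⟨rfl, rfl⟩

theorem periMk_mem_odd {B C : Matrix (Fin (n + 1)) (Fin (n + 1)) ℂ} {hA : Matrix.trace 0 = 0}
    {hB : B.transpose = B} {hC : C.transpose = -C} :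
    periMk 0 B C hA hB hC ∈ homog (Peri n) 1 :=
  ⟨rfl, by ext i j; simp [val_periMk]⟩

theorem exists_of_mem_even {x : Peri n} (hx : x ∈ homog (Peri n) 0) :
    ∃ A hA, x = periMk A 0 0 hA Matrix.transpose_zero transpose_zero_eq_neg := by
  obtain ⟨A, B, C, hA, hB, hC, rfl⟩ := exists_periMk x
  obtain ⟨h1, h2⟩ := hx
  obtain rfl : B = 0 := h1
  obtain rfl : C = 0 := h2
  exact ⟨A, hA, rfl⟩

theorem exists_of_mem_odd {x : Peri n} (hx : x ∈ homog (Peri n) 1) :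
    ∃ B C hB hC, x = periMk 0 B C (Matrix.trace_zero _ _) hB hC := by
  obtain ⟨A, B, C, hA, hB, hC, rfl⟩ := exists_periMk x
  obtain ⟨h1, h2⟩ := hx
  obtain rfl : A = 0 := h1
  exact ⟨B, C, hB, hC, rfl⟩

theorem val_br_periMk_even {A A' : Matrix (Fin (n + 1)) (Fin (n + 1)) ℂ} {hA : A.trace = 0}
    {hA' : A'.trace = 0} {B C : Matrix (Fin (n + 1)) (Fin (n + 1)) ℂ} {hB : B.transpose = B}
    {hC : C.transpose = -C} {hB₀ : Matrix.transpose 0 = 0} {hC₀ : Matrix.transpose 0 = -0} :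
    (periplectic n).val (br (periMk A 0 0 hA hB₀ hC₀) (periMk A' B C hA' hB hC)) =
      Matrix.fromBlocks (A * A' - A' * A) (A * B + B * A.transpose) (-A.transpose * C - C * A)
        (-(A * A' - A' * A).transpose) := by
  refine (glBracket_fromBlocks A 0 0 (-A.transpose) A' B C (-A'.transpose)).trans ?_
  congr 1 <;> simp [Matrix.transpose_sub, Matrix.transpose_mul]

/-! ### Weights and coroots of `p(n)` for an integral diagonal element -/

variable (h : Fin (n + 1) → ℤ)

/-- The diagonal element with given eigenvalues. -/
def periDiag (hsum : ∑ i, h i = 0) : Peri n :=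
  periMk (Matrix.diagonal fun i => (h i : ℂ)) 0 0
    (by rw [Matrix.trace_diagonal]; exact_mod_cast hsum) Matrix.transpose_zero transpose_zero_eq_neg

/-- The roots of `p(n)`: the entries at `(i, j)` of the three blocks have weights `h i - h j`, `h i
+ h j` and `-(h i + h j)`. The fourth block imposes nothing new. -/
theorem br_periDiag_eq_smul_iff (hsum : ∑ i, h i = 0) (k : ℤ)
    {A B C : Matrix (Fin (n + 1)) (Fin (n + 1)) ℂ} {hA : A.trace = 0} {hB : B.transpose = B}
    {hC : C.transpose = -C} :
    br (periDiag h hsum) (periMk A B C hA hB hC) = (k : ℂ) • periMk A B C hA hB hC ↔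
      (∀ i j, h i - h j ≠ k → A i j = 0) ∧ (∀ i j, h i + h j ≠ k → B i j = 0) ∧
        ∀ i j, h i + h j ≠ -k → C i j = 0 := by
  have key : ∀ (a b : ℤ) (z : ℂ), ((a : ℂ) * z = b * z) ↔ (a ≠ b → z = 0) := by
    intro a b z
    rw [mul_eq_mul_right_iff, Int.cast_inj]
    tauto
  rw [← (periplectic n).val_injective.eq_iff, periDiag, val_br_periMk_even, map_smul, val_periMk,
    Matrix.fromBlocks_smul, Matrix.fromBlocks_inj]
  have e1 : Matrix.diagonal (fun i => (h i : ℂ)) * A - A * Matrix.diagonal (fun i => (h i : ℂ)) =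
      (k : ℂ) • A ↔ ∀ i j, h i - h j ≠ k → A i j = 0 := by
    rw [← Matrix.ext_iff]
    refine forall_congr' fun i => forall_congr' fun j => ?_
    rw [← key, Matrix.sub_apply, Matrix.diagonal_mul, Matrix.mul_diagonal, Matrix.smul_apply,
      smul_eq_mul]
    push_cast
    rw [sub_mul, mul_comm (A i j)]
  have e2 : Matrix.diagonal (fun i => (h i : ℂ)) * B +
      B * (Matrix.diagonal fun i => (h i : ℂ)).transpose =
      (k : ℂ) • B ↔ ∀ i j, h i + h j ≠ k → B i j = 0 := by
    rw [← Matrix.ext_iff]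
    refine forall_congr' fun i => forall_congr' fun j => ?_
    rw [← key, Matrix.diagonal_transpose, Matrix.add_apply, Matrix.diagonal_mul,
      Matrix.mul_diagonal, Matrix.smul_apply, smul_eq_mul]
    push_cast
    rw [add_mul, mul_comm (B i j)]
  have e3 : -(Matrix.diagonal fun i => (h i : ℂ)).transpose * C -
      C * Matrix.diagonal (fun i => (h i : ℂ)) =
      (k : ℂ) • C ↔ ∀ i j, h i + h j ≠ -k → C i j = 0 := by
    rw [← Matrix.ext_iff]
    refine forall_congr' fun i => forall_congr' fun j => ?_
    rw [← key, Matrix.diagonal_transpose, Matrix.sub_apply, neg_mul, Matrix.neg_apply,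
      Matrix.diagonal_mul, Matrix.mul_diagonal, Matrix.smul_apply, smul_eq_mul]
    push_cast
    constructor <;> intro hh <;> linear_combination -hh
  rw [e1, e2, e3]
  refine ⟨fun ⟨a, b, c, _⟩ => ⟨a, b, c⟩, fun ⟨a, b, c⟩ => ⟨a, b, c, ?_⟩⟩
  rw [e1.2 a, Matrix.transpose_smul, smul_neg]

/-- The homogeneous weight spaces of a diagonal element. -/
def periWeight (hsum : ∑ i, h i = 0) (k : ℤ) (i : ZMod 2) : Submodule ℂ (Peri n) :=
  homog (Peri n) i ⊓ LinearMap.ker (br (periDiag h hsum) - (k : ℂ) • LinearMap.id)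

theorem mem_periWeight {hsum : ∑ i, h i = 0} {k : ℤ} {i : ZMod 2} {x : Peri n} :
    x ∈ periWeight h hsum k i ↔
      x ∈ homog (Peri n) i ∧ br (periDiag h hsum) x = (k : ℂ) • x := by
  rw [periWeight, Submodule.mem_inf, LinearMap.mem_ker, LinearMap.sub_apply, sub_eq_zero]
  rfl

theorem periDiag_even (hsum : ∑ i, h i = 0) : periDiag h hsum ∈ homog (Peri n) 0 :=
  periMk_mem_even

theorem periMk_eq_sum {A B C : Matrix (Fin (n + 1)) (Fin (n + 1)) ℂ} {hA : A.trace = 0}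
    {hB : B.transpose = B} {hC : C.transpose = -C} {ι : Type*} (s : Finset ι)
    {A' B' C' : ι → Matrix (Fin (n + 1)) (Fin (n + 1)) ℂ} {hA' : ∀ k, (A' k).trace = 0}
    {hB' : ∀ k, (B' k).transpose = B' k} {hC' : ∀ k, (C' k).transpose = -C' k}
    (h1 : A = ∑ k ∈ s, A' k) (h2 : B = ∑ k ∈ s, B' k) (h3 : C = ∑ k ∈ s, C' k) :
    periMk A B C hA hB hC = ∑ k ∈ s, periMk (A' k) (B' k) (C' k) (hA' k) (hB' k) (hC' k) := by
  refine (periplectic n).val_injective ?_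
  rw [map_sum]
  ext (i | i) (j | j) <;>
    simp [val_periMk, h1, h2, h3, Matrix.sum_apply]

/-- Each block is cut into pieces according to the weights of its entries. In the odd blocks the
weight is symmetric in `i` and `j`, so the pieces remain symmetric or skew-symmetric; in the even
block all diagonal entries have weight zero, so the pieces remain traceless. -/
theorem iSup_periWeight (hsum : ∑ i, h i = 0) :
    ⨆ k, ⨆ i, periWeight h hsum k i = ⊤ := by
  classical
  refine eq_top_iff.2 fun x _ => ?_
  have hmem : ∀ {k i x}, x ∈ periWeight h hsum k i → x ∈ ⨆ k, ⨆ i, periWeight h hsum k i :=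
    fun {k i x} hx => Submodule.mem_iSup_of_mem k (Submodule.mem_iSup_of_mem i hx)
  refine homog_induction (p := fun x => x ∈ ⨆ k, ⨆ i, periWeight h hsum k i)
    (fun x y hx hy => add_mem hx hy) (fun i x hx => ?_) x
  rcases zmod2_cases i with rfl | rfl
  · obtain ⟨A, hA, rfl⟩ := exists_of_mem_even hx
    let s : Finset ℤ := Finset.univ.image fun p : Fin (n + 1) × Fin (n + 1) => h p.1 - h p.2
    have htr : ∀ k, (Matrix.of fun i j => if h i - h j = k then A i j else 0).trace = 0 := fun k => by
      simp only [Matrix.trace, Matrix.diag_apply, Matrix.of_apply, sub_self]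
      by_cases hk : 0 = k
      · simpa [hk, Matrix.trace] using hA
      · simp [hk]
    have hsA : A = ∑ k ∈ s, Matrix.of fun i j => if h i - h j = k then A i j else 0 := by
      ext i j
      rw [Matrix.sum_apply]
      simp only [Matrix.of_apply]
      rw [Finset.sum_ite_eq, if_pos]
      exact Finset.mem_image.2 ⟨(i, j), Finset.mem_univ _, rfl⟩
    rw [periMk_eq_sum s (B' := fun _ => 0) (C' := fun _ => 0) (hA' := htr)
      (hB' := fun _ => Matrix.transpose_zero) (hC' := fun _ => transpose_zero_eq_neg) hsA
      Finset.sum_const_zero.symm Finset.sum_const_zero.symm]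
    refine sum_mem fun k _ => hmem (k := k) (i := 0)
      ((mem_periWeight h).2 ⟨periMk_mem_even, (br_periDiag_eq_smul_iff h hsum k).2 ?_⟩)
    exact ⟨fun i j hij => if_neg hij, fun _ _ _ => rfl, fun _ _ _ => rfl⟩
  · obtain ⟨B, C, hB, hC, rfl⟩ := exists_of_mem_odd hx
    let s : Finset ℤ := (Finset.univ.image fun p : Fin (n + 1) × Fin (n + 1) => h p.1 + h p.2) ∪
      Finset.univ.image fun p : Fin (n + 1) × Fin (n + 1) => -(h p.1 + h p.2)
    have hB' : ∀ k, (Matrix.of fun i j => if h i + h j = k then B i j else 0).transpose =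
        Matrix.of fun i j => if h i + h j = k then B i j else 0 := fun k => by
      ext i j
      have hij := Matrix.ext_iff.2 hB i j
      rw [Matrix.transpose_apply] at hij
      simp only [Matrix.transpose_apply, Matrix.of_apply, add_comm (h j), hij]
    have hC' : ∀ k, (Matrix.of fun i j => if -(h i + h j) = k then C i j else 0).transpose =
        -Matrix.of fun i j => if -(h i + h j) = k then C i j else 0 := fun k => by
      ext i j
      have hij := Matrix.ext_iff.2 hC i j
      rw [Matrix.transpose_apply, Matrix.neg_apply] at hij
      simp only [Matrix.transpose_apply, Matrix.of_apply, Matrix.neg_apply, add_comm (h j), hij]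
      split_ifs <;> simp
    have hsB : B = ∑ k ∈ s, Matrix.of fun i j => if h i + h j = k then B i j else 0 := by
      ext i j
      rw [Matrix.sum_apply]
      simp only [Matrix.of_apply]
      rw [Finset.sum_ite_eq, if_pos]
      exact Finset.mem_union_left _ (Finset.mem_image.2 ⟨(i, j), Finset.mem_univ _, rfl⟩)
    have hsC : C = ∑ k ∈ s, Matrix.of fun i j => if -(h i + h j) = k then C i j else 0 := by
      ext i j
      rw [Matrix.sum_apply]
      simp only [Matrix.of_apply]
      rw [Finset.sum_ite_eq, if_pos]
      exact Finset.mem_union_right _ (Finset.mem_image.2 ⟨(i, j), Finset.mem_univ _, rfl⟩)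
    rw [periMk_eq_sum s (A' := fun _ => 0) (hA' := fun _ => Matrix.trace_zero _ _) (hB' := hB')
      (hC' := hC') Finset.sum_const_zero.symm hsB hsC]
    refine sum_mem fun k _ => hmem (k := k) (i := 1)
      ((mem_periWeight h).2 ⟨periMk_mem_odd, (br_periDiag_eq_smul_iff h hsum k).2 ?_⟩)
    exact ⟨fun _ _ _ => rfl, fun i j hij => if_neg hij,
      fun i j hij => if_neg fun hh => hij (by rw [← hh, neg_neg])⟩

/-- The elements of weight zero are diagonal. -/
theorem exists_diagonal_of_mem_periWeight (hinj : Function.Injective h) {hsum : ∑ i, h i = 0}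
    {x : Peri n} (hx : x ∈ periWeight h hsum 0 0) :
    ∃ (d : Fin (n + 1) → ℂ) (hd : (Matrix.diagonal d).trace = 0),
      x = periMk (Matrix.diagonal d) 0 0 hd Matrix.transpose_zero transpose_zero_eq_neg := by
  obtain ⟨hx0, hx⟩ := (mem_periWeight h).1 hx
  obtain ⟨A, hA, rfl⟩ := exists_of_mem_even hx0
  rw [br_periDiag_eq_smul_iff] at hx
  obtain ⟨d, rfl⟩ : ∃ d, A = Matrix.diagonal d := by
    refine ⟨A.diag, ?_⟩
    ext i j
    by_cases hij : i = j
    · subst hij; simp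
    · rw [Matrix.diagonal_apply_ne _ hij]
      exact hx.1 i j fun h0 => hij (hinj (sub_eq_zero.1 h0))
  exact ⟨_, hA, rfl⟩

/-- The triangular decomposition of `p(n)` given by a diagonal element in general position. -/
def periTriangular (hinj : Function.Injective h) (hne : ∀ i j, h i + h j ≠ 0)
    (hsum : ∑ i, h i = 0) : Triangular (Peri n) where
  H := periDiag h hsum
  R := periWeight h hsum
  H_even := periDiag_even h hsum
  le_homog := fun _ _ => inf_le_left
  br_H := fun hx => ((mem_periWeight h).1 hx).2
  br_mem := by
    intro k l i j x y hx hy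
    rw [mem_periWeight] at hx hy ⊢
    refine ⟨LieSuperalgebra.br_mem hx.1 hy.1, ?_⟩
    rw [br_jacobi (periDiag_even h hsum) hx.1, hx.2, hy.2, ksign_zero_left, one_smul, map_smul,
      map_smul, LinearMap.smul_apply, ← add_smul]
    push_cast
    rfl
  iSup_eq_top := iSup_periWeight h hsum
  zero_one := by
    refine eq_bot_iff.2 fun x hx => ?_
    obtain ⟨hx1, hx⟩ := (mem_periWeight h).1 hx
    obtain ⟨B, C, hB, hC, rfl⟩ := exists_of_mem_odd hx1
    rw [br_periDiag_eq_smul_iff] at hx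
    obtain rfl : B = 0 := by ext i j; exact hx.2.1 i j (hne i j)
    obtain rfl : C = 0 := by ext i j; exact hx.2.2 i j (by simpa using hne i j)
    refine (Submodule.mem_bot ℂ).2 ((periplectic n).val_injective ?_)
    rw [val_periMk, map_zero]
    simp
  zero_comm := by
    intro x y hx hy
    obtain ⟨d, hd, rfl⟩ := exists_diagonal_of_mem_periWeight h hinj hx
    obtain ⟨d', hd', rfl⟩ := exists_diagonal_of_mem_periWeight h hinj hy
    refine (periplectic n).val_injective ?_
    rw [val_br_periMk_even, map_zero, Matrix.diagonal_mul_diagonal, Matrix.diagonal_mul_diagonal]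
    simp [mul_comm]

/-- The matrices `E_ii - E_00` span the traceless diagonal ones, and `E_ii - E_00 = [E_i0, E_0i]`.
Whether this bracket or its negative has the positive root vector first depends on the order of `h
i` and `h 0`. -/
theorem periTriangular_hasCoroots {hinj : Function.Injective h} {hne : ∀ i j, h i + h j ≠ 0}
    {hsum : ∑ i, h i = 0} : (periTriangular h hinj hne hsum).HasCoroots := by
  intro x hx
  obtain ⟨d, hd, rfl⟩ := exists_diagonal_of_mem_periWeight h hinj hx
  set N := Submodule.span ℂ {z | ∃ k : ℤ, 0 < k ∧ ∃ e ∈ periWeight h hsum k 0,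
    ∃ f ∈ periWeight h hsum (-k) 0, z = br e f}
  have htr : ∀ i : Fin (n + 1),
      (Matrix.single i i (1 : ℂ) - Matrix.single 0 0 1).trace = 0 := fun i => by simp
  have htr' : ∀ i j : Fin (n + 1), i ≠ j → (Matrix.single i j (1 : ℂ)).trace = 0 :=
    fun i j hij => Matrix.trace_single_eq_of_ne _ _ _ hij
  have hroot : ∀ (i j : Fin (n + 1)) (hij : i ≠ j),
      periMk (Matrix.single i j 1) 0 0 (htr' i j hij) Matrix.transpose_zero transpose_zero_eq_neg ∈
        periWeight h hsum (h i - h j) 0 := by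
    intro i j hij
    refine (mem_periWeight h).2 ⟨periMk_mem_even, ?_⟩
    rw [br_periDiag_eq_smul_iff]
    refine ⟨fun i' j' hne => Matrix.single_apply_of_ne _ _ _ _ _ ?_, fun _ _ _ => rfl, fun _ _ _ => rfl⟩
    rintro ⟨rfl, rfl⟩
    exact hne rfl
  have hcor : ∀ i, periMk _ 0 0 (htr i) Matrix.transpose_zero transpose_zero_eq_neg ∈ N := by
    intro i
    by_cases hi : i = 0
    · subst hi
      convert zero_mem N using 1
      refine (periplectic n).val_injective ?_
      rw [val_periMk, map_zero]
      simp
    · have hbr : ∀ (i j : Fin (n + 1)) (hij : i ≠ j),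
          (periplectic n).val (br (periMk (Matrix.single i j 1) 0 0 (htr' i j hij) Matrix.transpose_zero transpose_zero_eq_neg)
            (periMk (Matrix.single j i 1) 0 0 (htr' j i hij.symm) Matrix.transpose_zero transpose_zero_eq_neg)) =
          Matrix.fromBlocks (Matrix.single i i (1 : ℂ) - Matrix.single j j 1) 0 0
            (-(Matrix.single i i (1 : ℂ) - Matrix.single j j 1).transpose) := by
        intro i j hij
        rw [val_br_periMk_even]
        simp
      have hne0 : h i ≠ h 0 := fun h0 => hi (hinj h0)
      rcases lt_or_gt_of_ne hne0 with hlt | hlt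
      · have h1 : periMk _ 0 0 (htr i) Matrix.transpose_zero transpose_zero_eq_neg =
            -br (periMk (Matrix.single 0 i 1) 0 0 (htr' 0 i (Ne.symm hi)) Matrix.transpose_zero transpose_zero_eq_neg)
              (periMk (Matrix.single i 0 1) 0 0 (htr' i 0 hi) Matrix.transpose_zero transpose_zero_eq_neg) := by
          refine (periplectic n).val_injective ?_
          rw [val_periMk, map_neg, hbr 0 i (Ne.symm hi), Matrix.fromBlocks_neg]
          simp
        rw [h1]
        refine neg_mem (Submodule.subset_span ⟨h 0 - h i, sub_pos.2 hlt, _,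
          hroot 0 i (Ne.symm hi), _, ?_, rfl⟩)
        rw [neg_sub]
        exact hroot i 0 hi
      · have h1 : periMk _ 0 0 (htr i) Matrix.transpose_zero transpose_zero_eq_neg =
            br (periMk (Matrix.single i 0 1) 0 0 (htr' i 0 hi) Matrix.transpose_zero transpose_zero_eq_neg)
              (periMk (Matrix.single 0 i 1) 0 0 (htr' 0 i (Ne.symm hi)) Matrix.transpose_zero transpose_zero_eq_neg) := by
          refine (periplectic n).val_injective ?_
          rw [val_periMk, hbr i 0 hi]
        rw [h1]
        refine Submodule.subset_span ⟨h i - h 0, sub_pos.2 hlt, _, hroot i 0 hi, _, ?_, rfl⟩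
        rw [neg_sub]
        exact hroot 0 i (Ne.symm hi)
  have hsumd : ∑ i, d i = 0 := by rwa [Matrix.trace_diagonal] at hd
  have hdiag : Matrix.diagonal d = ∑ i, d i • (Matrix.single i i (1 : ℂ) - Matrix.single 0 0 1) := by
    simp only [smul_sub, Finset.sum_sub_distrib]
    rw [← Finset.sum_smul, hsumd, zero_smul, sub_zero]
    ext i j
    rw [Matrix.sum_apply, Matrix.diagonal_apply]
    simp [Matrix.single_apply, ite_and, eq_comm]
  have hx' : periMk (Matrix.diagonal d) 0 0 hd Matrix.transpose_zero transpose_zero_eq_neg =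
      ∑ i, d i • periMk _ 0 0 (htr i) Matrix.transpose_zero transpose_zero_eq_neg := by
    have h1 := periMk_eq_sum (hA := hd) (hB := Matrix.transpose_zero) (hC := transpose_zero_eq_neg) Finset.univ
      (A' := fun i => d i • (Matrix.single i i (1 : ℂ) - Matrix.single 0 0 1)) (B' := fun _ => 0)
      (C' := fun _ => 0) (hA' := fun i => by rw [Matrix.trace_smul, htr, smul_zero])
      (hB' := fun _ => Matrix.transpose_zero)
      (hC' := fun _ => transpose_zero_eq_neg) hdiag (B := 0) (C := 0) (by simp) (by simp)
    rw [h1]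
    refine Finset.sum_congr rfl fun i _ => (periplectic n).val_injective ?_
    rw [map_smul, val_periMk, val_periMk, Matrix.fromBlocks_smul, smul_zero, smul_neg,
      Matrix.transpose_smul]
  rw [hx']
  exact sum_mem fun i _ => N.smul_mem _ (hcor i)

/-- Integers of sum zero in general position. -/
theorem exists_general_position (hn : 2 ≤ n) : ∃ h : Fin (n + 1) → ℤ, Function.Injective h ∧
    (∀ i j, h i + h j ≠ 0) ∧ ∑ i, h i = 0 := by
  have hpow : ∀ i : ℕ, (0 : ℤ) < 2 ^ i := fun i => by positivity
  have hlt : ∀ i : Fin n, (2 : ℤ) ^ (i : ℕ) ≠ 2 ^ n - 1 := by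
    intro i hi
    have h1 : (2 : ℤ) ∣ 2 ^ n := dvd_pow_self 2 (by omega)
    rcases Nat.eq_zero_or_pos (i : ℕ) with h0 | h0
    · rw [h0, pow_zero] at hi
      have h2 : (4 : ℤ) ≤ 2 ^ n := by
        calc (4 : ℤ) = 2 ^ 2 := by norm_num
          _ ≤ 2 ^ n := pow_le_pow_right₀ (by norm_num) hn
      omega
    · have h2 : (2 : ℤ) ∣ 2 ^ (i : ℕ) := dvd_pow_self 2 (by omega)
      omega
  -- The entries are `1, 2, 4, …, 2 ^ (n - 1)` and minus their sum `2 ^ n - 1`. A sum of two entries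
  -- could vanish only if `2 ^ n - 1` were one of these powers of two, which `n ≥ 2` excludes.
  refine ⟨Fin.snoc (α := fun _ => ℤ) (fun i : Fin n => (2 : ℤ) ^ (i : ℕ)) (-(2 ^ n - 1)), ?_, ?_, ?_⟩
  · intro i j
    have h4 : (1 : ℤ) < 2 ^ n := one_lt_pow₀ (by norm_num) (by omega)
    refine Fin.lastCases ?_ (fun i => ?_) i <;> refine Fin.lastCases ?_ (fun j => ?_) j
    · simp
    · intro hij
      simp only [Fin.snoc_last, Fin.snoc_castSucc] at hij
      have := hpow j
      omega
    · intro hij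
      simp only [Fin.snoc_last, Fin.snoc_castSucc] at hij
      have := hpow i
      omega
    · intro hij
      simp only [Fin.snoc_castSucc] at hij
      rw [Fin.ext (pow_right_injective₀ (by norm_num) (by norm_num) hij)]
  · intro i j
    have h4 : (1 : ℤ) < 2 ^ n := one_lt_pow₀ (by norm_num) (by omega)
    refine Fin.lastCases ?_ (fun i => ?_) i <;> refine Fin.lastCases ?_ (fun j => ?_) j
    · simp only [Fin.snoc_last]
      omega
    · simp only [Fin.snoc_last, Fin.snoc_castSucc]
      have := hlt j
      omega
    · simp only [Fin.snoc_last, Fin.snoc_castSucc]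
      have := hlt i
      omega
    · simp only [Fin.snoc_castSucc]
      have := hpow i
      have := hpow j
      omega
  · rw [Fin.sum_univ_castSucc]
    simp only [Fin.snoc_last, Fin.snoc_castSucc]
    rw [Fin.sum_univ_eq_sum_range fun i => (2 : ℤ) ^ i]
    have := mul_geom_sum (2 : ℤ) n
    linarith

end Peri

end EquivMap
end

theorem mainTheorem1 (n : ℕ) (hn : 2 ≤ n)
    {A : Type*} [CommRing A] [Algebra ℂ A] [Algebra.FiniteType ℂ A]
    {Γ : Type*} [CommGroup Γ] [Finite Γ]
    (σ : Γ →* EquivMap.superAut (EquivMap.Peri n)) (τ : Γ →* (A ≃ₐ[ℂ] A))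
    (hfree : ∀ (γ : Γ) (m : MaximalSpectrum A), EquivMap.maxAct τ γ m = m → γ = 1) :
    (∀ π ∈ EquivMap.FinSuppMaps σ τ, ∃ l, EquivMap.IsSuppStar τ π l) ∧
    ∀ s : EquivMap.FinSuppMaps σ τ → List (MaximalSpectrum A),
      (∀ π, EquivMap.IsSuppStar τ π.1 (s π)) →
      ∃ h : ∀ π, FiniteDimensional ℂ (EquivMap.evalProduct σ τ π.1 (s π)).carrier ∧
          (EquivMap.evalProduct σ τ π.1 (s π)).IsIrreducible,
        Function.Bijective fun π : EquivMap.FinSuppMaps σ τ =>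
          EquivMap.SuperModule.isoClass (EquivMap.evalProduct σ τ π.1 (s π)) (h π) := by
  -- This is where `n ≥ 2` enters: for `n = 1` the vanishing of the sum would already give `h 0 + h
  -- 1 = 0`. Everything else depends only on the triangular decomposition and its coroots.
  obtain ⟨h, hinj, hne, hsum⟩ := EquivMap.exists_general_position hn
  have hT := EquivMap.periTriangular_hasCoroots h (hinj := hinj) (hne := hne) (hsum := hsum)
  exact ⟨fun π hπ => EquivMap.exists_isSuppStar hπ, fun s hs =>
    EquivMap.bijective_isoClass_evalProduct _ hfree hT (EquivMap.Triangular.perfect hT) s hs⟩
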